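/- **Setting.** Write $\sigma_3=\mathrm{diag}(1,-1)$, $\mathbb C_{13}$ (resp. $\mathbb C_{24}$) for the union of the open first and third (resp. second and fourth) quadrants, $*$ for complex conjugation and $\dagger$ for conjugate transposition. For a potential $q$ let $Q=\begin{pmatrix}0&q\\-q^*&0\end{pmatrix}$ and consider the spectral equation $J_x+i\zeta^2[\sigma_3,J]=\zeta QJ$ with Jost matrices $J_M\to I$ ($x\to-\infty$) and $J_P\to I$ ($x\to+\infty$), where $J_ME=J_PES$ for $\zeta\in\mathbb R\cup i\mathbb R$, $E=e^{-i\zeta^2x\sigma_3}$. The potential is reflectionless if $s_{12}=s_{21}=0$ on $\mathbb R\cup i\mathbb R$. Let $N\ge 0$, let $\zeta_1,\dots,\zeta_N\in\mathbb C_{13}$ with $\zeta_j\ne\pm\zeta_k$ for $j\neq k$, let $(a_k,b_k)\in\mathbb C^2\setminus\{0\}$, and put $$\theta_k=-i\zeta_k^2x-2i\zeta_k^6t,\qquad |v_k\rangle=e^{\theta_k\sigma_3}(a_k,b_k)^T,\qquad \langle v_k|=|v_k\rangle^\dagger,$$ $$M_{jk}=\frac{\langle v_k|\sigma_3|v_j\rangle}{\zeta_j+\zeta_k^*}-\frac{\langle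 v_k|v_j\rangle}{\zeta_j-\zeta_k^*}\quad(1\le j,k\le N),\qquad F=\begin{pmatrix}M&c\\ f&0\end{pmatrix},\quad G=\begin{pmatrix}M&c\\ g&0\end{pmatrix},$$ with the column $c=(|v_j\rangle_1)_j$ and the rows $f=(\langle v_k|_2/\zeta_k^{*2})_k$, $g=(\langle v_k|_1/\zeta_k^{*})_k$. For fixed $(x,t)$, the *reflectionless Riemann–Hilbert problem* asks for $P_+$, analytic on $\mathbb C_{13}$ and continuous up to $\mathbb R\cup i\mathbb R$, and $P_-$, analytic on $\mathbb C_{24}$ and continuous up to $\mathbb R\cup i\mathbb R$, with $P_-P_+=I$ on $\mathbb R\cup i\mathbb R$, $P_\pm(0)=I$, $P_+$ converging to an invertible matrix as $\zeta\to\infty$ in $\mathbb C_{13}\cup\mathbb R\cup i\mathbb R$, the symmetries $P_-(\zeta)=P_+(\zeta^*)^\dagger$ and $P_+(-\zeta)=\sigma_3P_+(\zeta)\sigma_3$, such that the zeros of $\det P_+$ in $\mathbb C_{13}$ are exactly $\pm\zeta_1,\dots,\pm\zeta_N$, all simple (so those of $\det P_-$ are the $\pm\zeta_k^*\in\mathbb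 C_{24}$), and $\ker P_+(\zeta_k)$ is spanned by $|v_k\rangle$. **Theorem.** 1. For all real $x,t$ one has $\det M\ne0$, $\det M+2\det G\neq0$, $1-\sum_{j,k}2(M^{-1})_{jk}|v_k\rangle_1\langle v_j|_1/\zeta_j^*\ne0$, and $$\frac{2\det F}{\det M+2\det G}=\Bigl(1-\sum_{j,k}\frac{2(M^{-1})_{jk}|v_k\rangle_1\langle v_j|_1}{\zeta_j^*}\Bigr)^{-1}\sum_{j,k}\frac{-2(M^{-1})_{jk}|v_k\rangle_1\langle v_j|_2}{\zeta_j^{*2}} .$$ Define $$q(x,t)=\Bigl(\frac{2\det F}{\det M+2\det G}\Bigr)_x .$$ 2. For all real $x,t$ the reflectionless Riemann–Hilbert problem has a solution. For every family of solutions $P_\pm(x,t;\zeta)$ one has $P_+=I+P^{(1)}(x,t)\,\zeta+O(\zeta^2)$ as $\zeta\to0$ in $\mathbb C_{13}\cup\mathbb R\cup i\mathbb R$, and the potential recovered from it is $q$: $\;(P^{(1)})_x=\begin{pmatrix}0&q\\-q^*&0\end{pmatrix}$. 3. If moreover $a_kb_k\neq0$ for all $k$, then for every $t$ the potential $q(\cdot,t)$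 is reflectionless, and $P_+$ is its matrix $[J_M^{(1)},J_P^{(2)}]$: for all $\zeta\in\mathbb C_{13}\cup\mathbb R\cup i\mathbb R$ it solves the spectral equation with potential $q(\cdot,t)$, its first column tends to $(1,0)^T$ as $x\to-\infty$, and its second column tends to $(0,1)^T$ as $x\to+\infty$. 4. $q$ is a $C^\infty$ function on $\mathbb R^2$; for every $t$, $q(\cdot,t)$ and all its $x$-derivatives decay faster than any power of $|x|$ as $x\to\pm\infty$; and $q$ solves the higher-order Kaup–Newell equation $$q_t=-\tfrac12q_{xxx}-\bigl(\tfrac{3i}{2}|q|^2q_x\bigr)_x+\bigl(\tfrac34|q|^4q\bigr)_x .$$ -/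

import Mathlib

open Complex Filter Topology
open scoped ComplexConjugate ContDiff Matrix

namespace HigherKN

noncomputable section

/-- The union of the open first and third quadrants of the spectral plane. -/
def C13 : Set ℂ := {z | 0 < z.re * z.im}

/-- The union of the open second and fourth quadrants of the spectral plane. -/
def C24 : Set ℂ := {z | z.re * z.im < 0}

/-- The contour: the union of the real and the imaginary axis. -/
def contour : Set ℂ := {z | z.re * z.im = 0}

/-- The third Pauli matrix. -/
def σ₃ : Matrix (Fin 2) (Fin 2) ℂ := !![1, 0; 0, -1]

/-- The potential matrix `Q` with entries `0, q, -q*, 0`. -/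
def potentialMatrix (w : ℂ) : Matrix (Fin 2) (Fin 2) ℂ := !![0, w; -conj w, 0]

/-- The phase `θ = -i ζ² x - 2 i ζ⁶ t`. -/
def phase (ζ : ℂ) (x t : ℝ) : ℂ := -I * ζ ^ 2 * x - 2 * I * ζ ^ 6 * t

/-- The kernel vector `e^{θ σ₃} (a, b)ᵀ`. -/
def kernelVector (ζ a b : ℂ) (x t : ℝ) : Fin 2 → ℂ :=
  ![a * exp (phase ζ x t), b * exp (-phase ζ x t)]

section Formula

variable {N : ℕ} (ζ : Fin N → ℂ) (v : Fin N → Fin 2 → ℂ)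

/-- `M_{jk} = ⟨v_k|σ₃|v_j⟩ / (ζ_j + ζ_k*) - ⟨v_k|v_j⟩ / (ζ_j - ζ_k*)`. -/
def matM : Matrix (Fin N) (Fin N) ℂ := Matrix.of fun j k =>
  (star (v k) ⬝ᵥ (σ₃ *ᵥ v j)) / (ζ j + conj (ζ k)) -
    (star (v k) ⬝ᵥ v j) / (ζ j - conj (ζ k))

/-- `M` bordered by the column of the `|v_j⟩₁` and by the row of the `⟨v_k|₂ / ζ_k*²`. -/
def matF : Matrix (Fin N ⊕ Unit) (Fin N ⊕ Unit) ℂ :=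
  Matrix.fromBlocks (matM ζ v) (Matrix.of fun j _ => v j 0)
    (Matrix.of fun _ k => conj (v k 1) / conj (ζ k) ^ 2) 0

/-- `M` bordered by the column of the `|v_j⟩₁` and by the row of the `⟨v_k|₁ / ζ_k*`. -/
def matG : Matrix (Fin N ⊕ Unit) (Fin N ⊕ Unit) ℂ :=
  Matrix.fromBlocks (matM ζ v) (Matrix.of fun j _ => v j 0)
    (Matrix.of fun _ k => conj (v k 0) / conj (ζ k)) 0

/-- `2 det F / (det M + 2 det G)`. -/
def detQuotient : ℂ := 2 * (matF ζ v).det / ((matM ζ v).det + 2 * (matG ζ v).det)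

/-- `1 - ∑_{j,k} 2 (M⁻¹)_{jk} |v_k⟩₁ ⟨v_j|₁ / ζ_j*`. -/
def sumDenominator : ℂ :=
  1 - ∑ j, ∑ k, 2 * (matM ζ v)⁻¹ j k * v k 0 * conj (v j 0) / conj (ζ j)

/-- `∑_{j,k} -2 (M⁻¹)_{jk} |v_k⟩₁ ⟨v_j|₂ / ζ_j*²`. -/
def sumNumerator : ℂ :=
  ∑ j, ∑ k, -2 * (matM ζ v)⁻¹ j k * v k 0 * conj (v j 1) / conj (ζ j) ^ 2

end Formula

/-- The potential `q(x,t) = (2 det F / (det M + 2 det G))_x` for the kernel vectors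
`e^{θ_k σ₃} (a_k, b_k)ᵀ`. -/
def solitonPotential {N : ℕ} (ζ a b : Fin N → ℂ) (x t : ℝ) : ℂ :=
  deriv (fun y : ℝ => detQuotient ζ (fun k => kernelVector (ζ k) (a k) (b k) y t)) x

/-- The higher-order Kaup-Newell equation
`q_t = -(1/2) q_xxx - ((3i/2) |q|² q_x)_x + ((3/4) |q|⁴ q)_x` on the whole plane; to be read for a
smooth `q`. -/
def SolvesHigherOrderKN (q : ℝ → ℝ → ℂ) : Prop := ∀ x t : ℝ,
  deriv (fun s => q x s) t =
    -(1 / 2) * iteratedDeriv 3 (fun y => q y t) x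
    - deriv (fun y => 3 * I / 2 * (‖q y t‖ : ℂ) ^ 2 * deriv (fun z => q z t) y) x
    + deriv (fun y => 3 / 4 * (‖q y t‖ : ℂ) ^ 4 * q y t) x

/-- `u` and all its derivatives decay faster than every power of `|x|`. -/
def RapidlyDecreasing (u : ℝ → ℂ) : Prop :=
  ∀ m n : ℕ, ∃ C : ℝ, ∀ x : ℝ, |x| ^ m * ‖iteratedDeriv n u x‖ ≤ C

/-- The reflectionless (`G = I`) Riemann-Hilbert problem at a fixed `(x, t)`, with simple zeros
`±ζ_k` and kernels spanned by `v_k`. `Pp` is the matrix on `C13` and `Pm` its counterpart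
on `C24` (built from rows of inverse Jost matrices), so the jump condition is `Pm * Pp = G`; the
zeros of `Pm` and its left kernels are those of `Pp` transported by the first symmetry. -/
structure IsReflectionlessRHPSolution {N : ℕ} (ζ : Fin N → ℂ) (v : Fin N → Fin 2 → ℂ)
    (Pp Pm : ℂ → Matrix (Fin 2) (Fin 2) ℂ) : Prop where
  analytic_pos : ∀ i j, DifferentiableOn ℂ (fun z => Pp z i j) C13
  analytic_neg : ∀ i j, DifferentiableOn ℂ (fun z => Pm z i j) C24
  continuous_pos : ContinuousOn Pp (C13 ∪ contour)
  continuous_neg : ContinuousOn Pm (C24 ∪ contour)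
  jump : ∀ z ∈ contour, Pm z * Pp z = 1
  normalization_pos : Pp 0 = 1
  normalization_neg : Pm 0 = 1
  /-- regular behaviour at infinity -/
  at_infinity : ∃ L : Matrix (Fin 2) (Fin 2) ℂ, L.det ≠ 0 ∧
    Tendsto Pp (Bornology.cobounded ℂ ⊓ 𝓟 (C13 ∪ contour)) (𝓝 L)
  symm_conj : ∀ z ∈ C24 ∪ contour, Pm z = (Pp (conj z))ᴴ
  symm_neg : ∀ z ∈ C13 ∪ contour, Pp (-z) = σ₃ * Pp z * σ₃
  zeros : ∀ z ∈ C13, (Pp z).det = 0 ↔ ∃ k, z = ζ k ∨ z = -ζ k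
  simple : ∀ k, deriv (fun z => (Pp z).det) (ζ k) ≠ 0 ∧ deriv (fun z => (Pp z).det) (-ζ k) ≠ 0
  kernel : ∀ k, LinearMap.ker (Pp (ζ k)).mulVecLin = Submodule.span ℂ {v k}

/-- The spectral equation `J_x + i ζ² [σ₃, J] = ζ Q J` with potential `u`. -/
def IsSpectralSolution (u : ℝ → ℂ) (z : ℂ) (J : ℝ → Matrix (Fin 2) (Fin 2) ℂ) : Prop :=
  ∀ (x : ℝ) (i j : Fin 2), HasDerivAt (fun y => J y i j)
    ((z • (potentialMatrix (u x) * J x) - (I * z ^ 2) • (σ₃ * J x - J x * σ₃)) i j) x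

/-- `P` is the matrix `[J_M⁽¹⁾, J_P⁽²⁾]` of the potential `u`: its columns solve the spectral
equation, the first one tends to `(1,0)ᵀ` as `x → -∞` and the second one to `(0,1)ᵀ`
as `x → +∞`. -/
def IsJostMatrix (u : ℝ → ℂ) (P : ℝ → ℂ → Matrix (Fin 2) (Fin 2) ℂ) : Prop :=
  ∀ z ∈ C13 ∪ contour, IsSpectralSolution u z (fun x => P x z) ∧
    (∀ i, Tendsto (fun x => P x z i 0) atBot (𝓝 ((1 : Matrix (Fin 2) (Fin 2) ℂ) i 0))) ∧
    (∀ i, Tendsto (fun x => P x z i 1) atTop (𝓝 ((1 : Matrix (Fin 2) (Fin 2) ℂ) i 1)))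

/-- `E = e^{-i ζ² x σ₃}`. -/
def expE (z : ℂ) (x : ℝ) : Matrix (Fin 2) (Fin 2) ℂ :=
  Matrix.diagonal ![exp (-I * z ^ 2 * x), exp (I * z ^ 2 * x)]

/-- The potential `u` has vanishing reflection coefficients: on the contour, its Jost matrices
`J_M` (normalized at `-∞`) and `J_P` (normalized at `+∞`) are related by `J_M E = J_P E S` with a
scattering matrix `S` such that `s₁₂ = s₂₁ = 0`. -/
def IsReflectionless (u : ℝ → ℂ) : Prop :=
  ∀ z ∈ contour, ∃ (JM JP : ℝ → Matrix (Fin 2) (Fin 2) ℂ) (S : Matrix (Fin 2) (Fin 2) ℂ),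
    IsSpectralSolution u z JM ∧ Tendsto JM atBot (𝓝 1) ∧
    IsSpectralSolution u z JP ∧ Tendsto JP atTop (𝓝 1) ∧
    (∀ x, JM x * expE z x = JP x * expE z x * S) ∧ S 0 1 = 0 ∧ S 1 0 = 0

end

end HigherKN

namespace HigherKN

noncomputable section

open Polynomial

/-! Put λ = ζ² and let d (`polePoly`) have its zeros at the conjugates of the ζ_k², with d(0) = 1.
The solution is sought with rows (a(λ), ζ b(λ))/d(λ) and (-ζ b*(λ), a*(λ))/d(λ), where * conjugates
coefficients, deg a ≤ N, deg b < N and a(0) = 1. Kernel and residue data then become linear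
conditions on the pair (a, b), collected in `IsDressed`.

Everything rests on one rigidity statement. The polynomial D = a a* + λ b b* vanishes at the 2N
points ζ_k² and their conjugates, while on λ > 0 it equals |a|² + λ|b|². If the degrees are too
small, then D = 0 and so a = b = 0 (`IsDressed.eq_zero`); the same holds if a(0) = 0
(`IsDressed.eq_zero_of_coeff_zero`). A null vector of M would supply the partial-fraction
coefficients of such a pair, hence det M ≠ 0. Solving M u = |v⟩₁ gives the row normalized at
infinity; its value at 0 is nonzero, and rescaling yields (a, b), with b(0) the determinant
quotient. For this pair D = d d* (`IsDressing.detPoly_eq`).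

Evolution (`IsDressing.flow`): differentiating the linear conditions shows that (a', b') minus the
right-hand side of a Lax equation is again dressed. As soon as the right-hand side has the correct
degree, rigidity makes the difference zero. In x the degree condition fixes the potential through
leading coefficients, and the constant coefficient identifies it with b(0)_x. In t it is a set of
relations between leading coefficients, obtained by differentiating the x-recursion
(`leading_relations`); the constant coefficient then gives b(0)_t, and one x-derivative is the
nonlinear equation.

Decay: D = d d* on the half-line bounds a and b uniformly in x, so the linear conditions make b
exponentially small at N interpolation nodes, hence in all coefficients (`isBigO_coeff_solB`). The
potential and all its x-derivatives lie in the ideal generated by these coefficients and their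
conjugates (`IsSmallPolynomial.iteratedDeriv`). Interpolating a in the same way gives the Jost
limits when a_k b_k ≠ 0, and rescaling columns gives both Jost matrices with a diagonal scattering
matrix.

Uniqueness for the Riemann-Hilbert problem: the quotient of a solution by the dressing matrix has
only removable singularities in the first quadrant, is bounded near infinity, and is unitary on the
axes up to conjugation by σ₃. Suitable combinations of its entries are real on the axes, hence
constant by Phragmén-Lindelöf (`eq_of_real_on_axes`, `eq_one_of_unitary`). So every solution is the
dressing matrix (`IsReflectionlessRHPSolution.eq_dressPlus`), and its expansion at 0 can be read off
from b(0). -/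

/-- The polynomial with conjugated coefficients. -/
def conjPoly (p : ℂ[X]) : ℂ[X] := p.map (starRingEnd ℂ)

lemma conjPoly_conjPoly (p : ℂ[X]) : conjPoly (conjPoly p) = p := by
  ext n; simp [conjPoly]

@[simp] lemma coeff_conjPoly (p : ℂ[X]) (n : ℕ) : (conjPoly p).coeff n = conj (p.coeff n) := by
  simp [conjPoly]

lemma eval_conjPoly (p : ℂ[X]) (z : ℂ) : (conjPoly p).eval z = conj (p.eval (conj z)) := by
  have h := eval_map_apply (starRingEnd ℂ) (p := p) (conj z)
  simpa [conjPoly] using h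

lemma degree_conjPoly (p : ℂ[X]) : (conjPoly p).degree = p.degree := by
  simp [conjPoly, degree_map]

lemma natDegree_conjPoly (p : ℂ[X]) : (conjPoly p).natDegree = p.natDegree := by
  simp [conjPoly, natDegree_map]

/-- The squares of the spectral parameters are distinct points of the upper half plane. -/
structure IsSpectrum {N : ℕ} (ζ : Fin N → ℂ) : Prop where
  im_pos : ∀ k, 0 < (ζ k ^ 2).im
  injective : Function.Injective fun k => ζ k ^ 2

lemma im_sq (z : ℂ) : (z ^ 2).im = 2 * (z.re * z.im) := by
  rw [pow_two, mul_im]; ring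

lemma isSpectrum_of_mem {N : ℕ} {ζ : Fin N → ℂ} (hζ : ∀ k, ζ k ∈ C13)
    (hd : ∀ j k, j ≠ k → ζ j ≠ ζ k ∧ ζ j ≠ -ζ k) : IsSpectrum ζ := by
  refine ⟨fun k => ?_, fun j k h => ?_⟩
  · have := hζ k
    rw [im_sq]
    simp only [C13, Set.mem_ofPred_eq] at this
    linarith
  · by_contra hjk
    rcases sq_eq_sq_iff_eq_or_eq_neg.1 h with h' | h'
    exacts [(hd j k hjk).1 h', (hd j k hjk).2 h']

/-! ### Dressed rows and their rigidity by counting zeros -/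

section

variable {N : ℕ} {ζ : Fin N → ℂ}

lemma IsSpectrum.ne_zero (hζ : IsSpectrum ζ) (k : Fin N) : ζ k ≠ 0 := by
  intro h
  have := hζ.im_pos k
  simp [h] at this

lemma IsSpectrum.conj_ne_zero (hζ : IsSpectrum ζ) (k : Fin N) : conj (ζ k) ≠ 0 := by
  simpa using hζ.ne_zero k

lemma IsSpectrum.conj_im_neg (hζ : IsSpectrum ζ) (k : Fin N) : (conj (ζ k) ^ 2).im < 0 := by
  rw [← map_pow, conj_im]
  linarith [hζ.im_pos k]

lemma IsSpectrum.ne_conj (hζ : IsSpectrum ζ) (j k : Fin N) : ζ j ^ 2 ≠ conj (ζ k) ^ 2 := by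
  intro h
  have h1 := hζ.im_pos j
  have h2 := hζ.conj_im_neg k
  rw [h] at h1
  linarith

lemma IsSpectrum.conj_injective (hζ : IsSpectrum ζ) :
    Function.Injective fun k => conj (ζ k) ^ 2 := by
  intro j k h
  apply hζ.injective
  exact (starRingEnd ℂ).injective (by simpa using h)

/-- The `ζ_k²` together with their conjugates. -/
def nodes (ζ : Fin N → ℂ) : Fin N ⊕ Fin N → ℂ :=
  Sum.elim (fun k => ζ k ^ 2) (fun k => conj (ζ k) ^ 2)

lemma IsSpectrum.nodes_injective (hζ : IsSpectrum ζ) : Function.Injective (nodes ζ) := by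
  rintro (j | j) (k | k) h
  · exact congrArg _ (hζ.injective h)
  · exact absurd h (hζ.ne_conj j k)
  · exact absurd h.symm (hζ.ne_conj k j)
  · exact congrArg _ (hζ.conj_injective h)

/-- The linear conditions on the first row `(a, ζ b)` of the dressing matrix: it annihilates `v_j`
at `ζ_j`, and is a multiple of `⟨v_j|` at the conjugate of `ζ_j`. -/
structure IsDressed (ζ : Fin N → ℂ) (v : Fin N → Fin 2 → ℂ) (a b : ℂ[X]) : Prop where
  kernel : ∀ j, a.eval (ζ j ^ 2) * v j 0 + ζ j * b.eval (ζ j ^ 2) * v j 1 = 0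
  range : ∀ j, a.eval (conj (ζ j) ^ 2) * conj (v j 1) =
    conj (ζ j) * b.eval (conj (ζ j) ^ 2) * conj (v j 0)

variable {v : Fin N → Fin 2 → ℂ} {a b : ℂ[X]}

lemma IsDressed.kernel_conj (h : IsDressed ζ v a b) (j : Fin N) :
    (conjPoly a).eval (conj (ζ j) ^ 2) * conj (v j 0) +
      conj (ζ j) * (conjPoly b).eval (conj (ζ j) ^ 2) * conj (v j 1) = 0 := by
  have := congrArg (starRingEnd ℂ) (h.kernel j)
  simpa [eval_conjPoly] using this

lemma IsDressed.range_conj (h : IsDressed ζ v a b) (j : Fin N) :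
    (conjPoly a).eval (ζ j ^ 2) * v j 1 = ζ j * (conjPoly b).eval (ζ j ^ 2) * v j 0 := by
  have := congrArg (starRingEnd ℂ) (h.range j)
  simpa [eval_conjPoly] using this

/-- `a a* + λ b b*`, the determinant of the dressing matrix up to its poles. -/
def detPoly (a b : ℂ[X]) : ℂ[X] := a * conjPoly a + X * (b * conjPoly b)

lemma conjPoly_detPoly (a b : ℂ[X]) : conjPoly (detPoly a b) = detPoly a b := by
  rw [detPoly, conjPoly, Polynomial.map_add, Polynomial.map_mul, Polynomial.map_mul,
    Polynomial.map_mul, map_X]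
  change conjPoly a * conjPoly (conjPoly a) + X * (conjPoly b * conjPoly (conjPoly b)) = _
  rw [conjPoly_conjPoly, conjPoly_conjPoly]
  ring

/-- At ζ_j both rows (a, ζ b) and (-ζ b*, a*) annihilate the nonzero vector v_j, so their
determinant vanishes; self-conjugacy of the determinant carries the zero to the conjugate node. -/
lemma IsDressed.eval_detPoly (h : IsDressed ζ v a b) (hv : ∀ k, v k ≠ 0) (s : Fin N ⊕ Fin N) :
    (detPoly a b).eval (nodes ζ s) = 0 := by
  have key : ∀ j, (detPoly a b).eval (ζ j ^ 2) = 0 := by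
    intro j
    have h1 := h.kernel j
    have h2 := h.range_conj j
    simp only [detPoly, eval_add, eval_mul, eval_X]
    by_cases h0 : v j 0 = 0
    · have h3 : v j 1 ≠ 0 := fun h3 => hv j (by ext i; fin_cases i <;> simp [h0, h3])
      refine mul_right_cancel₀ h3 ?_
      linear_combination (a.eval (ζ j ^ 2)) * h2 + ζ j * (conjPoly b).eval (ζ j ^ 2) * h1
    · refine mul_right_cancel₀ h0 ?_
      linear_combination ((conjPoly a).eval (ζ j ^ 2)) * h1 - ζ j * b.eval (ζ j ^ 2) * h2
  rcases s with j | j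
  · exact key j
  · rw [← conjPoly_detPoly, eval_conjPoly]
    simp [nodes, key]

lemma eval_detPoly_ofReal (a b : ℂ[X]) (c : ℝ) :
    (detPoly a b).eval (c : ℂ) = ((‖a.eval (c : ℂ)‖ ^ 2 + c * ‖b.eval (c : ℂ)‖ ^ 2 : ℝ) : ℂ) := by
  simp only [detPoly, eval_add, eval_mul, eval_X, eval_conjPoly, conj_ofReal, mul_conj,
    normSq_eq_norm_sq]
  push_cast
  ring

lemma eq_zero_of_eval_ofReal_eq_zero {p : ℂ[X]} (h : ∀ c : ℝ, 0 < c → p.eval (c : ℂ) = 0) :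
    p = 0 := by
  refine eq_zero_of_infinite_isRoot p ?_
  refine Set.Infinite.mono (s := (fun c : ℝ => (c : ℂ)) '' Set.Ioi 0) ?_ ?_
  · rintro _ ⟨c, hc, rfl⟩
    exact h c hc
  · exact (Set.Ioi_infinite (0 : ℝ)).image (Complex.ofReal_injective.injOn)

/-- On the positive half-line the determinant is a sum of two nonnegative terms, so both polynomials
vanish at infinitely many points. -/
lemma detPoly_eq_zero_iff : detPoly a b = 0 ↔ a = 0 ∧ b = 0 := by
  constructor
  · intro h
    have key : ∀ c : ℝ, 0 < c → a.eval (c : ℂ) = 0 ∧ b.eval (c : ℂ) = 0 := by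
      intro c hc
      have h1 := eval_detPoly_ofReal a b c
      rw [h, eval_zero, eq_comm, ofReal_eq_zero] at h1
      have h2 : 0 ≤ ‖a.eval (c : ℂ)‖ ^ 2 := by positivity
      have h3 : 0 ≤ c * ‖b.eval (c : ℂ)‖ ^ 2 := by positivity
      constructor
      · have : ‖a.eval (c : ℂ)‖ ^ 2 = 0 := by linarith
        simpa using this
      · have : c * ‖b.eval (c : ℂ)‖ ^ 2 = 0 := by linarith
        simpa [hc.ne'] using this
    exact ⟨eq_zero_of_eval_ofReal_eq_zero fun c hc => (key c hc).1,
      eq_zero_of_eval_ofReal_eq_zero fun c hc => (key c hc).2⟩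
  · rintro ⟨rfl, rfl⟩
    simp [detPoly, conjPoly]

lemma degree_mul_conjPoly_le {p : ℂ[X]} {n : ℕ} (hp : p.natDegree ≤ n) :
    (p * conjPoly p).natDegree ≤ 2 * n := by
  refine natDegree_mul_le.trans ?_
  rw [natDegree_conjPoly]
  omega

lemma natDegree_le_of_degree_lt_succ {p : ℂ[X]} {n : ℕ} (h : p.degree < (n + 1 : ℕ)) :
    p.natDegree ≤ n :=
  natDegree_le_iff_coeff_eq_zero.2 fun m hm => (degree_lt_iff_coeff_zero p (n + 1)).1 h m hm

/-- The homogeneous problem has no solution. -/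
lemma IsDressed.eq_zero (hζ : IsSpectrum ζ) (hv : ∀ k, v k ≠ 0) (h : IsDressed ζ v a b)
    (ha : a.degree < N) (hb : b.degree < N) : a = 0 ∧ b = 0 := by
  rw [← detPoly_eq_zero_iff]
  refine eq_zero_of_degree_lt_of_eval_index_eq_zero Finset.univ (v := nodes ζ)
    hζ.nodes_injective.injOn ?_ fun s _ => h.eval_detPoly hv s
  -- The case N = 0 is separate because the bound deg ≤ 2(N - 1) + 1 needs N ≥ 1.
  rcases N with _ | n
  · have ha' : a = 0 := by simpa using ha
    have hb' : b = 0 := by simpa using hb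
    subst ha' hb'
    simp [detPoly]
  · have ha' : a.natDegree ≤ n := natDegree_le_of_degree_lt_succ ha
    have hb' : b.natDegree ≤ n := natDegree_le_of_degree_lt_succ hb
    refine lt_of_le_of_lt degree_le_natDegree ?_
    rw [Finset.card_univ, Fintype.card_sum, Fintype.card_fin]
    have h1 := degree_mul_conjPoly_le ha'
    have h2 : (X * (b * conjPoly b)).natDegree ≤ 1 + 2 * n :=
      natDegree_mul_le.trans (add_le_add natDegree_X_le (degree_mul_conjPoly_le hb'))
    have h3 : (detPoly a b).natDegree ≤ 1 + 2 * n :=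
      (natDegree_add_le _ _).trans (max_le (by omega) h2)
    exact_mod_cast (by omega : (detPoly a b).natDegree < n + 1 + (n + 1))

/-- The homogeneous problem with a first entry that vanishes at the origin has no solution. -/
lemma IsDressed.eq_zero_of_coeff_zero (hζ : IsSpectrum ζ) (hv : ∀ k, v k ≠ 0)
    (h : IsDressed ζ v a b) (ha : a.degree ≤ N) (ha0 : a.coeff 0 = 0) (hb : b.degree < N) :
    a = 0 ∧ b = 0 := by
  obtain ⟨c, rfl⟩ := X_dvd_iff.2 ha0
  have hc : c.degree < N := by
    by_cases hc : c = 0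
    · simp [hc]
    · rw [degree_mul, degree_X, degree_eq_natDegree hc] at ha
      rw [degree_eq_natDegree hc]
      have : 1 + c.natDegree ≤ N := by exact_mod_cast ha
      exact_mod_cast (by omega : c.natDegree < N)
  -- Writing a = λ c and dividing the conditions by ζ_j or its conjugate exchanges the two
  -- components of v_j. The pair (b, c) has both degrees below N.
  have h' : IsDressed ζ (fun k => ![v k 1, v k 0]) b c := by
    refine ⟨fun j => mul_left_cancel₀ (hζ.ne_zero j) ?_,
      fun j => mul_left_cancel₀ (hζ.conj_ne_zero j) ?_⟩
    · have := h.kernel j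
      simp only [eval_mul, eval_X] at this
      simp only [Matrix.cons_val_zero, Matrix.cons_val_one]
      linear_combination this
    · have := h.range j
      simp only [eval_mul, eval_X] at this
      simp only [Matrix.cons_val_zero, Matrix.cons_val_one]
      linear_combination -this
  have hv' : ∀ k, (![v k 1, v k 0] : Fin 2 → ℂ) ≠ 0 := by
    intro k hk
    apply hv k
    have h0 := congrFun hk 0
    have h1 := congrFun hk 1
    ext i; fin_cases i
    · simpa using h1
    · simpa using h0
  obtain ⟨h1, h2⟩ := h'.eq_zero hζ hv' hb hc
  simp [h1, h2]

/-- The polynomial with simple zeros at the conjugates of the `ζ_k²`, normalized at the origin. -/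
def polePoly (ζ : Fin N → ℂ) : ℂ[X] :=
  C ((Lagrange.nodal Finset.univ fun k => conj (ζ k) ^ 2).eval 0)⁻¹ *
    Lagrange.nodal Finset.univ fun k => conj (ζ k) ^ 2

lemma IsSpectrum.nodal_zero_ne_zero (hζ : IsSpectrum ζ) :
    (Lagrange.nodal Finset.univ fun k => conj (ζ k) ^ 2).eval 0 ≠ 0 :=
  Lagrange.eval_nodal_not_at_node fun k _ => (pow_ne_zero 2 (hζ.conj_ne_zero k)).symm

lemma IsSpectrum.polePoly_zero (hζ : IsSpectrum ζ) : (polePoly ζ).eval 0 = 1 := by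
  simp [polePoly, hζ.nodal_zero_ne_zero]

lemma IsSpectrum.eval_polePoly_eq_zero_iff (hζ : IsSpectrum ζ) {z : ℂ} :
    (polePoly ζ).eval z = 0 ↔ ∃ k, z = conj (ζ k) ^ 2 := by
  rw [polePoly, eval_mul, eval_C, mul_eq_zero, or_iff_right (inv_ne_zero hζ.nodal_zero_ne_zero)]
  simp only [Lagrange.eval_nodal, Finset.prod_eq_zero_iff, Finset.mem_univ, true_and, sub_eq_zero]

lemma IsSpectrum.eval_conjPoly_polePoly_eq_zero_iff (hζ : IsSpectrum ζ) {z : ℂ} :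
    (conjPoly (polePoly ζ)).eval z = 0 ↔ ∃ k, z = ζ k ^ 2 := by
  rw [eval_conjPoly, map_eq_zero, hζ.eval_polePoly_eq_zero_iff]
  refine exists_congr fun k => ?_
  rw [← map_pow]
  exact (starRingEnd ℂ).injective.eq_iff

lemma IsSpectrum.natDegree_polePoly (hζ : IsSpectrum ζ) : (polePoly ζ).natDegree = N := by
  rw [polePoly, natDegree_C_mul (inv_ne_zero hζ.nodal_zero_ne_zero), Lagrange.natDegree_nodal]
  simp

/-- The first row of the dressing matrix, normalized at the origin. -/
structure IsDressing (ζ : Fin N → ℂ) (v : Fin N → Fin 2 → ℂ) (a b : ℂ[X]) : Prop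
    extends IsDressed ζ v a b where
  natDegree_le : a.natDegree ≤ N
  degree_lt : b.degree < N
  eval_zero : a.eval 0 = 1

/-- Two polynomials of degree at most 2N that agree at the 2N nodes and, thanks to both
normalizations, at the origin. -/
lemma IsDressing.detPoly_eq (hζ : IsSpectrum ζ) (hv : ∀ k, v k ≠ 0) (h : IsDressing ζ v a b) :
    detPoly a b = polePoly ζ * conjPoly (polePoly ζ) := by
  have hinj : Function.Injective fun s : Option (Fin N ⊕ Fin N) => s.elim 0 (nodes ζ) := by
    have h0 : ∀ s, nodes ζ s ≠ 0 := by
      rintro (k | k)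
      exacts [pow_ne_zero 2 (hζ.ne_zero k), pow_ne_zero 2 (hζ.conj_ne_zero k)]
    rintro (_ | s) (_ | s') hs
    · rfl
    · exact absurd hs.symm (h0 s')
    · exact absurd hs (h0 s)
    · exact congrArg _ (hζ.nodes_injective hs)
  rw [← sub_eq_zero]
  refine eq_zero_of_degree_lt_of_eval_index_eq_zero Finset.univ hinj.injOn ?_ ?_
  · refine lt_of_le_of_lt degree_le_natDegree ?_
    rw [Finset.card_univ, Fintype.card_option, Fintype.card_sum, Fintype.card_fin]
    have h1 := degree_mul_conjPoly_le h.natDegree_le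
    have h2 : (X * (b * conjPoly b)).natDegree ≤ 2 * N := by
      rcases eq_or_ne b 0 with rfl | hb
      · simp
      · have hb' := (natDegree_lt_iff_degree_lt hb).2 h.degree_lt
        -- The truncated N - 1 is harmless: a nonzero b of degree below N forces N ≥ 1.
        refine (natDegree_mul_le.trans (add_le_add natDegree_X_le
          (degree_mul_conjPoly_le (n := N - 1) (by omega)))).trans (by omega)
    have h3 : (detPoly a b).natDegree ≤ 2 * N := (natDegree_add_le _ _).trans (max_le h1 h2)
    have h4 := degree_mul_conjPoly_le hζ.natDegree_polePoly.le
    have h5 := (natDegree_sub_le (detPoly a b) (polePoly ζ * conjPoly (polePoly ζ))).trans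
      (max_le h3 h4)
    exact_mod_cast (by omega : _ < N + N + 1)
  · rintro (_ | s) -
    · have h1 : (conjPoly a).eval 0 = 1 := by simp [eval_conjPoly, h.eval_zero]
      have h2 : (conjPoly (polePoly ζ)).eval 0 = 1 := by simp [eval_conjPoly, hζ.polePoly_zero]
      simp [detPoly, h.eval_zero, h1, h2, hζ.polePoly_zero]
    · simp only [Option.elim, eval_sub, h.eval_detPoly hv s, eval_mul, zero_sub, neg_eq_zero,
        mul_eq_zero]
      rcases s with k | k
      · exact Or.inr (hζ.eval_conjPoly_polePoly_eq_zero_iff.2 ⟨k, rfl⟩)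
      · exact Or.inl (hζ.eval_polePoly_eq_zero_iff.2 ⟨k, rfl⟩)

end

/-! ### Partial fractions, invertibility of M, and the closed forms -/

section

variable {N : ℕ} {ζ : Fin N → ℂ} {v : Fin N → Fin 2 → ℂ}

/-- The monic polynomial with simple zeros at the conjugates of the `ζ_k²`. -/
abbrev poleNodal (ζ : Fin N → ℂ) : ℂ[X] := Lagrange.nodal Finset.univ fun k => conj (ζ k) ^ 2

/-- The product of the `λ - λ_l*` with `l ≠ k`. -/
abbrev poleCofactor (ζ : Fin N → ℂ) (k : Fin N) : ℂ[X] :=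
  Lagrange.nodal (Finset.univ.erase k) fun l => conj (ζ l) ^ 2

/-- The numerator of `∑_k 2 u_k ζ_k* ⟨v_k|₁ / (λ - λ_k*)`. -/
def residueA (ζ : Fin N → ℂ) (v : Fin N → Fin 2 → ℂ) (u : Fin N → ℂ) : ℂ[X] :=
  ∑ k, C (2 * u k * conj (ζ k) * conj (v k 0)) * poleCofactor ζ k

/-- The numerator of `∑_k 2 u_k ⟨v_k|₂ / (λ - λ_k*)`. -/
def residueB (ζ : Fin N → ℂ) (v : Fin N → Fin 2 → ℂ) (u : Fin N → ℂ) : ℂ[X] :=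
  ∑ k, C (2 * u k * conj (v k 1)) * poleCofactor ζ k

lemma eval_poleCofactor_mul (k : Fin N) (z : ℂ) :
    (poleCofactor ζ k).eval z * (z - conj (ζ k) ^ 2) = (poleNodal ζ).eval z := by
  rw [Lagrange.eval_nodal, Lagrange.eval_nodal, Finset.prod_erase_mul _ _ (Finset.mem_univ k)]

lemma eval_poleCofactor_of_ne {k l : Fin N} (h : l ≠ k) :
    (poleCofactor ζ k).eval (conj (ζ l) ^ 2) = 0 :=
  Lagrange.eval_nodal_at_node (v := fun l => conj (ζ l) ^ 2)
    (Finset.mem_erase.2 ⟨h, Finset.mem_univ l⟩)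

lemma IsSpectrum.eval_poleCofactor_self (hζ : IsSpectrum ζ) (k : Fin N) :
    (poleCofactor ζ k).eval (conj (ζ k) ^ 2) ≠ 0 :=
  Lagrange.eval_nodal_not_at_node fun _ hl h =>
    (Finset.mem_erase.1 hl).1 (hζ.conj_injective h).symm

lemma eval_residueA_node (u : Fin N → ℂ) (k : Fin N) :
    (residueA ζ v u).eval (conj (ζ k) ^ 2) =
      2 * u k * conj (ζ k) * conj (v k 0) * (poleCofactor ζ k).eval (conj (ζ k) ^ 2) := by
  rw [residueA, eval_finsetSum, Finset.sum_eq_single k]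
  · rw [eval_mul, eval_C]
  · intro l _ hl
    rw [eval_mul, eval_poleCofactor_of_ne hl.symm, mul_zero]
  · simp

lemma eval_residueB_node (u : Fin N → ℂ) (k : Fin N) :
    (residueB ζ v u).eval (conj (ζ k) ^ 2) =
      2 * u k * conj (v k 1) * (poleCofactor ζ k).eval (conj (ζ k) ^ 2) := by
  rw [residueB, eval_finsetSum, Finset.sum_eq_single k]
  · rw [eval_mul, eval_C]
  · intro l _ hl
    rw [eval_mul, eval_poleCofactor_of_ne hl.symm, mul_zero]
  · simp

lemma degree_sum_poleCofactor_lt (c : Fin N → ℂ) :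
    (∑ k, C (c k) * poleCofactor ζ k).degree < N := by
  rw [← mem_degreeLT]
  refine Submodule.sum_mem _ fun k _ => ?_
  rw [mem_degreeLT]
  rw [← smul_eq_C_mul]
  refine (degree_smul_le _ _).trans_lt ?_
  rw [Lagrange.degree_nodal, Finset.card_erase_of_mem (Finset.mem_univ k), Finset.card_univ,
    Fintype.card_fin]
  have := k.pos
  exact_mod_cast (by omega : N - 1 < N)

/-- Over the common denominator the two fractions of M combine to a Cauchy-type entry in the squared
variables, which is what allows M to encode the kernel conditions. -/
lemma matM_mul (hζ : IsSpectrum ζ) (j k : Fin N) :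
    matM ζ v j k * (ζ j ^ 2 - conj (ζ k) ^ 2) =
      -2 * (conj (ζ k) * conj (v k 0) * v j 0 + ζ j * conj (v k 1) * v j 1) := by
  have h : (ζ j + conj (ζ k)) * (ζ j - conj (ζ k)) ≠ 0 := by
    have := sub_ne_zero.2 (hζ.ne_conj j k)
    rwa [sq_sub_sq] at this
  have h1 := left_ne_zero_of_mul h
  have h2 := right_ne_zero_of_mul h
  simp only [matM, Matrix.of_apply, σ₃, dotProduct, Matrix.mulVec, Fin.sum_univ_two,
    Pi.star_apply, RCLike.star_def, Matrix.cons_val', Matrix.cons_val_zero, Matrix.cons_val_one,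
    Matrix.empty_val', Matrix.cons_val_fin_one]
  field_simp
  ring

lemma eval_residue_kernel (hζ : IsSpectrum ζ) (u : Fin N → ℂ) (j : Fin N) :
    (residueA ζ v u).eval (ζ j ^ 2) * v j 0 + ζ j * (residueB ζ v u).eval (ζ j ^ 2) * v j 1 =
      -(poleNodal ζ).eval (ζ j ^ 2) * (matM ζ v *ᵥ u) j := by
  simp only [residueA, residueB, eval_finsetSum, eval_mul, eval_C, Matrix.mulVec, dotProduct,
    Finset.mul_sum, Finset.sum_mul, ← Finset.sum_add_distrib]
  refine Finset.sum_congr rfl fun k _ => ?_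
  rw [← eval_poleCofactor_mul k]
  linear_combination (poleCofactor ζ k).eval (ζ j ^ 2) * u k * matM_mul (v := v) hζ j k

/-- A null vector u turns the residue sums into a dressed pair with both degrees below N, which is
zero by rigidity. Evaluating at the poles recovers u_k⟨v_k|, so u = 0. -/
lemma det_matM_ne_zero (hζ : IsSpectrum ζ) (hv : ∀ k, v k ≠ 0) : (matM ζ v).det ≠ 0 := by
  intro hdet
  obtain ⟨u, hu, hMu⟩ := Matrix.exists_mulVec_eq_zero_iff.2 hdet
  have h : IsDressed ζ v (residueA ζ v u) (residueB ζ v u) := by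
    refine ⟨fun j => ?_, fun j => ?_⟩
    · rw [eval_residue_kernel hζ, hMu, Pi.zero_apply, mul_zero]
    · rw [eval_residueA_node, eval_residueB_node]
      ring
  obtain ⟨hA, hB⟩ := h.eq_zero hζ hv (degree_sum_poleCofactor_lt _) (degree_sum_poleCofactor_lt _)
  refine hu (funext fun k => ?_)
  have h1 := eval_residueA_node (ζ := ζ) (v := v) u k
  have h2 := eval_residueB_node (ζ := ζ) (v := v) u k
  rw [hA, eval_zero, eq_comm, mul_eq_zero, or_iff_left (hζ.eval_poleCofactor_self k)] at h1
  rw [hB, eval_zero, eq_comm, mul_eq_zero, or_iff_left (hζ.eval_poleCofactor_self k)] at h2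
  by_contra hk
  simp only [Pi.zero_apply] at hk
  refine hv k (funext fun i => ?_)
  fin_cases i
  · simpa [hk, hζ.ne_zero k] using h1
  · simpa [hk] using h2

/-- The solution `u` of `M u = |v⟩₁`. -/
def residueVector (ζ : Fin N → ℂ) (v : Fin N → Fin 2 → ℂ) : Fin N → ℂ :=
  (matM ζ v)⁻¹ *ᵥ fun k => v k 0

/-- The numerator of the first diagonal entry of the dressing matrix normalized at infinity. -/
def numA (ζ : Fin N → ℂ) (v : Fin N → Fin 2 → ℂ) : ℂ[X] :=
  poleNodal ζ + residueA ζ v (residueVector ζ v)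

/-- The numerator of the off-diagonal entry, divided by `ζ`, in the first row of the dressing
matrix normalized at infinity. -/
def numB (ζ : Fin N → ℂ) (v : Fin N → Fin 2 → ℂ) : ℂ[X] :=
  residueB ζ v (residueVector ζ v)

/-- The residues are multiples of ⟨v_k| by construction, and M u = |v⟩₁ cancels the contribution of
the leading term at the kernel nodes. -/
lemma isDressed_num (hζ : IsSpectrum ζ) (hv : ∀ k, v k ≠ 0) :
    IsDressed ζ v (numA ζ v) (numB ζ v) := by
  refine ⟨fun j => ?_, fun j => ?_⟩
  · have h1 := eval_residue_kernel (v := v) hζ (residueVector ζ v) j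
    have h2 : matM ζ v *ᵥ residueVector ζ v = fun k => v k 0 := by
      rw [residueVector, Matrix.mulVec_mulVec,
        Matrix.mul_nonsing_inv _ (det_matM_ne_zero hζ hv).isUnit, Matrix.one_mulVec]
    rw [h2] at h1
    rw [numA, numB, eval_add]
    linear_combination h1
  · rw [numA, numB, eval_add, eval_residueA_node, eval_residueB_node,
      Lagrange.eval_nodal_at_node (v := fun k => conj (ζ k) ^ 2) (Finset.mem_univ j)]
    ring

lemma degree_poleNodal : (poleNodal ζ).degree = N := by
  simp [Lagrange.degree_nodal]

lemma degree_numA : (numA ζ v).degree = N := by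
  rw [numA, degree_add_eq_left_of_degree_lt, degree_poleNodal]
  rw [degree_poleNodal]
  exact degree_sum_poleCofactor_lt _

/-- This permits passing from the normalization at infinity to the one at the origin: a zero at 0
would make the pair vanish by rigidity, against the exact degree N. -/
lemma numA_zero_ne_zero (hζ : IsSpectrum ζ) (hv : ∀ k, v k ≠ 0) : (numA ζ v).eval 0 ≠ 0 := by
  intro h
  rw [← coeff_zero_eq_eval_zero] at h
  have h1 := ((isDressed_num hζ hv).eq_zero_of_coeff_zero hζ hv degree_numA.le h
    (degree_sum_poleCofactor_lt _)).1
  have h2 := degree_numA (ζ := ζ) (v := v)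
  simp [h1] at h2

/-- The numerator of the first diagonal entry of the dressing matrix normalized at the origin. -/
def dressA (ζ : Fin N → ℂ) (v : Fin N → Fin 2 → ℂ) : ℂ[X] := C ((numA ζ v).eval 0)⁻¹ * numA ζ v

/-- The numerator of the off-diagonal entry, divided by `ζ`, in the first row of the dressing
matrix normalized at the origin. -/
def dressB (ζ : Fin N → ℂ) (v : Fin N → Fin 2 → ℂ) : ℂ[X] := C ((numA ζ v).eval 0)⁻¹ * numB ζ v

lemma isDressing_dress (hζ : IsSpectrum ζ) (hv : ∀ k, v k ≠ 0) :
    IsDressing ζ v (dressA ζ v) (dressB ζ v) where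
  kernel j := by
    have := (isDressed_num hζ hv).kernel j
    simp only [dressA, dressB, eval_mul, eval_C]
    linear_combination ((numA ζ v).eval 0)⁻¹ * this
  range j := by
    have := (isDressed_num hζ hv).range j
    simp only [dressA, dressB, eval_mul, eval_C]
    linear_combination ((numA ζ v).eval 0)⁻¹ * this
  natDegree_le := (natDegree_C_mul_le _ _).trans (natDegree_le_of_degree_le degree_numA.le)
  degree_lt := by
    rw [dressB, ← smul_eq_C_mul]
    exact (degree_smul_le _ _).trans_lt (degree_sum_poleCofactor_lt _)
  eval_zero := by simp [dressA, numA_zero_ne_zero hζ hv]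

lemma sumDenominator_mul (hζ : IsSpectrum ζ) :
    sumDenominator ζ v * (poleNodal ζ).eval 0 = (numA ζ v).eval 0 := by
  have h : ∑ j, ∑ k, 2 * (matM ζ v)⁻¹ j k * v k 0 * conj (v j 0) / conj (ζ j) =
      ∑ j, 2 * residueVector ζ v j * conj (v j 0) / conj (ζ j) := by
    refine Finset.sum_congr rfl fun j _ => ?_
    simp only [residueVector, Matrix.mulVec, dotProduct, Finset.mul_sum, Finset.sum_mul,
      Finset.sum_div]
    exact Finset.sum_congr rfl fun k _ => by ring
  rw [sumDenominator, h, numA, residueA, eval_add, eval_finsetSum, sub_mul, one_mul,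
    Finset.sum_mul, sub_eq_add_neg, ← Finset.sum_neg_distrib]
  congr 1
  refine Finset.sum_congr rfl fun k _ => ?_
  have hk := hζ.conj_ne_zero k
  rw [← eval_poleCofactor_mul k, eval_mul, eval_C]
  field_simp
  ring

lemma sumNumerator_mul (hζ : IsSpectrum ζ) :
    sumNumerator ζ v * (poleNodal ζ).eval 0 = (numB ζ v).eval 0 := by
  have h : sumNumerator ζ v =
      ∑ j, -2 * residueVector ζ v j * conj (v j 1) / conj (ζ j) ^ 2 := by
    refine Finset.sum_congr rfl fun j _ => ?_
    simp only [residueVector, Matrix.mulVec, dotProduct, Finset.mul_sum, Finset.sum_mul,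
      Finset.sum_div]
    exact Finset.sum_congr rfl fun k _ => by ring
  rw [h, numB, residueB, eval_finsetSum, Finset.sum_mul]
  refine Finset.sum_congr rfl fun k _ => ?_
  have hk := hζ.conj_ne_zero k
  rw [← eval_poleCofactor_mul k, eval_mul, eval_C]
  field_simp
  ring

lemma sumDenominator_ne_zero (hζ : IsSpectrum ζ) (hv : ∀ k, v k ≠ 0) :
    sumDenominator ζ v ≠ 0 := by
  intro h
  have := sumDenominator_mul (v := v) hζ
  rw [h, zero_mul] at this
  exact numA_zero_ne_zero hζ hv this.symm

/-- Schur complement of the block A; the complement is a 1×1 matrix. -/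
lemma det_bordered {A : Matrix (Fin N) (Fin N) ℂ} (hA : A.det ≠ 0) (c f : Fin N → ℂ) :
    (Matrix.fromBlocks A (Matrix.of fun j (_ : Unit) => c j)
      (Matrix.of fun (_ : Unit) k => f k) 0).det = -A.det * ∑ j, ∑ k, f j * A⁻¹ j k * c k := by
  let _ := Matrix.invertibleOfIsUnitDet A hA.isUnit
  rw [Matrix.det_fromBlocks₁₁, Matrix.det_unique (n := Unit), Matrix.sub_apply, Matrix.zero_apply, zero_sub,
    mul_neg, neg_mul, Matrix.mul_assoc, Matrix.invOf_eq_nonsing_inv]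
  congr 2
  simp only [Matrix.mul_apply, Matrix.of_apply, Finset.mul_sum, mul_assoc]

lemma det_matG (hζ : IsSpectrum ζ) (hv : ∀ k, v k ≠ 0) :
    (matM ζ v).det + 2 * (matG ζ v).det = (matM ζ v).det * sumDenominator ζ v := by
  rw [matG, det_bordered (det_matM_ne_zero hζ hv), sumDenominator, mul_sub, mul_one,
    sub_eq_add_neg]
  congr 1
  simp only [Finset.mul_sum, ← Finset.sum_neg_distrib]
  exact Finset.sum_congr rfl fun j _ => Finset.sum_congr rfl fun k _ => by ring

lemma det_matF (hζ : IsSpectrum ζ) (hv : ∀ k, v k ≠ 0) :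
    2 * (matF ζ v).det = (matM ζ v).det * sumNumerator ζ v := by
  rw [matF, det_bordered (det_matM_ne_zero hζ hv), sumNumerator]
  simp only [Finset.mul_sum]
  exact Finset.sum_congr rfl fun j _ => Finset.sum_congr rfl fun k _ => by ring

lemma det_add_ne_zero (hζ : IsSpectrum ζ) (hv : ∀ k, v k ≠ 0) :
    (matM ζ v).det + 2 * (matG ζ v).det ≠ 0 := by
  rw [det_matG hζ hv]
  exact mul_ne_zero (det_matM_ne_zero hζ hv) (sumDenominator_ne_zero hζ hv)

lemma detQuotient_eq (hζ : IsSpectrum ζ) (hv : ∀ k, v k ≠ 0) :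
    detQuotient ζ v = (sumDenominator ζ v)⁻¹ * sumNumerator ζ v := by
  have h1 := det_matM_ne_zero hζ hv
  have h2 := sumDenominator_ne_zero hζ hv
  rw [detQuotient, det_matG hζ hv, det_matF hζ hv]
  field_simp

/-- The link between the determinant formula and the dressing matrix: numerator and denominator are
the values at 0 of the two entries normalized at infinity, with the common factor of the nodal
polynomial cancelling. -/
lemma detQuotient_eq_eval (hζ : IsSpectrum ζ) (hv : ∀ k, v k ≠ 0) :
    detQuotient ζ v = (dressB ζ v).eval 0 := by
  have h1 := sumDenominator_ne_zero hζ hv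
  have h2 := hζ.nodal_zero_ne_zero
  rw [detQuotient_eq hζ hv, dressB, eval_mul, eval_C, ← sumDenominator_mul hζ,
    ← sumNumerator_mul hζ]
  field_simp

end

/-! ### Smooth dependence on parameters -/

section Smooth

variable {E : Type*} [NormedAddCommGroup E] [NormedSpace ℝ E] {N : ℕ}

lemma contDiff_conj {f : E → ℂ} (hf : ContDiff ℝ ∞ f) : ContDiff ℝ ∞ fun x => conj (f x) :=
  conjCLE.contDiff.comp hf

lemma contDiff_det {n : Type*} [Fintype n] [DecidableEq n] {A : E → Matrix n n ℂ}
    (hA : ∀ i j, ContDiff ℝ ∞ fun x => A x i j) : ContDiff ℝ ∞ fun x => (A x).det := by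
  simp only [Matrix.det_apply]
  exact ContDiff.sum fun σ _ => (contDiff_prod fun i _ => hA _ _).const_smul _

lemma contDiff_matrix_inv {n : Type*} [Fintype n] [DecidableEq n] {A : E → Matrix n n ℂ}
    (hA : ∀ i j, ContDiff ℝ ∞ fun x => A x i j) (hdet : ∀ x, (A x).det ≠ 0) (i j : n) :
    ContDiff ℝ ∞ fun x => (A x)⁻¹ i j := by
  simp only [Matrix.inv_def, Ring.inverse_eq_inv', Matrix.smul_apply, smul_eq_mul,
    Matrix.adjugate_apply]
  refine ((contDiff_det hA).inv hdet).mul (contDiff_det fun k l => ?_)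
  by_cases hk : k = j
  · subst hk
    simp only [Matrix.updateRow_self]
    exact contDiff_const
  · simp only [Matrix.updateRow_ne hk]
    exact hA k l

variable {ζ : Fin N → ℂ} {v : E → Fin N → Fin 2 → ℂ}

lemma contDiff_matM (hv : ∀ k i, ContDiff ℝ ∞ fun x => v x k i) (j k : Fin N) :
    ContDiff ℝ ∞ fun x => matM ζ (v x) j k := by
  simp only [matM, Matrix.of_apply, σ₃, dotProduct, Matrix.mulVec, Fin.sum_univ_two,
    Pi.star_apply, RCLike.star_def, Matrix.cons_val', Matrix.cons_val_zero, Matrix.cons_val_one,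
    Matrix.empty_val', Matrix.cons_val_fin_one]
  have h := fun k i => contDiff_conj (hv k i)
  have := hv j 0
  have := hv j 1
  have := h k 0
  have := h k 1
  fun_prop

lemma contDiff_residueVector (hζ : IsSpectrum ζ) (hv0 : ∀ x k, v x k ≠ 0)
    (hv : ∀ k i, ContDiff ℝ ∞ fun x => v x k i) (k : Fin N) :
    ContDiff ℝ ∞ fun x => residueVector ζ (v x) k := by
  simp only [residueVector, Matrix.mulVec, dotProduct]
  exact ContDiff.sum fun j _ =>
    (contDiff_matrix_inv (contDiff_matM hv) (fun x => det_matM_ne_zero hζ (hv0 x)) k j).mul (hv j 0)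

lemma contDiff_coeff_numA (hζ : IsSpectrum ζ) (hv0 : ∀ x k, v x k ≠ 0)
    (hv : ∀ k i, ContDiff ℝ ∞ fun x => v x k i) (n : ℕ) :
    ContDiff ℝ ∞ fun x => (numA ζ (v x)).coeff n := by
  simp only [numA, residueA, coeff_add, finsetSum_coeff, coeff_C_mul]
  refine contDiff_const.add (ContDiff.sum fun k _ => ?_)
  exact (((contDiff_const.mul (contDiff_residueVector hζ hv0 hv k)).mul contDiff_const).mul
    (contDiff_conj (hv k 0))).mul contDiff_const

lemma contDiff_coeff_numB (hζ : IsSpectrum ζ) (hv0 : ∀ x k, v x k ≠ 0)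
    (hv : ∀ k i, ContDiff ℝ ∞ fun x => v x k i) (n : ℕ) :
    ContDiff ℝ ∞ fun x => (numB ζ (v x)).coeff n := by
  simp only [numB, residueB, finsetSum_coeff, coeff_C_mul]
  refine ContDiff.sum fun k _ => ?_
  exact ((contDiff_const.mul (contDiff_residueVector hζ hv0 hv k)).mul
    (contDiff_conj (hv k 1))).mul contDiff_const

lemma contDiff_numA_zero_inv (hζ : IsSpectrum ζ) (hv0 : ∀ x k, v x k ≠ 0)
    (hv : ∀ k i, ContDiff ℝ ∞ fun x => v x k i) :
    ContDiff ℝ ∞ fun x => ((numA ζ (v x)).eval 0)⁻¹ := by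
  refine ContDiff.inv ?_ fun x => numA_zero_ne_zero hζ (hv0 x)
  simp only [← coeff_zero_eq_eval_zero]
  exact contDiff_coeff_numA hζ hv0 hv 0

lemma contDiff_coeff_dressA (hζ : IsSpectrum ζ) (hv0 : ∀ x k, v x k ≠ 0)
    (hv : ∀ k i, ContDiff ℝ ∞ fun x => v x k i) (n : ℕ) :
    ContDiff ℝ ∞ fun x => (dressA ζ (v x)).coeff n := by
  simp only [dressA, coeff_C_mul]
  exact (contDiff_numA_zero_inv hζ hv0 hv).mul (contDiff_coeff_numA hζ hv0 hv n)

lemma contDiff_coeff_dressB (hζ : IsSpectrum ζ) (hv0 : ∀ x k, v x k ≠ 0)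
    (hv : ∀ k i, ContDiff ℝ ∞ fun x => v x k i) (n : ℕ) :
    ContDiff ℝ ∞ fun x => (dressB ζ (v x)).coeff n := by
  simp only [dressB, coeff_C_mul]
  exact (contDiff_numA_zero_inv hζ hv0 hv).mul (contDiff_coeff_numB hζ hv0 hv n)

end Smooth

/-! ### Differentiating families of polynomials of bounded degree -/

section PolyDeriv

/-- The polynomial `f'` is the derivative at `s` of the family `f` of polynomials, coefficient by
coefficient. -/
def HasPolyDerivAt (f : ℝ → ℂ[X]) (f' : ℂ[X]) (s : ℝ) : Prop :=
  ∀ n, HasDerivAt (fun y => (f y).coeff n) (f'.coeff n) s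

variable {f : ℝ → ℂ[X]} {f' : ℂ[X]} {s : ℝ} {N : ℕ}

lemma hasDerivAt_conj {g : ℝ → ℂ} {g' : ℂ} (h : HasDerivAt g g' s) :
    HasDerivAt (fun y => conj (g y)) (conj g') s :=
  conjCLE.toContinuousLinearMap.hasFDerivAt.comp_hasDerivAt s h

/-- The uniform degree bound is what keeps the coefficientwise derivative a polynomial. -/
lemma hasPolyDerivAt_of_differentiable (hd : ∀ n, DifferentiableAt ℝ (fun y => (f y).coeff n) s)
    (hN : ∀ y, (f y).natDegree ≤ N) : ∃ f', HasPolyDerivAt f f' s := by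
  refine ⟨∑ i ∈ Finset.range (N + 1), monomial i (deriv (fun y => (f y).coeff i) s), fun n => ?_⟩
  simp only [finsetSum_coeff, coeff_monomial, Finset.sum_ite_eq', Finset.mem_range]
  split_ifs with h
  · exact (hd n).hasDerivAt
  · have : (fun y => (f y).coeff n) = fun _ => 0 :=
      funext fun y => coeff_eq_zero_of_natDegree_lt ((hN y).trans_lt (by omega))
    rw [this]
    exact hasDerivAt_const _ _

lemma HasPolyDerivAt.natDegree_le (h : HasPolyDerivAt f f' s) (hN : ∀ y, (f y).natDegree ≤ N) :
    f'.natDegree ≤ N := by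
  refine natDegree_le_iff_coeff_eq_zero.2 fun n hn => ?_
  have : (fun y => (f y).coeff n) = fun _ => 0 :=
    funext fun y => coeff_eq_zero_of_natDegree_lt ((hN y).trans_lt hn)
  have h1 := h n
  rw [this] at h1
  exact h1.unique (hasDerivAt_const _ _)

lemma HasPolyDerivAt.degree_lt (h : HasPolyDerivAt f f' s) (hN : ∀ y, (f y).degree < N) :
    f'.degree < N := by
  refine (degree_lt_iff_coeff_zero _ _).2 fun n hn => ?_
  have : (fun y => (f y).coeff n) = fun _ => 0 :=
    funext fun y => (degree_lt_iff_coeff_zero _ _).1 (hN y) n hn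
  have h1 := h n
  rw [this] at h1
  exact h1.unique (hasDerivAt_const _ _)

lemma HasPolyDerivAt.eval (h : HasPolyDerivAt f f' s) (hN : ∀ y, (f y).natDegree ≤ N) (z : ℂ) :
    HasDerivAt (fun y => (f y).eval z) (f'.eval z) s := by
  have h1 : ∀ y, (f y).eval z = ∑ i ∈ Finset.range (N + 1), (f y).coeff i * z ^ i :=
    fun y => eval_eq_sum_range' (Nat.lt_succ_of_le (hN y)) z
  simp only [h1]
  rw [eval_eq_sum_range' (Nat.lt_succ_of_le (h.natDegree_le hN)) z]
  exact HasDerivAt.fun_sum fun i _ => (h i).mul_const _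

lemma HasPolyDerivAt.const_mul (h : HasPolyDerivAt f f' s) (p : ℂ[X]) :
    HasPolyDerivAt (fun y => p * f y) (p * f') s := by
  intro n
  simp only [coeff_mul]
  exact HasDerivAt.fun_sum fun i _ => (h i.2).const_mul _

end PolyDeriv

/-! ### Evolution equations of the dressing matrix from rigidity -/

section Flow

variable {N : ℕ} {ζ : Fin N → ℂ}

lemma IsDressing.natDegree_le' {v : Fin N → Fin 2 → ℂ} {a b : ℂ[X]} (h : IsDressing ζ v a b) :
    b.natDegree ≤ N :=
  natDegree_le_of_degree_le h.degree_lt.le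

/-- If the kernel vectors evolve by `v' = -Ω(ζ²) σ₃ v` and `V`, `W` are such that the right-hand
sides have the right degrees, then the dressing matrix evolves by `P' = [[V, ζW], ..] P + Ω P σ₃`. -/
lemma IsDressing.flow (hζ : IsSpectrum ζ) {v : ℝ → Fin N → Fin 2 → ℂ} {a b : ℝ → ℂ[X]}
    (hv : ∀ s k, v s k ≠ 0) (h : ∀ s, IsDressing ζ (v s) (a s) (b s)) {s : ℝ} {a' b' Ω V W : ℂ[X]}
    (ha : HasPolyDerivAt a a' s) (hb : HasPolyDerivAt b b' s) (hΩ : conjPoly Ω = -Ω)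
    (hv0 : ∀ k, HasDerivAt (fun y => v y k 0) (-Ω.eval (ζ k ^ 2) * v s k 0) s)
    (hv1 : ∀ k, HasDerivAt (fun y => v y k 1) (Ω.eval (ζ k ^ 2) * v s k 1) s)
    (hV0 : V.coeff 0 = 0) (hΩ0 : Ω.coeff 0 = 0)
    (hdeg1 : ((V + Ω) * a s - X * (W * conjPoly (b s))).degree ≤ (N : WithBot ℕ))
    (hdeg2 : ((V - Ω) * b s + W * conjPoly (a s)).degree < N) :
    a' = (V + Ω) * a s - X * (W * conjPoly (b s)) ∧ b' = (V - Ω) * b s + W * conjPoly (a s) := by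
  -- Anti-self-conjugacy of Ω lets the conjugated vectors evolve with Ω evaluated at the conjugate
  -- nodes, so that the range condition is propagated as well.
  have hΩc : ∀ k, conj (Ω.eval (ζ k ^ 2)) = -Ω.eval (conj (ζ k) ^ 2) := fun k => by
    rw [← eval_neg, ← hΩ, eval_conjPoly, map_pow, conj_conj]
  -- The differentiated conditions are inhomogeneous only through Ω, and the V and W terms respect
  -- the conditions at time s, so the defect satisfies the homogeneous ones.
  have hK : IsDressed ζ (v s) (a' - ((V + Ω) * a s - X * (W * conjPoly (b s))))
      (b' - ((V - Ω) * b s + W * conjPoly (a s))) := by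
    refine ⟨fun j => ?_, fun j => ?_⟩
    · have h1 := (((ha.eval (fun y => (h y).natDegree_le) (ζ j ^ 2)).mul (hv0 j)).add
        (((hb.eval (fun y => (h y).natDegree_le') (ζ j ^ 2)).const_mul (ζ j)).mul (hv1 j)))
      have h2 : ((fun y => (a y).eval (ζ j ^ 2)) * fun y => v y j 0) +
          ((fun y => ζ j * (b y).eval (ζ j ^ 2)) * fun y => v y j 1) = fun _ => 0 :=
        funext fun y => (h y).kernel j
      rw [h2] at h1
      have h3 := h1.unique (hasDerivAt_const _ _)
      have h4 := (h s).kernel j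
      have h5 := (h s).range_conj j
      simp only [eval_sub, eval_add, eval_mul, eval_X]
      linear_combination h3 - V.eval (ζ j ^ 2) * h4 - ζ j * W.eval (ζ j ^ 2) * h5
    · have h1 := ((ha.eval (fun y => (h y).natDegree_le) (conj (ζ j) ^ 2)).mul (hasDerivAt_conj (hv1 j))).sub
        (((hb.eval (fun y => (h y).natDegree_le') (conj (ζ j) ^ 2)).const_mul (conj (ζ j))).mul
          (hasDerivAt_conj (hv0 j)))
      have h2 : ((fun y => (a y).eval (conj (ζ j) ^ 2)) * fun y => conj (v y j 1)) -
          ((fun y => conj (ζ j) * (b y).eval (conj (ζ j) ^ 2)) * fun y => conj (v y j 0)) =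
            fun _ => 0 :=
        funext fun y => sub_eq_zero.2 ((h y).range j)
      rw [h2] at h1
      have h3 := h1.unique (hasDerivAt_const _ _)
      have h4 := (h s).range j
      have h5 := (h s).kernel_conj j
      rw [map_mul, map_mul, map_neg, hΩc j] at h3
      simp only [eval_sub, eval_add, eval_mul, eval_X]
      linear_combination h3 - V.eval (conj (ζ j) ^ 2) * h4 +
        conj (ζ j) * W.eval (conj (ζ j) ^ 2) * h5
  -- The normalization a(0) = 1 is constant in s; this brings the defect into the version of
  -- rigidity that allows degree N in the first entry.
  have h0 : a'.coeff 0 = 0 := by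
    have h1 : (fun y => (a y).coeff 0) = fun _ => 1 := funext fun y => by
      rw [coeff_zero_eq_eval_zero, (h y).eval_zero]
    have h2 := ha 0
    rw [h1] at h2
    exact h2.unique (hasDerivAt_const _ _)
  obtain ⟨h1, h2⟩ := hK.eq_zero_of_coeff_zero hζ (hv s)
    ((degree_sub_le _ _).trans (max_le (natDegree_le_iff_degree_le.1
      (ha.natDegree_le fun y => (h y).natDegree_le)) hdeg1))
    (by simp [h0, hV0, hΩ0, mul_coeff_zero])
    ((degree_sub_le _ _).trans_lt (max_lt (hb.degree_lt fun y => (h y).degree_lt) hdeg2))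
  exact ⟨sub_eq_zero.1 h1, sub_eq_zero.1 h2⟩

/-- The λ^{2N} coefficient of the determinant identity, to which λ b b* does not contribute. Thus
|a_N| depends on the spectrum alone, not on the vectors. -/
lemma IsDressing.coeff_mul_conj (hζ : IsSpectrum ζ) {v : Fin N → Fin 2 → ℂ} {a b : ℂ[X]}
    (hv : ∀ k, v k ≠ 0) (h : IsDressing ζ v a b) :
    a.coeff N * conj (a.coeff N) = (polePoly ζ).coeff N * conj ((polePoly ζ).coeff N) := by
  have h1 := congrArg (fun p => coeff p (N + N)) (h.detPoly_eq hζ hv)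
  simp only [detPoly, coeff_add] at h1
  rw [coeff_mul_add_eq_of_natDegree_le h.natDegree_le ((natDegree_conjPoly a).trans_le h.natDegree_le),
    coeff_mul_add_eq_of_natDegree_le hζ.natDegree_polePoly.le
      ((natDegree_conjPoly _).trans_le hζ.natDegree_polePoly.le), coeff_conjPoly,
    coeff_conjPoly] at h1
  rw [← h1]
  have h2 : (X * (b * conjPoly b)).coeff (N + N) = 0 := by
    rcases eq_or_ne b 0 with rfl | hb
    · simp
    · have hb' := (natDegree_lt_iff_degree_lt hb).2 h.degree_lt
      exact coeff_eq_zero_of_natDegree_lt ((natDegree_mul_le.trans (add_le_add natDegree_X_le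
          (degree_mul_conjPoly_le (n := N - 1) (by omega)))).trans_lt (by omega))
  rw [h2, add_zero]

lemma IsSpectrum.coeff_polePoly_ne_zero (hζ : IsSpectrum ζ) : (polePoly ζ).coeff N ≠ 0 := by
  have h : polePoly ζ ≠ 0 := fun h => by
    have := hζ.polePoly_zero
    simp [h] at this
  have := leadingCoeff_ne_zero.2 h
  rwa [leadingCoeff, hζ.natDegree_polePoly] at this

lemma IsDressing.coeff_ne_zero (hζ : IsSpectrum ζ) {v : Fin N → Fin 2 → ℂ} {a b : ℂ[X]}
    (hv : ∀ k, v k ≠ 0) (h : IsDressing ζ v a b) : a.coeff N ≠ 0 := by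
  intro h0
  have h1 := h.coeff_mul_conj hζ hv
  rw [h0, zero_mul, eq_comm, mul_conj, ofReal_eq_zero, normSq_eq_zero] at h1
  exact hζ.coeff_polePoly_ne_zero h1

/-- The potential read off from the leading coefficients of the dressing matrix. -/
def leadingPotential (N : ℕ) (a b : ℂ[X]) : ℂ := 2 * I * (X * b).coeff N / conj (a.coeff N)

/-- The evolution of the dressing matrix in `x`. -/
lemma IsDressing.flow_x (hζ : IsSpectrum ζ) {v : ℝ → Fin N → Fin 2 → ℂ} {a b : ℝ → ℂ[X]}
    (hv : ∀ s k, v s k ≠ 0) (h : ∀ s, IsDressing ζ (v s) (a s) (b s)) {s : ℝ} {a' b' : ℂ[X]}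
    (ha : HasPolyDerivAt a a' s) (hb : HasPolyDerivAt b b' s)
    (hv0 : ∀ k, HasDerivAt (fun y => v y k 0) (-(I * ζ k ^ 2) * v s k 0) s)
    (hv1 : ∀ k, HasDerivAt (fun y => v y k 1) (I * ζ k ^ 2 * v s k 1) s) :
    a' = -(C (leadingPotential N (a s) (b s)) * (X * conjPoly (b s))) ∧
      b' = C (leadingPotential N (a s) (b s)) * conjPoly (a s) - C (2 * I) * (X * b s) := by
  set q := leadingPotential N (a s) (b s) with hq
  have hb0 : ∀ n, N ≤ n → (b s).coeff n = 0 := (degree_lt_iff_coeff_zero _ _).1 (h s).degree_lt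
  have ha0 : ∀ n, N < n → (a s).coeff n = 0 := fun n hn =>
    coeff_eq_zero_of_natDegree_lt ((h s).natDegree_le.trans_lt hn)
  have h1 : (-(C I * X) + C I * X) * a s - X * (C q * conjPoly (b s)) =
      -(C q * (X * conjPoly (b s))) := by ring
  have h2 : (-(C I * X) - C I * X) * b s + C q * conjPoly (a s) =
      C q * conjPoly (a s) - C (2 * I) * (X * b s) := by
    rw [C_mul, show (C 2 : ℂ[X]) = 2 from rfl]
    ring
  -- Here V + Ω = 0, so the first degree bound is automatic; the second amounts to cancelling the
  -- coefficient of λ^N, which is how the leading potential was chosen.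
  have key := IsDressing.flow (W := C q) (V := -(C I * X)) (Ω := C I * X) hζ hv h ha hb ?_ ?_ ?_
    (by simp) (by simp) ?_ ?_
  · rwa [h1, h2] at key
  · simp [conjPoly]
  · simpa using hv0
  · simpa using hv1
  · rw [h1, ← natDegree_le_iff_degree_le, natDegree_le_iff_coeff_eq_zero]
    intro n hn
    obtain ⟨m, rfl⟩ : ∃ m, n = m + 1 := ⟨n - 1, by omega⟩
    rw [coeff_neg, coeff_C_mul, coeff_X_mul, coeff_conjPoly, hb0 m (by omega)]
    simp
  · rw [h2, degree_lt_iff_coeff_zero]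
    intro n hn
    rw [coeff_sub, coeff_C_mul, coeff_C_mul, coeff_conjPoly]
    rcases hn.eq_or_lt with rfl | hn
    · have h3 := (h s).coeff_ne_zero hζ (hv s)
      have h4 : conj ((a s).coeff N) ≠ 0 := by simpa using h3
      rw [hq, leadingPotential]
      field_simp
      ring
    · obtain ⟨m, rfl⟩ : ∃ m, n = m + 1 := ⟨n - 1, by omega⟩
      rw [coeff_X_mul, hb0 m (by omega), ha0 _ hn]
      simp

end Flow

/-! ### Relations between leading coefficients -/

section LeadingCoefficients

lemma conjPoly_X_pow_mul (n : ℕ) (p : ℂ[X]) : conjPoly (X ^ n * p) = X ^ n * conjPoly p := by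
  simp [conjPoly]

variable {N : ℕ} {a b : ℝ → ℂ[X]} {q q₁ q₂ : ℝ → ℂ}

/-- The recursion for the coefficients in `x`. -/
lemma hasDerivAt_coeff_shift_left
    (ha : ∀ x, HasPolyDerivAt a (-(C (q x) * (X * conjPoly (b x)))) x) (k : ℕ) (x : ℝ) :
    HasDerivAt (fun y => (X ^ 3 * a y).coeff (k + 1))
      (-(q x * conj ((X ^ 3 * b x).coeff k))) x := by
  convert (ha x).const_mul (X ^ 3) (k + 1) using 1
  have : X ^ 3 * -(C (q x) * (X * conjPoly (b x))) = -(C (q x) * (X * conjPoly (X ^ 3 * b x))) := by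
    rw [conjPoly_X_pow_mul]; ring
  rw [this, coeff_neg, coeff_C_mul, coeff_X_mul, coeff_conjPoly]

lemma hasDerivAt_coeff_shift_right
    (hb : ∀ x, HasPolyDerivAt b (C (q x) * conjPoly (a x) - C (2 * I) * (X * b x)) x)
    (k : ℕ) (x : ℝ) :
    HasDerivAt (fun y => (X ^ 3 * b y).coeff (k + 1))
      (q x * conj ((X ^ 3 * a x).coeff (k + 1)) - 2 * I * (X ^ 3 * b x).coeff k) x := by
  convert (hb x).const_mul (X ^ 3) (k + 1) using 1
  have : X ^ 3 * (C (q x) * conjPoly (a x) - C (2 * I) * (X * b x)) =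
      C (q x) * conjPoly (X ^ 3 * a x) - C (2 * I) * (X * (X ^ 3 * b x)) := by
    rw [conjPoly_X_pow_mul]; ring
  rw [this, coeff_sub, coeff_C_mul, coeff_C_mul, coeff_X_mul, coeff_conjPoly]

/-- The algebraic relations between the leading coefficients that result from the recursion. -/
lemma leading_relations
    (ha : ∀ x, HasPolyDerivAt a (-(C (q x) * (X * conjPoly (b x)))) x)
    (hb : ∀ x, HasPolyDerivAt b (C (q x) * conjPoly (a x) - C (2 * I) * (X * b x)) x)
    (hdb : ∀ x, (b x).degree < N)
    (hq : ∀ x, HasDerivAt q (q₁ x) x) (hq₁ : ∀ x, HasDerivAt q₁ (q₂ x) x) (x : ℝ)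
    {A₀ A₁ A₂ B₁ B₂ B₃ w₁ w₂ f₀ f₁ f₂ : ℂ}
    (hA₀ : A₀ = (X ^ 3 * a x).coeff (N + 3)) (hA₁ : A₁ = (X ^ 3 * a x).coeff (N + 2))
    (hA₂ : A₂ = (X ^ 3 * a x).coeff (N + 1)) (hB₁ : B₁ = (X ^ 3 * b x).coeff (N + 2))
    (hB₂ : B₂ = (X ^ 3 * b x).coeff (N + 1)) (hB₃ : B₃ = (X ^ 3 * b x).coeff N)
    (hw₁ : w₁ = -(q x * conj (q x)) / 2)
    (hw₂ : w₂ = 3 / 8 * (q x * conj (q x)) ^ 2 -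
      I / 4 * (conj (q x) * q₁ x - q x * conj (q₁ x)))
    (hf₀ : f₀ = I * q x) (hf₁ : f₁ = -q₁ x / 2 - I / 2 * (q x * conj (q x)) * q x)
    (hf₂ : f₂ = I / 2 * (-q₂ x / 2 - 3 * I / 2 * (q x * conj (q x)) * q₁ x +
      3 / 4 * (q x * conj (q x)) ^ 2 * q x)) :
    2 * B₁ + f₀ * conj A₀ = 0 ∧
    2 * B₂ + w₁ * B₁ + f₀ * conj A₁ + f₁ * conj A₀ = 0 ∧
    2 * B₃ + w₁ * B₂ + w₂ * B₁ + f₀ * conj A₂ + f₁ * conj A₁ + f₂ * conj A₀ = 0 ∧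
    w₁ * A₀ - f₀ * conj B₁ = 0 ∧
    w₁ * A₁ + w₂ * A₀ - f₀ * conj B₂ - f₁ * conj B₁ = 0 := by
  -- The factor X³ replaces the indices N - 1, N - 2, N - 3 by natural numbers, and coefficients of
  -- negative index become zero. So A₀, A₁, A₂ stand for a_N, a_{N-1}, a_{N-2} and B₁, B₂, B₃ for
  -- b_{N-1}, b_{N-2}, b_{N-3}.
  have dA := hasDerivAt_coeff_shift_left ha
  have dB := hasDerivAt_coeff_shift_right hb
  -- The coefficient b_N is identically zero, so its derivative vanishes. The next two relations are
  -- the first and second x-derivatives of this one, with the recursion substituted.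
  have R0 : ∀ x, q x * conj ((X ^ 3 * a x).coeff (N + 3)) = 2 * I * (X ^ 3 * b x).coeff (N + 2) := by
    intro x
    have h1 := dB (N + 2) x
    have h2 : (fun y => (X ^ 3 * b y).coeff (N + 2 + 1)) = fun _ => 0 := funext fun y => by
      rw [show N + 2 + 1 = N + 3 from rfl, coeff_X_pow_mul,
        (degree_lt_iff_coeff_zero _ _).1 (hdb y) N le_rfl]
    rw [h2] at h1
    exact sub_eq_zero.1 (h1.unique (hasDerivAt_const _ _))
  have E1 : ∀ x, q₁ x * conj ((X ^ 3 * a x).coeff (N + 3)) -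
      q x * conj (q x) * (X ^ 3 * b x).coeff (N + 2) =
      2 * I * (q x * conj ((X ^ 3 * a x).coeff (N + 2)) - 2 * I * (X ^ 3 * b x).coeff (N + 1)) := by
    intro x
    have h1 := (hq x).mul (hasDerivAt_conj (dA (N + 2) x))
    have h2 : (q * fun y => conj ((X ^ 3 * a y).coeff (N + 2 + 1))) =
      fun y => 2 * I * (X ^ 3 * b y).coeff (N + 1 + 1) := funext fun y => R0 y
    rw [h2] at h1
    have h3 := h1.unique ((dB (N + 1) x).const_mul (2 * I))
    simp only [map_neg, map_mul, conj_conj] at h3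
    linear_combination h3
  have E2 : q₂ x * conj A₀ - 2 * q₁ x * conj (q x) * B₁ - q x * conj (q₁ x) * B₁
      - q x * conj (q x) * (q x * conj A₁ - 2 * I * B₂) =
      2 * I * (q₁ x * conj A₁ - q x * conj (q x) * B₂ - 2 * I * (q x * conj A₂ - 2 * I * B₃)) := by
    have h1 := ((hq₁ x).mul (hasDerivAt_conj (dA (N + 2) x))).sub
      (((hq x).mul (hasDerivAt_conj (hq x))).mul (dB (N + 1) x))
    have h2 : (q₁ * fun y => conj ((X ^ 3 * a y).coeff (N + 2 + 1))) -
        ((q * fun y => conj (q y)) * fun y => (X ^ 3 * b y).coeff (N + 1 + 1)) =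
        fun y => 2 * I * (q y * conj ((X ^ 3 * a y).coeff (N + 1 + 1)) -
          2 * I * (X ^ 3 * b y).coeff (N + 1)) := funext fun y => E1 y
    rw [h2] at h1
    have h3 := h1.unique ((((hq x).mul (hasDerivAt_conj (dA (N + 1) x))).sub
      ((dB N x).const_mul (2 * I))).const_mul (2 * I))
    simp only [map_neg, map_mul, conj_conj, Pi.mul_apply] at h3
    rw [hA₀, hA₁, hA₂, hB₁, hB₂, hB₃]
    linear_combination h3
  have R0x := R0 x
  have E1x := E1 x
  rw [← hA₀, ← hB₁] at R0x
  rw [← hA₀, ← hB₁, ← hA₁, ← hB₂] at E1x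
  have R0c : conj (q x) * A₀ + 2 * I * conj B₁ = 0 := by
    have := congrArg (starRingEnd ℂ) R0x
    simp only [map_mul, conj_conj, conj_I, map_ofNat] at this
    linear_combination this
  have hI : I * I = -1 := I_mul_I
  have C1 : 2 * B₁ + f₀ * conj A₀ = 0 := by
    rw [hf₀]
    linear_combination I * R0x + 2 * B₁ * hI
  have C2 : 2 * B₂ + w₁ * B₁ + f₀ * conj A₁ + f₁ * conj A₀ = 0 := by
    rw [hf₀] at C1
    rw [hw₁, hf₀, hf₁]
    linear_combination -1 / 2 * E1x - q x * conj (q x) / 2 * C1 + 2 * B₂ * hI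
  -- The relations for the diagonal entry come from the conjugates of those for the off-diagonal
  -- entry; w₁ is real.
  have C2c : 2 * conj B₂ + w₁ * conj B₁ - I * conj (q x) * A₁ + conj f₁ * A₀ = 0 := by
    have := congrArg (starRingEnd ℂ) C2
    simp only [map_mul, map_add, conj_conj, conj_I, map_ofNat, map_zero, hw₁, hf₀, map_div₀,
      map_neg] at this
    rw [hw₁]
    linear_combination this
  have hf₁c : conj f₁ = -conj (q₁ x) / 2 + I / 2 * (q x * conj (q x)) * conj (q x) := by
    rw [hf₁]
    simp only [map_mul, map_sub, map_neg, map_div₀, conj_conj, conj_I, map_ofNat]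
    ring
  rw [hf₁c] at C2c
  refine ⟨C1, C2, ?_, ?_, ?_⟩
  · rw [hf₀, hf₁, hw₁] at C2
    rw [hw₁, hw₂, hf₀, hf₁, hf₂]
    linear_combination -(I / 4) * E2 - 3 / 4 * (q x * conj (q x)) * C2 +
      3 / 8 * conj (q x) * q₁ x * R0x + (2 * B₃ * (1 - I * I) +
        q x * conj (q x) * B₂ - 3 / 4 * q x * conj (q x) * q₁ x * conj A₀ + q x * I * conj A₂ -
        1 / 2 * q₁ x * conj A₁) * hI
  · rw [hw₁, hf₀]
    linear_combination -q x / 2 * R0c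
  · rw [hw₁] at C2c
    rw [hw₁, hw₂, hf₀, hf₁]
    linear_combination -(I * q x) / 2 * C2c +
      (1 / 8 * (q x) ^ 2 * conj (q x) - I / 4 * q₁ x) * R0c +
      (-1 / 2 * q x * conj (q x) * A₁ + 1 / 4 * q x ^ 2 * conj (q x) ^ 2 * A₀ +
        1 / 2 * q₁ x * conj B₁) * hI

end LeadingCoefficients

/-! ### Degree conditions for the time flow -/

section TimeDegree

variable {N : ℕ} {a b : ℂ[X]} {w₁ w₂ f₀ f₁ f₂ : ℂ}

/-- The diagonal entry of the matrix of the time evolution. -/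
def timeDiag (w₁ w₂ : ℂ) : ℂ[X] := C (-2 * I) * (X ^ 3 + C w₁ * X ^ 2 + C w₂ * X)

/-- The off-diagonal entry, divided by `ζ`, of the matrix of the time evolution. -/
def timeOff (f₀ f₁ f₂ : ℂ) : ℂ[X] := C (-2 * I) * (C f₀ * X ^ 2 + C f₁ * X + C f₂)

lemma coeff_shift_one (p : ℂ[X]) (n : ℕ) : (X ^ 2 * p).coeff n = (X ^ 3 * p).coeff (n + 1) := by
  rw [pow_succ' X 2, mul_assoc, coeff_X_mul]

lemma coeff_shift_two (p : ℂ[X]) (n : ℕ) : (X * p).coeff n = (X ^ 3 * p).coeff (n + 2) := by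
  rw [show (X : ℂ[X]) ^ 3 * p = X ^ 2 * (X * p) by ring, coeff_X_pow_mul]

lemma coeff_shift_three (p : ℂ[X]) (n : ℕ) : p.coeff n = (X ^ 3 * p).coeff (n + 3) := by
  rw [coeff_X_pow_mul]

/-- The λ³ terms of the diagonal part cancel, so only the coefficients of λ^{N+1} and λ^{N+2} have
to be killed, one hypothesis for each. -/
lemma degree_time_left (ha : a.natDegree ≤ N) (hb : b.degree < N)
    (h1 : w₁ * (X ^ 3 * a).coeff (N + 3) - f₀ * conj ((X ^ 3 * b).coeff (N + 2)) = 0)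
    (h2 : w₁ * (X ^ 3 * a).coeff (N + 2) + w₂ * (X ^ 3 * a).coeff (N + 3) -
      f₀ * conj ((X ^ 3 * b).coeff (N + 1)) - f₁ * conj ((X ^ 3 * b).coeff (N + 2)) = 0) :
    ((timeDiag w₁ w₂ + C (2 * I) * X ^ 3) * a -
      X * (timeOff f₀ f₁ f₂ * conjPoly b)).degree ≤ (N : WithBot ℕ) := by
  have ha0 : ∀ n, N + 3 < n → (X ^ 3 * a).coeff n = 0 := fun n hn => by
    obtain ⟨m, rfl⟩ : ∃ m, n = m + 3 := ⟨n - 3, by omega⟩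
    rw [coeff_X_pow_mul, coeff_eq_zero_of_natDegree_lt (ha.trans_lt (by omega))]
  have hb0 : ∀ n, N + 3 ≤ n → (X ^ 3 * b).coeff n = 0 := fun n hn => by
    obtain ⟨m, rfl⟩ : ∃ m, n = m + 3 := ⟨n - 3, by omega⟩
    rw [coeff_X_pow_mul, (degree_lt_iff_coeff_zero _ _).1 hb m (by omega)]
  have key : (timeDiag w₁ w₂ + C (2 * I) * X ^ 3) * a - X * (timeOff f₀ f₁ f₂ * conjPoly b) =
      C (-2 * I) * (C w₁ * (X ^ 2 * a) + C w₂ * (X * a) - C f₀ * conjPoly (X ^ 3 * b)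
        - C f₁ * (X ^ 2 * conjPoly b) - C f₂ * (X * conjPoly b)) := by
    rw [conjPoly_X_pow_mul, timeDiag, timeOff, show C (-2 * I) = -C (2 * I) by
      rw [← C_neg, neg_mul]]
    ring
  rw [key, ← natDegree_le_iff_degree_le, natDegree_le_iff_coeff_eq_zero]
  intro n hn
  rw [coeff_C_mul]
  refine mul_eq_zero_of_right _ ?_
  simp only [coeff_sub, coeff_add, coeff_C_mul, coeff_shift_one _ n, coeff_shift_two _ n,
    ← conjPoly_X_pow_mul, coeff_conjPoly]
  obtain rfl | rfl | hn : n = N + 1 ∨ n = N + 2 ∨ N + 3 ≤ n := by omega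
  · rw [hb0 (N + 1 + 2) (by omega), map_zero]
    linear_combination h2
  · rw [hb0 (N + 2 + 2) (by omega), hb0 (N + 2 + 1) (by omega), ha0 (N + 2 + 2) (by omega), map_zero]
    linear_combination h1
  · rw [hb0 n hn, hb0 (n + 1) (by omega), hb0 (n + 2) (by omega), ha0 (n + 1) (by omega),
      ha0 (n + 2) (by omega), map_zero]
    ring

/-- Here the λ³ terms add up instead of cancelling: the coefficients of λ^N, λ^{N+1} and λ^{N+2}
must vanish, whence three hypotheses. -/
lemma degree_time_right (ha : a.natDegree ≤ N) (hb : b.degree < N)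
    (h1 : 2 * (X ^ 3 * b).coeff (N + 2) + f₀ * conj ((X ^ 3 * a).coeff (N + 3)) = 0)
    (h2 : 2 * (X ^ 3 * b).coeff (N + 1) + w₁ * (X ^ 3 * b).coeff (N + 2) +
      f₀ * conj ((X ^ 3 * a).coeff (N + 2)) + f₁ * conj ((X ^ 3 * a).coeff (N + 3)) = 0)
    (h3 : 2 * (X ^ 3 * b).coeff N + w₁ * (X ^ 3 * b).coeff (N + 1) +
      w₂ * (X ^ 3 * b).coeff (N + 2) + f₀ * conj ((X ^ 3 * a).coeff (N + 1)) +
      f₁ * conj ((X ^ 3 * a).coeff (N + 2)) + f₂ * conj ((X ^ 3 * a).coeff (N + 3)) = 0) :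
    ((timeDiag w₁ w₂ - C (2 * I) * X ^ 3) * b + timeOff f₀ f₁ f₂ * conjPoly a).degree <
      (N : WithBot ℕ) := by
  have ha0 : ∀ n, N + 3 < n → (X ^ 3 * a).coeff n = 0 := fun n hn => by
    obtain ⟨m, rfl⟩ : ∃ m, n = m + 3 := ⟨n - 3, by omega⟩
    rw [coeff_X_pow_mul, coeff_eq_zero_of_natDegree_lt (ha.trans_lt (by omega))]
  have hb0 : ∀ n, N + 3 ≤ n → (X ^ 3 * b).coeff n = 0 := fun n hn => by
    obtain ⟨m, rfl⟩ : ∃ m, n = m + 3 := ⟨n - 3, by omega⟩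
    rw [coeff_X_pow_mul, (degree_lt_iff_coeff_zero _ _).1 hb m (by omega)]
  have key : (timeDiag w₁ w₂ - C (2 * I) * X ^ 3) * b + timeOff f₀ f₁ f₂ * conjPoly a =
      C (-2 * I) * (C 2 * (X ^ 3 * b) + C w₁ * (X ^ 2 * b) + C w₂ * (X * b)
        + C f₀ * (X ^ 2 * conjPoly a) + C f₁ * (X * conjPoly a) + C f₂ * conjPoly a) := by
    rw [timeDiag, timeOff, show C (-2 * I) = -C (2 * I) by rw [← C_neg, neg_mul],
      show (C 2 : ℂ[X]) = 2 from rfl]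
    ring
  rw [key, degree_lt_iff_coeff_zero]
  intro n hn
  rw [coeff_C_mul]
  refine mul_eq_zero_of_right _ ?_
  simp only [coeff_add, coeff_C_mul, coeff_shift_one _ n, coeff_shift_two _ n,
    coeff_shift_three (conjPoly a) n, ← conjPoly_X_pow_mul, coeff_conjPoly]
  obtain rfl | rfl | rfl | hn : n = N ∨ n = N + 1 ∨ n = N + 2 ∨ N + 3 ≤ n := by omega
  · linear_combination h3
  · rw [hb0 (N + 1 + 2) (by omega), ha0 (N + 1 + 3) (by omega), map_zero]
    linear_combination h2
  · rw [hb0 (N + 2 + 2) (by omega), hb0 (N + 2 + 1) (by omega), ha0 (N + 2 + 2) (by omega),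
      ha0 (N + 2 + 3) (by omega), map_zero]
    linear_combination h1
  · rw [hb0 n hn, hb0 (n + 1) (by omega), hb0 (n + 2) (by omega), ha0 (n + 1) (by omega),
      ha0 (n + 2) (by omega), ha0 (n + 3) (by omega), map_zero]
    ring

end TimeDegree

/-! ### Partial derivatives on the plane -/

section Partial

/-- The partial derivative in `x`. -/
def partialX (f : ℝ × ℝ → ℂ) (p : ℝ × ℝ) : ℂ := fderiv ℝ f p (1, 0)

/-- The partial derivative in `t`. -/
def partialT (f : ℝ × ℝ → ℂ) (p : ℝ × ℝ) : ℂ := fderiv ℝ f p (0, 1)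

variable {f : ℝ × ℝ → ℂ}

lemma contDiff_partialX (hf : ContDiff ℝ ∞ f) : ContDiff ℝ ∞ (partialX f) :=
  (hf.fderiv_right (m := ∞) le_rfl).clm_apply contDiff_const

lemma contDiff_partialT (hf : ContDiff ℝ ∞ f) : ContDiff ℝ ∞ (partialT f) :=
  (hf.fderiv_right (m := ∞) le_rfl).clm_apply contDiff_const

lemma hasDerivAt_partialX (hf : ContDiff ℝ ∞ f) (x t : ℝ) :
    HasDerivAt (fun y => f (y, t)) (partialX f (x, t)) x :=
  ((hf.differentiable (by simp)) (x, t)).hasFDerivAt.comp_hasDerivAt x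
    ((hasDerivAt_id x).prodMk (hasDerivAt_const x t))

lemma hasDerivAt_partialT (hf : ContDiff ℝ ∞ f) (x t : ℝ) :
    HasDerivAt (fun s => f (x, s)) (partialT f (x, t)) t :=
  ((hf.differentiable (by simp)) (x, t)).hasFDerivAt.comp_hasDerivAt t
    ((hasDerivAt_const t x).prodMk (hasDerivAt_id t))

lemma partialX_partialT (hf : ContDiff ℝ ∞ f) (p : ℝ × ℝ) :
    partialX (partialT f) p = partialT (partialX f) p := by
  have hd : DifferentiableAt ℝ (fderiv ℝ f) p :=
    (hf.fderiv_right (m := ∞) le_rfl).differentiable (by simp) p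
  have h : ∀ u w : ℝ × ℝ, fderiv ℝ (fun p => fderiv ℝ f p u) p w = fderiv ℝ (fderiv ℝ f) p w u := by
    intro u w
    rw [fderiv_clm_apply hd (differentiableAt_const u)]
    simp
  have hs : IsSymmSndFDerivAt ℝ f p :=
    hf.contDiffAt.isSymmSndFDerivAt (by
      rw [minSmoothness_of_isRCLikeNormedField]
      exact WithTop.coe_le_coe.2 le_top)
  change fderiv ℝ (fun p => fderiv ℝ f p (0, 1)) p (1, 0) =
    fderiv ℝ (fun p => fderiv ℝ f p (1, 0)) p (0, 1)
  rw [h, h]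
  exact hs _ _

end Partial

/-! ### The multi-soliton and its evolution equation -/

section Soliton

variable {N : ℕ} {ζ α β : Fin N → ℂ}

/-- The family of the kernel vectors. -/
abbrev kernelVectors (ζ α β : Fin N → ℂ) (x t : ℝ) : Fin N → Fin 2 → ℂ :=
  fun k => kernelVector (ζ k) (α k) (β k) x t

/-- The first diagonal entry of the dressing matrix of the multi-soliton. -/
def solA (ζ α β : Fin N → ℂ) (x t : ℝ) : ℂ[X] := dressA ζ (kernelVectors ζ α β x t)

/-- The off-diagonal entry, divided by `ζ`, of the dressing matrix of the multi-soliton. -/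
def solB (ζ α β : Fin N → ℂ) (x t : ℝ) : ℂ[X] := dressB ζ (kernelVectors ζ α β x t)

lemma kernelVectors_ne_zero (h : ∀ k, α k ≠ 0 ∨ β k ≠ 0) (x t : ℝ) (k : Fin N) :
    kernelVectors ζ α β x t k ≠ 0 := by
  intro hk
  have h0 := congrFun hk 0
  have h1 := congrFun hk 1
  simp only [kernelVector, Matrix.cons_val_zero, Matrix.cons_val_one, Pi.zero_apply, mul_eq_zero,
    exp_ne_zero, or_false] at h0 h1
  rcases h k with h | h
  exacts [h h0, h h1]

lemma contDiff_phase (z : ℂ) : ContDiff ℝ ∞ fun p : ℝ × ℝ => phase z p.1 p.2 := by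
  have h1 : ContDiff ℝ ∞ fun p : ℝ × ℝ => (p.1 : ℂ) := ofRealCLM.contDiff.comp contDiff_fst
  have h2 : ContDiff ℝ ∞ fun p : ℝ × ℝ => (p.2 : ℂ) := ofRealCLM.contDiff.comp contDiff_snd
  exact (contDiff_const.mul h1).sub (contDiff_const.mul h2)

lemma contDiff_kernelVectors (k : Fin N) (i : Fin 2) :
    ContDiff ℝ ∞ fun p : ℝ × ℝ => kernelVectors ζ α β p.1 p.2 k i := by
  have h1 := contDiff_phase (ζ k)
  fin_cases i
  · exact contDiff_const.mul h1.cexp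
  · exact contDiff_const.mul h1.neg.cexp

lemma hasDerivAt_phase_x (z : ℂ) (x t : ℝ) :
    HasDerivAt (fun y => phase z y t) (-(I * z ^ 2)) x := by
  have := (((hasDerivAt_id x).ofReal_comp).const_mul (-I * z ^ 2)).sub_const (2 * I * z ^ 6 * t)
  refine HasDerivAt.congr_deriv this ?_
  simp

lemma hasDerivAt_phase_t (z : ℂ) (x t : ℝ) :
    HasDerivAt (fun s => phase z x s) (-(2 * I * (z ^ 2) ^ 3)) t := by
  have := (((hasDerivAt_id t).ofReal_comp).const_mul (2 * I * z ^ 6)).const_sub (-I * z ^ 2 * x)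
  refine HasDerivAt.congr_deriv this ?_
  simp only [ofReal_one]
  ring

lemma isDressing_sol (hζ : IsSpectrum ζ) (hαβ : ∀ k, α k ≠ 0 ∨ β k ≠ 0) (x t : ℝ) :
    IsDressing ζ (kernelVectors ζ α β x t) (solA ζ α β x t) (solB ζ α β x t) :=
  isDressing_dress hζ (kernelVectors_ne_zero hαβ x t)

lemma contDiff_coeff_solA (hζ : IsSpectrum ζ) (hαβ : ∀ k, α k ≠ 0 ∨ β k ≠ 0) (n : ℕ) :
    ContDiff ℝ ∞ fun p : ℝ × ℝ => (solA ζ α β p.1 p.2).coeff n :=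
  contDiff_coeff_dressA (v := fun p : ℝ × ℝ => kernelVectors ζ α β p.1 p.2) hζ
    (fun p => kernelVectors_ne_zero hαβ p.1 p.2) contDiff_kernelVectors n

lemma contDiff_coeff_solB (hζ : IsSpectrum ζ) (hαβ : ∀ k, α k ≠ 0 ∨ β k ≠ 0) (n : ℕ) :
    ContDiff ℝ ∞ fun p : ℝ × ℝ => (solB ζ α β p.1 p.2).coeff n :=
  contDiff_coeff_dressB (v := fun p : ℝ × ℝ => kernelVectors ζ α β p.1 p.2) hζ
    (fun p => kernelVectors_ne_zero hαβ p.1 p.2) contDiff_kernelVectors n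

lemma solitonPotential_eq_partialX (hζ : IsSpectrum ζ) (hαβ : ∀ k, α k ≠ 0 ∨ β k ≠ 0) (x t : ℝ) :
    solitonPotential ζ α β x t =
      partialX (fun p => (solB ζ α β p.1 p.2).coeff 0) (x, t) := by
  rw [solitonPotential]
  have h : (fun y : ℝ => detQuotient ζ fun k => kernelVector (ζ k) (α k) (β k) y t) =
      fun y => (solB ζ α β y t).coeff 0 := funext fun y => by
    rw [detQuotient_eq_eval hζ (kernelVectors_ne_zero hαβ y t), coeff_zero_eq_eval_zero]
    rfl
  rw [h]
  exact (hasDerivAt_partialX (contDiff_coeff_solB hζ hαβ 0) x t).deriv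

lemma contDiff_solitonPotential (hζ : IsSpectrum ζ) (hαβ : ∀ k, α k ≠ 0 ∨ β k ≠ 0) :
    ContDiff ℝ ∞ fun p : ℝ × ℝ => solitonPotential ζ α β p.1 p.2 := by
  simp only [solitonPotential_eq_partialX hζ hαβ]
  exact contDiff_partialX (contDiff_coeff_solB hζ hαβ 0)

lemma flow_x_aux (hζ : IsSpectrum ζ) (hαβ : ∀ k, α k ≠ 0 ∨ β k ≠ 0) (x t : ℝ) :
    HasPolyDerivAt (fun y => solA ζ α β y t)
      (-(C (leadingPotential N (solA ζ α β x t) (solB ζ α β x t)) *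
        (X * conjPoly (solB ζ α β x t)))) x ∧
    HasPolyDerivAt (fun y => solB ζ α β y t)
      (C (leadingPotential N (solA ζ α β x t) (solB ζ α β x t)) * conjPoly (solA ζ α β x t) -
        C (2 * I) * (X * solB ζ α β x t)) x := by
  have hd := isDressing_sol hζ hαβ
  obtain ⟨a', ha⟩ := hasPolyDerivAt_of_differentiable (f := fun y => solA ζ α β y t) (s := x)
    (fun n => (hasDerivAt_partialX (contDiff_coeff_solA hζ hαβ n) x t).differentiableAt)
    fun y => (hd y t).natDegree_le
  obtain ⟨b', hb⟩ := hasPolyDerivAt_of_differentiable (f := fun y => solB ζ α β y t) (s := x)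
    (fun n => (hasDerivAt_partialX (contDiff_coeff_solB hζ hαβ n) x t).differentiableAt)
    fun y => (hd y t).natDegree_le'
  have key := IsDressing.flow_x (v := fun y => kernelVectors ζ α β y t) hζ
    (fun y => kernelVectors_ne_zero hαβ y t) (fun y => hd y t) ha hb
    (fun k => by
      have := ((hasDerivAt_phase_x (ζ k) x t).cexp).const_mul (α k)
      simp only [kernelVectors, kernelVector, Matrix.cons_val_zero]
      refine HasDerivAt.congr_deriv this ?_
      ring)
    (fun k => by
      have := ((hasDerivAt_phase_x (ζ k) x t).neg.cexp).const_mul (β k)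
      simp only [kernelVectors, kernelVector, Matrix.cons_val_one, Matrix.cons_val_fin_one]
      refine HasDerivAt.congr_deriv this ?_
      simp only [Pi.neg_apply]
      ring)
  rw [← key.1, ← key.2]
  exact ⟨ha, hb⟩

/-- At λ = 0 the x-equation for b reduces to b(0)_x = q, because a(0) = 1. This identifies the
potential seen at λ = ∞ with the one seen at λ = 0. -/
lemma leadingPotential_eq (hζ : IsSpectrum ζ) (hαβ : ∀ k, α k ≠ 0 ∨ β k ≠ 0) (x t : ℝ) :
    leadingPotential N (solA ζ α β x t) (solB ζ α β x t) = solitonPotential ζ α β x t := by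
  have h1 := (flow_x_aux hζ hαβ x t).2 0
  have h2 := hasDerivAt_partialX (contDiff_coeff_solB hζ hαβ 0) x t
  have h3 := h1.unique h2
  have h4 := (isDressing_sol hζ hαβ x t).eval_zero
  rw [solitonPotential_eq_partialX hζ hαβ, ← h3, coeff_sub, coeff_C_mul, coeff_C_mul,
    mul_coeff_zero, coeff_X_zero, coeff_conjPoly, coeff_zero_eq_eval_zero, h4]
  simp

/-- The evolution of the first row in `x`. -/
lemma hasPolyDerivAt_solA (hζ : IsSpectrum ζ) (hαβ : ∀ k, α k ≠ 0 ∨ β k ≠ 0) (x t : ℝ) :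
    HasPolyDerivAt (fun y => solA ζ α β y t)
      (-(C (solitonPotential ζ α β x t) * (X * conjPoly (solB ζ α β x t)))) x := by
  rw [← leadingPotential_eq hζ hαβ]
  exact (flow_x_aux hζ hαβ x t).1

lemma hasPolyDerivAt_solB (hζ : IsSpectrum ζ) (hαβ : ∀ k, α k ≠ 0 ∨ β k ≠ 0) (x t : ℝ) :
    HasPolyDerivAt (fun y => solB ζ α β y t)
      (C (solitonPotential ζ α β x t) * conjPoly (solA ζ α β x t) -
        C (2 * I) * (X * solB ζ α β x t)) x := by
  rw [← leadingPotential_eq hζ hαβ]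
  exact (flow_x_aux hζ hαβ x t).2

/-- The evolution in `t` of the antiderivative of the potential. -/
lemma hasDerivAt_coeff_solB_t (hζ : IsSpectrum ζ) (hαβ : ∀ k, α k ≠ 0 ∨ β k ≠ 0) (x t : ℝ)
    {q q₁ q₂ : ℝ → ℂ} (hq0 : ∀ y, q y = solitonPotential ζ α β y t)
    (hq : ∀ y, HasDerivAt q (q₁ y) y) (hq₁ : ∀ y, HasDerivAt q₁ (q₂ y) y) :
    HasDerivAt (fun s => (solB ζ α β x s).coeff 0)
      (-q₂ x / 2 - 3 * I / 2 * (q x * conj (q x)) * q₁ x +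
        3 / 4 * (q x * conj (q x)) ^ 2 * q x) t := by
  have hd := isDressing_sol hζ hαβ
  obtain ⟨a', ha⟩ := hasPolyDerivAt_of_differentiable (f := fun s => solA ζ α β x s) (s := t)
    (fun n => (hasDerivAt_partialT (contDiff_coeff_solA hζ hαβ n) x t).differentiableAt)
    fun s => (hd x s).natDegree_le
  obtain ⟨b', hb⟩ := hasPolyDerivAt_of_differentiable (f := fun s => solB ζ α β x s) (s := t)
    (fun n => (hasDerivAt_partialT (contDiff_coeff_solB hζ hαβ n) x t).differentiableAt)
    fun s => (hd x s).natDegree_le'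
  obtain ⟨h1, h2, h3, h4, h5⟩ := leading_relations (a := fun y => solA ζ α β y t)
    (b := fun y => solB ζ α β y t) (q := q)
    (fun y => by rw [hq0]; exact hasPolyDerivAt_solA hζ hαβ y t)
    (fun y => by rw [hq0]; exact hasPolyDerivAt_solB hζ hαβ y t)
    (fun y => (hd y t).degree_lt) hq hq₁ x rfl rfl rfl rfl rfl rfl rfl rfl rfl rfl rfl
  have key := IsDressing.flow (Ω := C (2 * I) * X ^ 3) (v := fun s => kernelVectors ζ α β x s) hζ
    (fun s => kernelVectors_ne_zero hαβ x s) (fun s => hd x s) ha hb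
    (by simp [conjPoly, Complex.ext_iff])
    (fun k => by
      have := ((hasDerivAt_phase_t (ζ k) x t).cexp).const_mul (α k)
      simp only [kernelVectors, kernelVector, Matrix.cons_val_zero]
      refine HasDerivAt.congr_deriv this ?_
      simp only [eval_mul, eval_C, eval_pow, eval_X]
      ring)
    (fun k => by
      have := ((hasDerivAt_phase_t (ζ k) x t).neg.cexp).const_mul (β k)
      simp only [kernelVectors, kernelVector, Matrix.cons_val_one, Matrix.cons_val_fin_one]
      refine HasDerivAt.congr_deriv this ?_
      simp only [eval_mul, eval_C, eval_pow, eval_X, Pi.neg_apply]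
      ring)
    (by simp [timeDiag]) (by simp [coeff_zero_eq_eval_zero])
    (degree_time_left (hd x t).natDegree_le (hd x t).degree_lt h4 h5)
    (degree_time_right (hd x t).natDegree_le (hd x t).degree_lt h1 h2 h3)
  have h6 := hb 0
  have h7 := (hd x t).eval_zero
  -- At λ = 0 only the last coefficient of the off-diagonal Lax entry survives, namely -2i f₂ with
  -- f₂ equal to i/2 times the stated right-hand side.
  convert h6 using 1
  rw [key.2]
  simp only [timeDiag, timeOff, coeff_zero_eq_eval_zero, eval_add, eval_sub, eval_mul, eval_C,
    eval_pow, eval_X, eval_conjPoly, map_zero, h7, map_one]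
  linear_combination (-q₂ x / 2 - 3 * I / 2 * (q x * conj (q x)) * q₁ x +
        3 / 4 * (q x * conj (q x)) ^ 2 * q x) * I_mul_I

/-- With u = b(0) and q = u_x, the equation is the x-derivative of the evolution equation for u, by
symmetry of mixed partial derivatives. -/
theorem solvesHigherOrderKN_solitonPotential (hζ : IsSpectrum ζ)
    (hαβ : ∀ k, α k ≠ 0 ∨ β k ≠ 0) : SolvesHigherOrderKN (solitonPotential ζ α β) := by
  intro x t
  set u : ℝ × ℝ → ℂ := fun p => (solB ζ α β p.1 p.2).coeff 0 with hu
  have hsu : ContDiff ℝ ∞ u := contDiff_coeff_solB hζ hαβ 0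
  have hsq := contDiff_partialX hsu
  have hsq1 := contDiff_partialX hsq
  have hsq2 := contDiff_partialX hsq1
  have hq0 : ∀ y s, solitonPotential ζ α β y s = partialX u (y, s) :=
    solitonPotential_eq_partialX hζ hαβ
  have hq : ∀ y, HasDerivAt (fun y => solitonPotential ζ α β y t) (partialX (partialX u) (y, t)) y :=
    fun y => by simp only [hq0]; exact hasDerivAt_partialX hsq y t
  have hq1 := fun y => hasDerivAt_partialX hsq1 y t
  have hq2 := fun y => hasDerivAt_partialX hsq2 y t
  have hut : ∀ y, partialT u (y, t) = -(partialX (partialX (partialX u)) (y, t)) / 2 -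
      3 * I / 2 * (‖solitonPotential ζ α β y t‖ : ℂ) ^ 2 * deriv (fun z => solitonPotential ζ α β z t) y +
      3 / 4 * (‖solitonPotential ζ α β y t‖ : ℂ) ^ 4 * solitonPotential ζ α β y t := by
    intro y
    have h1 := hasDerivAt_coeff_solB_t hζ hαβ y t (fun _ => rfl) hq hq1
    have h2 := (hasDerivAt_partialT hsu y t).unique h1
    rw [h2, (hq y).deriv, mul_conj, normSq_eq_norm_sq]
    push_cast
    ring
  have hl : HasDerivAt (fun s => solitonPotential ζ α β x s) (partialT (partialX u) (x, t)) t := by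
    simp only [hq0]
    exact hasDerivAt_partialT hsq x t
  have hr := hasDerivAt_partialX (contDiff_partialT hsu) x t
  have hn2 : (fun y => (‖solitonPotential ζ α β y t‖ : ℂ) ^ 2) =
      fun y => solitonPotential ζ α β y t * conj (solitonPotential ζ α β y t) := funext fun y => by
    rw [mul_conj, normSq_eq_norm_sq]; push_cast; rfl
  have hdn : DifferentiableAt ℝ (fun y => (‖solitonPotential ζ α β y t‖ : ℂ) ^ 2) x := by
    rw [hn2]
    exact ((hq x).mul (hasDerivAt_conj (hq x))).differentiableAt
  have hdd : DifferentiableAt ℝ (deriv fun z => solitonPotential ζ α β z t) x := by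
    rw [show (deriv fun z => solitonPotential ζ α β z t) = fun y => partialX (partialX u) (y, t) from
      funext fun y => (hq y).deriv]
    exact (hq1 x).differentiableAt
  have hd2 : DifferentiableAt ℝ (fun y => 3 * I / 2 * (‖solitonPotential ζ α β y t‖ : ℂ) ^ 2 *
      deriv (fun z => solitonPotential ζ α β z t) y) x := (hdn.const_mul _).mul hdd
  have hd3 : DifferentiableAt ℝ (fun y => 3 / 4 * (‖solitonPotential ζ α β y t‖ : ℂ) ^ 4 *
      solitonPotential ζ α β y t) x := by
    have h4 : (fun y => 3 / 4 * (‖solitonPotential ζ α β y t‖ : ℂ) ^ 4 * solitonPotential ζ α β y t) =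
        fun y => 3 / 4 * ((‖solitonPotential ζ α β y t‖ : ℂ) ^ 2 *
          (‖solitonPotential ζ α β y t‖ : ℂ) ^ 2) * solitonPotential ζ α β y t :=
      funext fun y => by ring
    rw [h4]
    exact ((hdn.mul hdn).const_mul _).mul (hq x).differentiableAt
  have h3 : iteratedDeriv 3 (fun y => solitonPotential ζ α β y t) x =
      partialX (partialX (partialX (partialX u))) (x, t) := by
    have e1 : deriv (fun y => solitonPotential ζ α β y t) =
      fun y => partialX (partialX u) (y, t) := funext fun y => (hq y).deriv
    have e2 : deriv (fun y => partialX (partialX u) (y, t)) =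
      fun y => partialX (partialX (partialX u)) (y, t) := funext fun y => (hq1 y).deriv
    rw [iteratedDeriv_succ', iteratedDeriv_succ', iteratedDeriv_succ', iteratedDeriv_zero, e1, e2]
    exact (hq2 x).deriv
  have h5 := ((((hq2 x).neg.div_const 2).sub hd2.hasDerivAt).add hd3.hasDerivAt)
  have h6 : HasDerivAt (fun y => partialT u (y, t)) _ x := h5.congr_of_eventuallyEq
    (Eventually.of_forall fun y => by simpa using hut y)
  rw [hl.deriv, ← partialX_partialT hsu, hr.unique h6, h3]
  ring

end Soliton

/-! ### Controlling coefficients by values at interpolation nodes -/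

section Interpolation

variable {ι : Type*} [Fintype ι] [DecidableEq ι]

lemma coeff_eq_sum_eval {p : ℂ[X]} {μ : ι → ℂ} (hμ : Function.Injective μ)
    (hp : p.degree < Fintype.card ι) (n : ℕ) :
    p.coeff n = ∑ k, (Lagrange.basis Finset.univ μ k).coeff n * p.eval (μ k) := by
  have h := Lagrange.eq_interpolate (s := Finset.univ) (v := μ) (f := p) hμ.injOn
    (by rwa [Finset.card_univ])
  conv_lhs => rw [h, Lagrange.interpolate_apply]
  rw [finsetSum_coeff]
  exact Finset.sum_congr rfl fun k _ => by rw [coeff_C_mul, mul_comm]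

lemma isBigO_coeff {p : ℝ → ℂ[X]} {μ : ι → ℂ} (hμ : Function.Injective μ)
    (hp : ∀ x, (p x).degree < Fintype.card ι) {l : Filter ℝ} {g : ℝ → ℝ}
    (h : ∀ k, (fun x => (p x).eval (μ k)) =O[l] g) (n : ℕ) :
    (fun x => (p x).coeff n) =O[l] g := by
  simp only [fun x => coeff_eq_sum_eval hμ (hp x) n]
  exact Asymptotics.IsBigO.fun_sum fun k _ => (h k).const_mul_left _

lemma isBigO_eval {p : ℝ → ℂ[X]} {N : ℕ} (hp : ∀ x, (p x).natDegree ≤ N) {l : Filter ℝ}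
    {g : ℝ → ℝ} (h : ∀ n, (fun x => (p x).coeff n) =O[l] g) (z : ℂ) :
    (fun x => (p x).eval z) =O[l] g := by
  simp only [fun x => eval_eq_sum_range' (Nat.lt_succ_of_le (hp x)) z]
  refine Asymptotics.IsBigO.fun_sum fun k _ => ?_
  simp only [mul_comm _ (z ^ k)]
  exact (h k).const_mul_left _

end Interpolation

/-! ### Uniform bounds from positivity -/

section Bounds

variable {N : ℕ} {ζ : Fin N → ℂ} {v : Fin N → Fin 2 → ℂ} {a b : ℂ[X]}

lemma IsDressing.norm_sq_add (hζ : IsSpectrum ζ) (hv : ∀ k, v k ≠ 0) (h : IsDressing ζ v a b)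
    (c : ℝ) : ‖a.eval (c : ℂ)‖ ^ 2 + c * ‖b.eval (c : ℂ)‖ ^ 2 =
      ‖(polePoly ζ).eval (c : ℂ)‖ ^ 2 := by
  have h1 := eval_detPoly_ofReal a b c
  rw [h.detPoly_eq hζ hv, eval_mul, eval_conjPoly, conj_ofReal, mul_conj, normSq_eq_norm_sq] at h1
  exact_mod_cast h1.symm

lemma IsDressing.norm_eval_le (hζ : IsSpectrum ζ) (hv : ∀ k, v k ≠ 0) (h : IsDressing ζ v a b)
    {c : ℝ} (hc : 1 ≤ c) : ‖a.eval (c : ℂ)‖ ≤ ‖(polePoly ζ).eval (c : ℂ)‖ ∧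
      ‖b.eval (c : ℂ)‖ ≤ ‖(polePoly ζ).eval (c : ℂ)‖ := by
  have h1 := h.norm_sq_add hζ hv c
  have h2 : 0 ≤ ‖b.eval (c : ℂ)‖ ^ 2 := by positivity
  have h3 : 0 ≤ ‖a.eval (c : ℂ)‖ ^ 2 := by positivity
  constructor <;> refine le_of_sq_le_sq ?_ (norm_nonneg _) <;> nlinarith

/-- On λ ≥ 1 the identity |a|² + λ|b|² = |d|² bounds both polynomials independently of the vectors.
Interpolation at 1, ..., N + 1 passes this to the coefficients. -/
lemma isBigO_coeff_one (hζ : IsSpectrum ζ) {v : ℝ → Fin N → Fin 2 → ℂ} {a b : ℝ → ℂ[X]}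
    (hv : ∀ x k, v x k ≠ 0) (h : ∀ x, IsDressing ζ (v x) (a x) (b x)) (n : ℕ) :
    (fun x => (a x).coeff n) =O[⊤] (fun _ => (1 : ℝ)) ∧
      (fun x => (b x).coeff n) =O[⊤] (fun _ => (1 : ℝ)) := by
  have hμ : Function.Injective fun i : Fin (N + 1) => (((i : ℕ) + 1 : ℝ) : ℂ) := by
    intro i j hij
    have := add_right_cancel (ofReal_injective hij)
    exact Fin.ext (by exact_mod_cast this)
  have hlt : ((N : ℕ) : WithBot ℕ) < (Fintype.card (Fin (N + 1)) : WithBot ℕ) := by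
    rw [Fintype.card_fin]
    exact_mod_cast Nat.lt_succ_self N
  constructor
  · refine isBigO_coeff hμ (fun x => (natDegree_le_iff_degree_le.1 (h x).natDegree_le).trans_lt hlt)
      (fun k => ?_) n
    exact Asymptotics.IsBigO.of_bound ‖(polePoly ζ).eval (((k : ℕ) + 1 : ℝ) : ℂ)‖
      (Eventually.of_forall fun x => by
        simpa using ((h x).norm_eval_le hζ (hv x) (c := (k : ℕ) + 1) (by simp)).1)
  · refine isBigO_coeff hμ (fun x => (h x).degree_lt.trans hlt) (fun k => ?_) n
    exact Asymptotics.IsBigO.of_bound ‖(polePoly ζ).eval (((k : ℕ) + 1 : ℝ) : ℂ)‖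
      (Eventually.of_forall fun x => by
        simpa using ((h x).norm_eval_le hζ (hv x) (c := (k : ℕ) + 1) (by simp)).2)

end Bounds

/-! ### Exponential decay and limits of the dressing matrix -/

section Decay

variable {N : ℕ} {ζ α β : Fin N → ℂ}

/-- A common exponential rate. -/
lemma IsSpectrum.exists_rate (hζ : IsSpectrum ζ) : ∃ ε : ℝ, 0 < ε ∧ ∀ k, ε ≤ 2 * (ζ k ^ 2).im := by
  rcases isEmpty_or_nonempty (Fin N) with hN | hN
  · exact ⟨1, one_pos, fun k => (IsEmpty.false k).elim⟩
  · obtain ⟨k, hk⟩ := Finite.exists_min fun k => 2 * (ζ k ^ 2).im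
    exact ⟨_, by linarith [hζ.im_pos k], hk⟩

lemma re_phase (z : ℂ) (x t : ℝ) : (phase z x t).re = (z ^ 2).im * x + 2 * (z ^ 6).im * t := by
  simp [phase, mul_assoc]

lemma isBigO_exp_phase_right {ε : ℝ} {z : ℂ} (hz : ε ≤ 2 * (z ^ 2).im) (t : ℝ) :
    (fun x => exp (-phase z x t - phase z x t)) =O[𝓟 (Set.Ici 0)]
      fun x => Real.exp (-ε * |x|) := by
  refine Asymptotics.IsBigO.of_bound (Real.exp (-4 * (z ^ 6).im * t)) ?_
  refine eventually_principal.2 fun x hx => ?_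
  rw [norm_exp, Real.norm_eq_abs, Real.abs_exp, ← Real.exp_add, Real.exp_le_exp, sub_re, neg_re,
    re_phase, abs_of_nonneg hx]
  nlinarith [Set.mem_Ici.1 hx]

lemma isBigO_exp_phase_left {ε : ℝ} {z : ℂ} (hz : ε ≤ 2 * (z ^ 2).im) (t : ℝ) :
    (fun x => exp (phase z x t + phase z x t)) =O[𝓟 (Set.Iic 0)]
      fun x => Real.exp (-ε * |x|) := by
  refine Asymptotics.IsBigO.of_bound (Real.exp (4 * (z ^ 6).im * t)) ?_
  refine eventually_principal.2 fun x hx => ?_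
  rw [norm_exp, Real.norm_eq_abs, Real.abs_exp, ← Real.exp_add, Real.exp_le_exp, add_re,
    re_phase, abs_of_nonpos hx]
  nlinarith [Set.mem_Iic.1 hx]

lemma isBigO_conj {f : ℝ → ℂ} {g : ℝ → ℝ} {l : Filter ℝ} (h : f =O[l] g) :
    (fun x => conj (f x)) =O[l] g :=
  (Asymptotics.IsBigO.of_bound 1 (Eventually.of_forall fun x => by simp)).trans h

lemma isBigO_mul_one {f h : ℝ → ℂ} {g : ℝ → ℝ} {l : Filter ℝ} (hf : f =O[l] fun _ => (1 : ℝ))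
    (hh : h =O[l] g) : (fun x => f x * h x) =O[l] g := by
  simpa using hf.mul hh

variable {ε : ℝ}

lemma kernelVectors_zero (x t : ℝ) (k : Fin N) :
    kernelVectors ζ α β x t k 0 = α k * exp (phase (ζ k) x t) := rfl

lemma kernelVectors_one (x t : ℝ) (k : Fin N) :
    kernelVectors ζ α β x t k 1 = β k * exp (-phase (ζ k) x t) := rfl

lemma isBigO_eval_solA_solB (hζ : IsSpectrum ζ) (hαβ : ∀ k, α k ≠ 0 ∨ β k ≠ 0) (t : ℝ) (z : ℂ) :
    (fun x => (solA ζ α β x t).eval z) =O[⊤] (fun _ => (1 : ℝ)) ∧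
      (fun x => (solB ζ α β x t).eval z) =O[⊤] (fun _ => (1 : ℝ)) := by
  have hd := isDressing_sol hζ hαβ
  have h := isBigO_coeff_one (v := fun x => kernelVectors ζ α β x t) hζ
    (fun x => kernelVectors_ne_zero hαβ x t) (fun x => hd x t)
  exact ⟨isBigO_eval (fun x => (hd x t).natDegree_le) (fun n => (h n).1) z,
    isBigO_eval (fun x => (hd x t).natDegree_le') (fun n => (h n).2) z⟩

/-- For x ≥ 0 the first component of v_k dominates. Solving the range and kernel conditions for the
entry that multiplies it produces the factor exp(-2θ_k) or its conjugate, times a bounded quantity.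
-/
lemma isBigO_solB_right (hζ : IsSpectrum ζ) (hαβ : ∀ k, α k ≠ 0 ∨ β k ≠ 0)
    (hε : ∀ k, ε ≤ 2 * (ζ k ^ 2).im) (t : ℝ) {k : Fin N} (hα : α k ≠ 0) :
    (fun x => (solB ζ α β x t).eval (conj (ζ k) ^ 2)) =O[𝓟 (Set.Ici 0)]
        (fun x => Real.exp (-ε * |x|)) ∧
      (fun x => (solA ζ α β x t).eval (ζ k ^ 2)) =O[𝓟 (Set.Ici 0)]
        (fun x => Real.exp (-ε * |x|)) := by
  have hz := hζ.ne_zero k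
  have hz' := hζ.conj_ne_zero k
  have hα' : conj (α k) ≠ 0 := by simpa using hα
  have he := isBigO_exp_phase_right (hε k) t
  constructor
  · have h1 : ∀ x, (solB ζ α β x t).eval (conj (ζ k) ^ 2) =
        (conj (β k) / conj (α k) / conj (ζ k)) * ((solA ζ α β x t).eval (conj (ζ k) ^ 2) *
          conj (exp (-phase (ζ k) x t - phase (ζ k) x t))) := by
      intro x
      have h2 := (isDressing_sol hζ hαβ x t).range k
      have h3 : conj (exp (phase (ζ k) x t)) ≠ 0 := by simp
      rw [kernelVectors_zero, kernelVectors_one, map_mul, map_mul] at h2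
      rw [sub_eq_add_neg, Complex.exp_add, map_mul]
      nth_rewrite 2 [Complex.exp_neg]
      rw [map_inv₀]
      field_simp
      linear_combination -h2
    simp only [h1]
    exact (isBigO_mul_one ((isBigO_eval_solA_solB hζ hαβ t _).1.mono le_top)
      (isBigO_conj he)).const_mul_left _
  · have h1 : ∀ x, (solA ζ α β x t).eval (ζ k ^ 2) =
        (-ζ k * β k / α k) * ((solB ζ α β x t).eval (ζ k ^ 2) *
          exp (-phase (ζ k) x t - phase (ζ k) x t)) := by
      intro x
      have h2 := (isDressing_sol hζ hαβ x t).kernel k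
      have h3 : exp (phase (ζ k) x t) ≠ 0 := exp_ne_zero _
      rw [kernelVectors_zero, kernelVectors_one] at h2
      rw [sub_eq_add_neg, Complex.exp_add]
      nth_rewrite 2 [Complex.exp_neg]
      field_simp
      linear_combination h2
    simp only [h1]
    exact (isBigO_mul_one ((isBigO_eval_solA_solB hζ hαβ t _).2.mono le_top)
      he).const_mul_left _

/-- Mirror image: for x ≤ 0 the second component dominates and the roles of the two kinds of nodes
are exchanged. -/
lemma isBigO_solB_left (hζ : IsSpectrum ζ) (hαβ : ∀ k, α k ≠ 0 ∨ β k ≠ 0)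
    (hε : ∀ k, ε ≤ 2 * (ζ k ^ 2).im) (t : ℝ) {k : Fin N} (hβ : β k ≠ 0) :
    (fun x => (solB ζ α β x t).eval (ζ k ^ 2)) =O[𝓟 (Set.Iic 0)]
        (fun x => Real.exp (-ε * |x|)) ∧
      (fun x => (solA ζ α β x t).eval (conj (ζ k) ^ 2)) =O[𝓟 (Set.Iic 0)]
        (fun x => Real.exp (-ε * |x|)) := by
  have hz := hζ.ne_zero k
  have hz' := hζ.conj_ne_zero k
  have hβ' : conj (β k) ≠ 0 := by simpa using hβ
  have he := isBigO_exp_phase_left (hε k) t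
  constructor
  · have h1 : ∀ x, (solB ζ α β x t).eval (ζ k ^ 2) =
        (-α k / β k / ζ k) * ((solA ζ α β x t).eval (ζ k ^ 2) *
          exp (phase (ζ k) x t + phase (ζ k) x t)) := by
      intro x
      have h2 := (isDressing_sol hζ hαβ x t).kernel k
      have h3 : exp (phase (ζ k) x t) ≠ 0 := exp_ne_zero _
      rw [kernelVectors_zero, kernelVectors_one, Complex.exp_neg] at h2
      rw [Complex.exp_add]
      field_simp at h2 ⊢
      linear_combination h2
    simp only [h1]
    exact (isBigO_mul_one ((isBigO_eval_solA_solB hζ hαβ t _).1.mono le_top)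
      he).const_mul_left _
  · have h1 : ∀ x, (solA ζ α β x t).eval (conj (ζ k) ^ 2) =
        (conj (ζ k) * conj (α k) / conj (β k)) * ((solB ζ α β x t).eval (conj (ζ k) ^ 2) *
          conj (exp (phase (ζ k) x t + phase (ζ k) x t))) := by
      intro x
      have h2 := (isDressing_sol hζ hαβ x t).range k
      have h3 : conj (exp (phase (ζ k) x t)) ≠ 0 := by simp
      rw [kernelVectors_zero, kernelVectors_one, map_mul, map_mul, Complex.exp_neg, map_inv₀] at h2
      rw [Complex.exp_add, map_mul]
      field_simp at h2 ⊢
      linear_combination h2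
    simp only [h1]
    exact (isBigO_mul_one ((isBigO_eval_solA_solB hζ hαβ t _).2.mono le_top)
      (isBigO_conj he)).const_mul_left _

open Classical in
/-- The coefficients of the off-diagonal entry decay exponentially. -/
lemma isBigO_coeff_solB (hζ : IsSpectrum ζ) (hαβ : ∀ k, α k ≠ 0 ∨ β k ≠ 0)
    (hε : ∀ k, ε ≤ 2 * (ζ k ^ 2).im) (t : ℝ) (n : ℕ) :
    (fun x => (solB ζ α β x t).coeff n) =O[⊤] (fun x => Real.exp (-ε * |x|)) := by
  have hd := isDressing_sol hζ hαβ
  -- Since deg b < N, one node per k suffices, and it may be chosen from the pair ζ_k² and its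
  -- conjugate separately for each k.
  have hinj : ∀ s : Fin N → Prop, Function.Injective fun k =>
      if s k then conj (ζ k) ^ 2 else ζ k ^ 2 := by
    intro s j k hjk
    simp only at hjk
    split_ifs at hjk
    · exact hζ.conj_injective hjk
    · exact absurd hjk.symm (hζ.ne_conj k j)
    · exact absurd hjk (hζ.ne_conj j k)
    · exact hζ.injective hjk
  have htop : (⊤ : Filter ℝ) = 𝓟 (Set.Ici 0) ⊔ 𝓟 (Set.Iic 0) := by
    rw [sup_principal, Set.union_comm, Set.Iic_union_Ici, principal_univ]
  rw [htop]
  refine Asymptotics.IsBigO.sup ?_ ?_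
  · refine isBigO_coeff (hinj fun k => α k ≠ 0) (fun x => by simpa using (hd x t).degree_lt)
      (fun k => ?_) n
    by_cases hα : α k ≠ 0
    · simp only [if_pos hα]
      exact (isBigO_solB_right hζ hαβ hε t hα).1
    · simp only [if_neg hα]
      -- When α_k = 0, v_k has only a second component, and the kernel condition makes b vanish
      -- exactly at ζ_k².
      have h0 : (fun x => (solB ζ α β x t).eval (ζ k ^ 2)) = fun _ => 0 := funext fun x => by
        have h1 := (hd x t).kernel k
        rw [kernelVectors_zero, kernelVectors_one, not_not.1 hα] at h1
        simpa [hζ.ne_zero k, (hαβ k).resolve_left hα] using h1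
      rw [h0]
      exact Asymptotics.isBigO_zero _ _
  · refine isBigO_coeff (hinj fun k => ¬ β k ≠ 0) (fun x => by simpa using (hd x t).degree_lt)
      (fun k => ?_) n
    by_cases hβ : β k ≠ 0
    · simp only [if_neg (not_not.2 hβ)]
      exact (isBigO_solB_left hζ hαβ hε t hβ).1
    · simp only [if_pos hβ]
      have h0 : (fun x => (solB ζ α β x t).eval (conj (ζ k) ^ 2)) = fun _ => 0 :=
        funext fun x => by
          have h1 := (hd x t).range k
          rw [kernelVectors_zero, kernelVectors_one, not_not.1 hβ, eq_comm] at h1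
          simpa [hζ.ne_zero k, (hαβ k).resolve_right hβ] using h1
      rw [h0]
      exact Asymptotics.isBigO_zero _ _

lemma tendsto_exp_neg_abs (hε : 0 < ε) (l : Filter ℝ) (hl : Tendsto (fun x : ℝ => |x|) l atTop) :
    Tendsto (fun x : ℝ => Real.exp (-ε * |x|)) l (𝓝 0) := by
  refine Real.tendsto_exp_atBot.comp ?_
  simp only [neg_mul]
  exact tendsto_neg_atTop_atBot.comp (hl.const_mul_atTop hε)

lemma tendsto_eval_solB (hζ : IsSpectrum ζ) (hαβ : ∀ k, α k ≠ 0 ∨ β k ≠ 0) (t : ℝ) (z : ℂ)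
    {l : Filter ℝ} (hl : Tendsto (fun x : ℝ => |x|) l atTop) :
    Tendsto (fun x => (solB ζ α β x t).eval z) l (𝓝 0) := by
  obtain ⟨ε, hε0, hε⟩ := hζ.exists_rate
  have h := isBigO_eval (fun x => (isDressing_sol hζ hαβ x t).natDegree_le')
    (isBigO_coeff_solB hζ hαβ hε t) z
  exact (h.mono le_top).trans_tendsto (tendsto_exp_neg_abs hε0 l hl)

lemma IsSpectrum.option_injective (hζ : IsSpectrum ζ) :
    Function.Injective fun s : Option (Fin N) => s.elim 0 fun k => conj (ζ k) ^ 2 := by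
  rintro (_ | j) (_ | k) h
  · rfl
  · exact absurd h.symm (pow_ne_zero 2 (hζ.conj_ne_zero k))
  · exact absurd h (pow_ne_zero 2 (hζ.conj_ne_zero j))
  · exact congrArg _ (hζ.conj_injective h)

/-- Degree at most N is determined by N + 1 values; those at the origin and at the conjugate nodes
converge to the values of `polePoly`. -/
lemma tendsto_eval_of_nodes (hζ : IsSpectrum ζ) {p : ℝ → ℂ[X]} (hp : ∀ x, (p x).natDegree ≤ N)
    (hp0 : ∀ x, (p x).eval 0 = 1) {l : Filter ℝ}
    (hp1 : ∀ k, Tendsto (fun x => (p x).eval (conj (ζ k) ^ 2)) l (𝓝 0)) (z : ℂ) :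
    Tendsto (fun x => (p x).eval z) l (𝓝 ((polePoly ζ).eval z)) := by
  have hcard : Fintype.card (Option (Fin N)) = N + 1 := by simp
  have hlt : ∀ p : ℂ[X], p.natDegree ≤ N → p.degree < (Fintype.card (Option (Fin N)) : WithBot ℕ) :=
    fun p hp => (natDegree_le_iff_degree_le.1 hp).trans_lt (by
      rw [hcard]; exact_mod_cast Nat.lt_succ_self N)
  have hc : ∀ n, Tendsto (fun x => (p x).coeff n) l (𝓝 ((polePoly ζ).coeff n)) := by
    intro n
    simp only [fun x => coeff_eq_sum_eval hζ.option_injective (hlt _ (hp x)) n,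
      coeff_eq_sum_eval hζ.option_injective (hlt _ hζ.natDegree_polePoly.le) n]
    refine tendsto_finsetSum _ fun s _ => Tendsto.const_mul _ ?_
    rcases s with _ | k
    · simp only [Option.elim, hp0, hζ.polePoly_zero]
      exact tendsto_const_nhds
    · simp only [Option.elim, hζ.eval_polePoly_eq_zero_iff.2 ⟨k, rfl⟩]
      exact hp1 k
  simp only [fun x => eval_eq_sum_range' (Nat.lt_succ_of_le (hp x)) z,
    eval_eq_sum_range' (Nat.lt_succ_of_le hζ.natDegree_polePoly.le) z]
  exact tendsto_finsetSum _ fun n _ => (hc n).mul_const _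

/-- The diagonal entries of the dressing matrix have the limits of Jost functions. -/
lemma tendsto_eval_solA_atBot (hζ : IsSpectrum ζ) (hαβ : ∀ k, α k ≠ 0 ∧ β k ≠ 0) (t : ℝ) (z : ℂ) :
    Tendsto (fun x => (solA ζ α β x t).eval z) atBot (𝓝 ((polePoly ζ).eval z)) := by
  have hαβ' : ∀ k, α k ≠ 0 ∨ β k ≠ 0 := fun k => Or.inl (hαβ k).1
  obtain ⟨ε, hε0, hε⟩ := hζ.exists_rate
  have hd := isDressing_sol hζ hαβ'
  refine tendsto_eval_of_nodes hζ (fun x => (hd x t).natDegree_le) (fun x => (hd x t).eval_zero)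
    (fun k => ?_) z
  exact ((isBigO_solB_left hζ hαβ' hε t (hαβ k).2).2.mono
    (le_principal_iff.2 (Iic_mem_atBot 0))).trans_tendsto
      (tendsto_exp_neg_abs hε0 _ tendsto_abs_atBot_atTop)

lemma tendsto_eval_conjPoly_solA_atTop (hζ : IsSpectrum ζ) (hαβ : ∀ k, α k ≠ 0 ∧ β k ≠ 0)
    (t : ℝ) (z : ℂ) :
    Tendsto (fun x => (conjPoly (solA ζ α β x t)).eval z) atTop (𝓝 ((polePoly ζ).eval z)) := by
  have hαβ' : ∀ k, α k ≠ 0 ∨ β k ≠ 0 := fun k => Or.inl (hαβ k).1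
  obtain ⟨ε, hε0, hε⟩ := hζ.exists_rate
  have hd := isDressing_sol hζ hαβ'
  refine tendsto_eval_of_nodes hζ (fun x => (natDegree_conjPoly _).trans_le (hd x t).natDegree_le)
    (fun x => by rw [eval_conjPoly, map_zero, (hd x t).eval_zero, map_one]) (fun k => ?_) z
  have h := (isBigO_conj (isBigO_solB_right hζ hαβ' hε t (hαβ k).1).2).mono
    (le_principal_iff.2 (Ici_mem_atTop 0))
  simpa [eval_conjPoly] using h.trans_tendsto (tendsto_exp_neg_abs hε0 _ tendsto_abs_atTop_atTop)

end Decay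

/-! ### The differential ring of coefficients and its small ideal -/

section Differential

/-- The ring generated by the coefficients of `a`, `b` and their conjugates. -/
inductive IsCoeffPolynomial (a b : ℝ → ℂ[X]) : (ℝ → ℂ) → Prop
  | const (c : ℂ) : IsCoeffPolynomial a b fun _ => c
  | left (n : ℕ) : IsCoeffPolynomial a b fun x => (a x).coeff n
  | right (n : ℕ) : IsCoeffPolynomial a b fun x => (b x).coeff n
  | conjugate {f : ℝ → ℂ} : IsCoeffPolynomial a b f → IsCoeffPolynomial a b fun x => conj (f x)
  | add {f g : ℝ → ℂ} : IsCoeffPolynomial a b f → IsCoeffPolynomial a b g →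
      IsCoeffPolynomial a b fun x => f x + g x
  | mul {f g : ℝ → ℂ} : IsCoeffPolynomial a b f → IsCoeffPolynomial a b g →
      IsCoeffPolynomial a b fun x => f x * g x

/-- The ideal generated by the coefficients of `b` and their conjugates. -/
inductive IsSmallPolynomial (a b : ℝ → ℂ[X]) : (ℝ → ℂ) → Prop
  | gen (n : ℕ) : IsSmallPolynomial a b fun x => (b x).coeff n
  | conjugate {f : ℝ → ℂ} : IsSmallPolynomial a b f → IsSmallPolynomial a b fun x => conj (f x)
  | add {f g : ℝ → ℂ} : IsSmallPolynomial a b f → IsSmallPolynomial a b g →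
      IsSmallPolynomial a b fun x => f x + g x
  | mul {f g : ℝ → ℂ} : IsCoeffPolynomial a b f → IsSmallPolynomial a b g →
      IsSmallPolynomial a b fun x => f x * g x

variable {a b : ℝ → ℂ[X]} {f q : ℝ → ℂ}

lemma IsSmallPolynomial.const_mul (h : IsSmallPolynomial a b f) (c : ℂ) :
    IsSmallPolynomial a b fun x => c * f x :=
  .mul (.const c) h

lemma IsSmallPolynomial.coeff_X_mul : ∀ n, IsSmallPolynomial a b fun x => (X * b x).coeff n
  | 0 => by simpa using (IsSmallPolynomial.gen (a := a) (b := b) 0).const_mul 0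
  | n + 1 => by
    simp only [Polynomial.coeff_X_mul]
    exact .gen n

lemma IsSmallPolynomial.isCoeffPolynomial (h : IsSmallPolynomial a b f) :
    IsCoeffPolynomial a b f := by
  induction h with
  | gen n => exact .right n
  | conjugate _ ih => exact .conjugate ih
  | add _ _ ih1 ih2 => exact .add ih1 ih2
  | mul hf _ ih => exact .mul hf ih

/-- Every term in the x-equations for a and b contains q or a coefficient of b, so differentiation
maps the whole ring into the ideal of decaying functions. Hence no x-derivative loses decay. -/
lemma IsCoeffPolynomial.exists_deriv (hq : IsSmallPolynomial a b q)
    (ha : ∀ x, HasPolyDerivAt a (-(C (q x) * (X * conjPoly (b x)))) x)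
    (hb : ∀ x, HasPolyDerivAt b (C (q x) * conjPoly (a x) - C (2 * I) * (X * b x)) x)
    (h : IsCoeffPolynomial a b f) :
    ∃ f', IsSmallPolynomial a b f' ∧ ∀ x, HasDerivAt f (f' x) x := by
  induction h with
  | const c =>
    exact ⟨fun x => 0 * (b x).coeff 0, (IsSmallPolynomial.gen 0).const_mul 0, fun x => by
      simpa using hasDerivAt_const x c⟩
  | left n =>
    refine ⟨fun x => (-1 : ℂ) * (conj ((X * b x).coeff n) * q x), (IsSmallPolynomial.mul
      (.conjugate (IsSmallPolynomial.coeff_X_mul n).isCoeffPolynomial) hq).const_mul (-1),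
      fun x => (ha x n).congr_deriv ?_⟩
    rw [coeff_neg, coeff_C_mul]
    cases n with
    | zero => simp
    | succ n => simp only [Polynomial.coeff_X_mul, coeff_conjPoly]; ring
  | right n =>
    refine ⟨fun x => conj ((a x).coeff n) * q x + (-2 * I) * (X * b x).coeff n,
      .add (.mul (.conjugate (.left n)) hq) ((IsSmallPolynomial.coeff_X_mul n).const_mul _),
      fun x => (hb x n).congr_deriv ?_⟩
    rw [coeff_sub, coeff_C_mul, coeff_C_mul, coeff_conjPoly]
    ring
  | conjugate _ ih =>
    obtain ⟨f', h1, h2⟩ := ih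
    exact ⟨_, .conjugate h1, fun x => hasDerivAt_conj (h2 x)⟩
  | add _ _ ih1 ih2 =>
    obtain ⟨f', h1, h2⟩ := ih1
    obtain ⟨g', h3, h4⟩ := ih2
    exact ⟨_, .add h1 h3, fun x => (h2 x).add (h4 x)⟩
  | mul hf hg ih1 ih2 =>
    obtain ⟨f', h1, h2⟩ := ih1
    obtain ⟨g', h3, h4⟩ := ih2
    exact ⟨_, .add (.mul hg h1) (.mul hf h3), fun x =>
      ((h2 x).mul (h4 x)).congr_deriv (by ring)⟩

lemma IsSmallPolynomial.iteratedDeriv (hq : IsSmallPolynomial a b q)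
    (ha : ∀ x, HasPolyDerivAt a (-(C (q x) * (X * conjPoly (b x)))) x)
    (hb : ∀ x, HasPolyDerivAt b (C (q x) * conjPoly (a x) - C (2 * I) * (X * b x)) x)
    (h : IsSmallPolynomial a b f) (n : ℕ) : IsSmallPolynomial a b (iteratedDeriv n f) := by
  induction n with
  | zero => simpa using h
  | succ n ih =>
    obtain ⟨f', h1, h2⟩ := ih.isCoeffPolynomial.exists_deriv hq ha hb
    rw [iteratedDeriv_succ, show deriv (_root_.iteratedDeriv n f) = f' from
      funext fun x => (h2 x).deriv]
    exact h1

lemma IsCoeffPolynomial.isBigO (ha : ∀ n, (fun x => (a x).coeff n) =O[⊤] fun _ => (1 : ℝ))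
    (hb : ∀ n, (fun x => (b x).coeff n) =O[⊤] fun _ => (1 : ℝ)) (h : IsCoeffPolynomial a b f) :
    f =O[⊤] fun _ => (1 : ℝ) := by
  induction h with
  | const c => exact Asymptotics.isBigO_const_const c one_ne_zero _
  | left n => exact ha n
  | right n => exact hb n
  | conjugate _ ih => exact isBigO_conj ih
  | add _ _ ih1 ih2 => exact ih1.add ih2
  | mul _ _ ih1 ih2 => exact isBigO_mul_one ih1 ih2

lemma IsSmallPolynomial.isBigO {g : ℝ → ℝ}
    (ha : ∀ n, (fun x => (a x).coeff n) =O[⊤] fun _ => (1 : ℝ))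
    (hb : ∀ n, (fun x => (b x).coeff n) =O[⊤] fun _ => (1 : ℝ))
    (hg : ∀ n, (fun x => (b x).coeff n) =O[⊤] g) (h : IsSmallPolynomial a b f) : f =O[⊤] g := by
  induction h with
  | gen n => exact hg n
  | conjugate _ ih => exact isBigO_conj ih
  | add _ _ ih1 ih2 => exact ih1.add ih2
  | mul hf _ ih => exact isBigO_mul_one (hf.isBigO ha hb) ih

lemma pow_mul_exp_le {ε : ℝ} (hε : 0 < ε) (m : ℕ) (y : ℝ) (hy : 0 ≤ y) :
    y ^ m * Real.exp (-ε * y) ≤ m.factorial / ε ^ m := by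
  have h := Real.pow_div_factorial_le_exp (ε * y) (by positivity) m
  rw [div_le_iff₀ (by positivity)] at h
  rw [neg_mul, Real.exp_neg, ← div_eq_mul_inv, div_le_div_iff₀ (Real.exp_pos _) (by positivity),
    ← mul_pow, mul_comm y ε]
  linarith

end Differential

variable {N : ℕ} {ζ α β : Fin N → ℂ}

theorem rapidlyDecreasing_solitonPotential (hζ : IsSpectrum ζ) (hαβ : ∀ k, α k ≠ 0 ∨ β k ≠ 0)
    (t : ℝ) : RapidlyDecreasing fun x => solitonPotential ζ α β x t := by
  intro m n
  obtain ⟨ε, hε0, hε⟩ := hζ.exists_rate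
  have hd := isDressing_sol hζ hαβ
  have hO := isBigO_coeff_one (v := fun x => kernelVectors ζ α β x t) hζ
    (fun x => kernelVectors_ne_zero hαβ x t) (fun x => hd x t)
  have hq : IsSmallPolynomial (fun x => solA ζ α β x t) (fun x => solB ζ α β x t)
      (fun x => solitonPotential ζ α β x t) := by
    -- The denominator of the leading potential is removed by multiplying with a_N: |a_N|² is a
    -- constant, so q is polynomial in the coefficients and lies in the ideal.
    have h1 : (fun x => solitonPotential ζ α β x t) = fun x =>
        (2 * I / ((polePoly ζ).coeff N * conj ((polePoly ζ).coeff N))) *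
          ((solA ζ α β x t).coeff N * (X * solB ζ α β x t).coeff N) := funext fun x => by
      have h2 := (hd x t).coeff_ne_zero hζ (kernelVectors_ne_zero hαβ x t)
      have h3 : conj ((solA ζ α β x t).coeff N) ≠ 0 := by simpa using h2
      rw [← leadingPotential_eq hζ hαβ, leadingPotential,
        ← (hd x t).coeff_mul_conj hζ (kernelVectors_ne_zero hαβ x t)]
      field_simp
    rw [h1]
    exact (IsSmallPolynomial.mul (.left N) (.coeff_X_mul N)).const_mul _
  have hqn := (hq.iteratedDeriv (fun x => hasPolyDerivAt_solA hζ hαβ x t)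
    (fun x => hasPolyDerivAt_solB hζ hαβ x t) hq n).isBigO (fun n => (hO n).1) (fun n => (hO n).2)
    (isBigO_coeff_solB hζ hαβ hε t)
  obtain ⟨C, hC⟩ := Asymptotics.isBigO_top.1 hqn
  refine ⟨|C| * (m.factorial / ε ^ m), fun x => ?_⟩
  have h1 := hC x
  rw [Real.norm_eq_abs, Real.abs_exp] at h1
  calc |x| ^ m * ‖iteratedDeriv n (fun x => solitonPotential ζ α β x t) x‖
      ≤ |x| ^ m * (|C| * Real.exp (-ε * |x|)) := by
        refine mul_le_mul_of_nonneg_left (h1.trans ?_) (by positivity)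
        exact mul_le_mul_of_nonneg_right (le_abs_self C) (Real.exp_pos _).le
    _ = |C| * (|x| ^ m * Real.exp (-ε * |x|)) := by ring
    _ ≤ _ := mul_le_mul_of_nonneg_left (pow_mul_exp_le hε0 m _ (abs_nonneg x)) (abs_nonneg C)

/-! ### Jost matrices and vanishing reflection coefficients -/

section Jost

/-- The dressing matrix normalized at the origin. -/
def dressPlus (ζ : Fin N → ℂ) (a b : ℂ[X]) (z : ℂ) : Matrix (Fin 2) (Fin 2) ℂ :=
  !![a.eval (z ^ 2) / (polePoly ζ).eval (z ^ 2), z * b.eval (z ^ 2) / (polePoly ζ).eval (z ^ 2);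
    -z * (conjPoly b).eval (z ^ 2) / (polePoly ζ).eval (z ^ 2),
    (conjPoly a).eval (z ^ 2) / (polePoly ζ).eval (z ^ 2)]

/-- The inverse of the dressing matrix normalized at the origin. -/
def dressMinus (ζ : Fin N → ℂ) (a b : ℂ[X]) (z : ℂ) : Matrix (Fin 2) (Fin 2) ℂ :=
  !![(conjPoly a).eval (z ^ 2) / (conjPoly (polePoly ζ)).eval (z ^ 2),
    -z * b.eval (z ^ 2) / (conjPoly (polePoly ζ)).eval (z ^ 2);
    z * (conjPoly b).eval (z ^ 2) / (conjPoly (polePoly ζ)).eval (z ^ 2),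
    a.eval (z ^ 2) / (conjPoly (polePoly ζ)).eval (z ^ 2)]

lemma HasPolyDerivAt.conjPoly {f : ℝ → ℂ[X]} {f' : ℂ[X]} {s : ℝ} (h : HasPolyDerivAt f f' s) :
    HasPolyDerivAt (fun y => HigherKN.conjPoly (f y)) (HigherKN.conjPoly f') s := by
  intro n
  simp only [coeff_conjPoly]
  exact hasDerivAt_conj (h n)

lemma isSpectralSolution_dressPlus (hζ : IsSpectrum ζ) (hαβ : ∀ k, α k ≠ 0 ∨ β k ≠ 0) (t : ℝ)
    (z : ℂ) : IsSpectralSolution (fun x => solitonPotential ζ α β x t) z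
      fun x => dressPlus ζ (solA ζ α β x t) (solB ζ α β x t) z := by
  intro x i j
  have hd := isDressing_sol hζ hαβ
  have ha := hasPolyDerivAt_solA hζ hαβ x t
  have hb := hasPolyDerivAt_solB hζ hαβ x t
  have h1 := ha.eval (fun y => (hd y t).natDegree_le) (z ^ 2)
  have h2 := hb.eval (fun y => (hd y t).natDegree_le') (z ^ 2)
  have h3 := ha.conjPoly.eval
    (fun y => (natDegree_conjPoly _).trans_le (hd y t).natDegree_le) (z ^ 2)
  have h4 := hb.conjPoly.eval
    (fun y => (natDegree_conjPoly _).trans_le (hd y t).natDegree_le') (z ^ 2)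
  simp only [conjPoly, Polynomial.map_neg, Polynomial.map_mul, map_C, map_X,
    Polynomial.map_sub] at h3 h4
  change HasDerivAt (fun y => (conjPoly (solA ζ α β y t)).eval (z ^ 2))
    ((-(C (conj (solitonPotential ζ α β x t)) *
      (X * conjPoly (conjPoly (solB ζ α β x t))))).eval (z ^ 2)) x at h3
  change HasDerivAt (fun y => (conjPoly (solB ζ α β y t)).eval (z ^ 2))
    ((C (conj (solitonPotential ζ α β x t)) * conjPoly (conjPoly (solA ζ α β x t)) -
      C (conj (2 * I)) * (X * conjPoly (solB ζ α β x t))).eval (z ^ 2)) x at h4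
  simp only [eval_neg, eval_sub, eval_mul, eval_C, eval_X, conjPoly_conjPoly, map_mul, conj_I,
    map_ofNat] at h1 h2 h3 h4
  fin_cases i <;> fin_cases j
  · refine (h1.div_const ((polePoly ζ).eval (z ^ 2))).congr_deriv ?_
    simp [dressPlus, potentialMatrix, σ₃]
    ring
  · refine ((h2.const_mul z).div_const ((polePoly ζ).eval (z ^ 2))).congr_deriv ?_
    simp [dressPlus, potentialMatrix, σ₃]
    ring
  · refine ((h4.const_mul (-z)).div_const ((polePoly ζ).eval (z ^ 2))).congr_deriv ?_
    simp [dressPlus, potentialMatrix, σ₃]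
    ring
  · refine (h3.div_const ((polePoly ζ).eval (z ^ 2))).congr_deriv ?_
    simp [dressPlus, potentialMatrix, σ₃]
    ring

lemma IsSpectrum.polePoly_ne_zero (hζ : IsSpectrum ζ) {z : ℂ} (hz : z ∈ C13 ∪ contour) :
    (polePoly ζ).eval (z ^ 2) ≠ 0 := by
  intro h
  obtain ⟨k, hk⟩ := hζ.eval_polePoly_eq_zero_iff.1 h
  have h1 := hζ.conj_im_neg k
  rw [← hk, im_sq] at h1
  rcases hz with hz | hz
  · have : 0 < z.re * z.im := hz
    linarith
  · have : z.re * z.im = 0 := hz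
    linarith

lemma IsSpectrum.conjPoly_polePoly_ne_zero (hζ : IsSpectrum ζ) {z : ℂ} (hz : z ∈ C24 ∪ contour) :
    (conjPoly (polePoly ζ)).eval (z ^ 2) ≠ 0 := by
  intro h
  obtain ⟨k, hk⟩ := hζ.eval_conjPoly_polePoly_eq_zero_iff.1 h
  have h1 := hζ.im_pos k
  rw [← hk, im_sq] at h1
  rcases hz with hz | hz
  · have : z.re * z.im < 0 := hz
    linarith
  · have : z.re * z.im = 0 := hz
    linarith

lemma tendsto_eval_conjPoly {p : ℝ → ℂ[X]} {q : ℂ[X]} {l : Filter ℝ}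
    (h : ∀ z, Tendsto (fun x => (p x).eval z) l (𝓝 (q.eval z))) (z : ℂ) :
    Tendsto (fun x => (conjPoly (p x)).eval z) l (𝓝 ((conjPoly q).eval z)) := by
  simp only [eval_conjPoly]
  exact (continuous_conj.tendsto _).comp (h _)

lemma isJostMatrix_dressPlus (hζ : IsSpectrum ζ) (hαβ : ∀ k, α k ≠ 0 ∧ β k ≠ 0) (t : ℝ) :
    IsJostMatrix (fun x => solitonPotential ζ α β x t)
      fun x => dressPlus ζ (solA ζ α β x t) (solB ζ α β x t) := by
  have hαβ' : ∀ k, α k ≠ 0 ∨ β k ≠ 0 := fun k => Or.inl (hαβ k).1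
  intro z hz
  have hdz := hζ.polePoly_ne_zero hz
  have hB := fun (l : Filter ℝ) (hl : Tendsto (fun x : ℝ => |x|) l atTop) (z : ℂ) =>
    tendsto_eval_solB (t := t) hζ hαβ' z hl
  refine ⟨isSpectralSolution_dressPlus hζ hαβ' t z, Fin.forall_fin_two.2 ⟨?_, ?_⟩,
    Fin.forall_fin_two.2 ⟨?_, ?_⟩⟩
  · have h := (tendsto_eval_solA_atBot hζ hαβ t (z ^ 2)).div_const ((polePoly ζ).eval (z ^ 2))
    rw [div_self hdz] at h
    simpa [dressPlus] using h
  · have h := tendsto_eval_conjPoly (q := 0) (p := fun x => solB ζ α β x t)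
      (fun z => by simpa using hB _ tendsto_abs_atBot_atTop z) (z ^ 2)
    simpa [dressPlus, conjPoly] using
      (h.const_mul (-z)).div_const ((polePoly ζ).eval (z ^ 2))
  · simpa [dressPlus] using ((hB _ tendsto_abs_atTop_atTop (z ^ 2)).const_mul z).div_const
      ((polePoly ζ).eval (z ^ 2))
  · have h := (tendsto_eval_conjPoly_solA_atTop hζ hαβ t (z ^ 2)).div_const ((polePoly ζ).eval (z ^ 2))
    rw [div_self hdz] at h
    simpa [dressPlus] using h

/-- A constant diagonal factor on the right commutes with σ₃, so it passes through the commutator;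
columns can be rescaled freely. -/
lemma IsSpectralSolution.mul_diagonal {u : ℝ → ℂ} {z : ℂ} {J : ℝ → Matrix (Fin 2) (Fin 2) ℂ}
    (h : IsSpectralSolution u z J) (c : Fin 2 → ℂ) :
    IsSpectralSolution u z fun x => J x * Matrix.diagonal c := by
  intro x i j
  have h1 := (h x i j).mul_const (c j)
  have hσ : σ₃ = Matrix.diagonal ![1, -1] := by
    ext i j; fin_cases i <;> fin_cases j <;> simp [σ₃]
  simp only [hσ, ← Matrix.mul_assoc, Matrix.mul_diagonal, Matrix.sub_apply, Matrix.smul_apply,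
    smul_eq_mul] at h1 ⊢
  refine h1.congr_deriv ?_
  ring

theorem isReflectionless_solitonPotential (hζ : IsSpectrum ζ) (hαβ : ∀ k, α k ≠ 0 ∧ β k ≠ 0)
    (t : ℝ) : IsReflectionless fun x => solitonPotential ζ α β x t := by
  have hαβ' : ∀ k, α k ≠ 0 ∨ β k ≠ 0 := fun k => Or.inl (hαβ k).1
  intro z hz
  have hd := hζ.polePoly_ne_zero (Or.inr hz : z ∈ C13 ∪ contour)
  have hd' := hζ.conjPoly_polePoly_ne_zero (Or.inr hz : z ∈ C24 ∪ contour)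
  set d := (polePoly ζ).eval (z ^ 2) with hdd
  set e := (conjPoly (polePoly ζ)).eval (z ^ 2) with hee
  have hP := isSpectralSolution_dressPlus hζ hαβ' t z
  have hJ := isJostMatrix_dressPlus hζ hαβ t z (Or.inr hz)
  have hB := fun (l : Filter ℝ) (hl : Tendsto (fun x : ℝ => |x|) l atTop) (z : ℂ) =>
    tendsto_eval_solB (t := t) hζ hαβ' z hl
  -- The second column of the dressing matrix tends to (0, e/d)ᵀ at -∞ and the first to (e/d, 0)ᵀ at
  -- +∞; rescaling these columns by d/e gives J_M and J_P.
  refine ⟨_, _, Matrix.diagonal ![e / d, d / e], hP.mul_diagonal ![1, d / e], ?_,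
    hP.mul_diagonal ![d / e, 1], ?_, fun x => ?_, by simp, by simp⟩
  · refine tendsto_pi_nhds.2 fun i => tendsto_pi_nhds.2 (Fin.forall_fin_two.2 ⟨?_, ?_⟩) <;>
      simp only [Matrix.mul_diagonal]
    · simpa using (hJ.2.1 i)
    · revert i
      refine Fin.forall_fin_two.2 ⟨?_, ?_⟩
      · simpa [dressPlus] using (((hB _ tendsto_abs_atBot_atTop (z ^ 2)).const_mul z).div_const
          d).mul_const (d / e)
      · have h := tendsto_eval_conjPoly (tendsto_eval_solA_atBot hζ hαβ t) (z ^ 2)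
        have h2 := (h.div_const d).mul_const (d / e)
        rw [← hee, show e / d * (d / e) = 1 by field_simp] at h2
        simpa [dressPlus] using h2
  · refine tendsto_pi_nhds.2 fun i => tendsto_pi_nhds.2 (Fin.forall_fin_two.2 ⟨?_, ?_⟩) <;>
      simp only [Matrix.mul_diagonal]
    · revert i
      refine Fin.forall_fin_two.2 ⟨?_, ?_⟩
      · have h := tendsto_eval_conjPoly (tendsto_eval_conjPoly_solA_atTop hζ hαβ t) (z ^ 2)
        simp only [conjPoly_conjPoly] at h
        have h2 := (h.div_const d).mul_const (d / e)
        rw [← hee, show e / d * (d / e) = 1 by field_simp] at h2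
        simpa [dressPlus] using h2
      · have h := tendsto_eval_conjPoly (q := 0) (p := fun x => solB ζ α β x t)
          (fun z => by simpa using hB _ tendsto_abs_atTop_atTop z) (z ^ 2)
        have h2 := ((h.const_mul (-z)).div_const d).mul_const (d / e)
        simpa [dressPlus, conjPoly] using h2
    · simpa using (hJ.2.2 i)
  · ext i j
    simp only [expE, Matrix.mul_diagonal]
    fin_cases j
    · simp only [Fin.zero_eta, Matrix.cons_val_zero]
      field_simp
    · simp only [Fin.mk_one, Matrix.cons_val_one, Matrix.cons_val_fin_one]
      field_simp

end Jost

/-! ### Limits of rational functions of λ = ζ² at infinity -/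

section Infinity

lemma tendsto_pow_div_pow_cobounded {m n : ℕ} (h : m < n) :
    Tendsto (fun z : ℂ => z ^ m / z ^ n) (Bornology.cobounded ℂ) (𝓝 0) := by
  have h1 : Tendsto (fun z : ℂ => (z⁻¹) ^ (n - m)) (Bornology.cobounded ℂ) (𝓝 0) := by
    have := (tendsto_inv₀_cobounded (α := ℂ)).pow (n - m)
    rwa [zero_pow (by omega)] at this
  refine h1.congr' ?_
  filter_upwards [Bornology.eventually_ne_cobounded (0 : ℂ)] with z hz
  rw [inv_pow, eq_div_iff (pow_ne_zero _ hz), inv_mul_eq_iff_eq_mul₀ (pow_ne_zero _ hz), ← pow_add]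
  congr 1
  omega

lemma tendsto_eval_sq_div {p : ℂ[X]} {N : ℕ} (hp : p.natDegree ≤ N) :
    Tendsto (fun z : ℂ => p.eval (z ^ 2) / z ^ (2 * N)) (Bornology.cobounded ℂ)
      (𝓝 (p.coeff N)) := by
  have h1 : ∀ z : ℂ, p.eval (z ^ 2) / z ^ (2 * N) =
      ∑ i ∈ Finset.range N, p.coeff i * (z ^ (2 * i) / z ^ (2 * N)) +
        p.coeff N * (z ^ (2 * N) / z ^ (2 * N)) := fun z => by
    rw [eval_eq_sum_range' (Nat.lt_succ_of_le hp), Finset.sum_range_succ, add_div, Finset.sum_div]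
    congr 1
    · exact Finset.sum_congr rfl fun i _ => by rw [← pow_mul, mul_div_assoc]
    · rw [← pow_mul, mul_div_assoc]
  have h2 : Tendsto (fun z : ℂ => ∑ i ∈ Finset.range N, p.coeff i * (z ^ (2 * i) / z ^ (2 * N)))
      (Bornology.cobounded ℂ) (𝓝 (∑ i ∈ Finset.range N, p.coeff i * 0)) :=
    tendsto_finsetSum _ fun i hi => (tendsto_pow_div_pow_cobounded
      (by have := Finset.mem_range.1 hi; omega)).const_mul _
  have h3 : Tendsto (fun z : ℂ => p.coeff N * (z ^ (2 * N) / z ^ (2 * N)))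
      (Bornology.cobounded ℂ) (𝓝 (p.coeff N * 1)) := by
    refine Tendsto.const_mul _ (tendsto_const_nhds.congr' ?_)
    filter_upwards [Bornology.eventually_ne_cobounded (0 : ℂ)] with z hz
    rw [div_self (pow_ne_zero _ hz)]
  simp only [h1]
  simpa using h2.add h3

lemma tendsto_mul_eval_sq_div {p : ℂ[X]} {N : ℕ} (hp : p.degree < N) :
    Tendsto (fun z : ℂ => z * p.eval (z ^ 2) / z ^ (2 * N)) (Bornology.cobounded ℂ) (𝓝 0) := by
  have h1 : ∀ z : ℂ, z * p.eval (z ^ 2) / z ^ (2 * N) =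
      ∑ i ∈ Finset.range N, p.coeff i * (z ^ (2 * i + 1) / z ^ (2 * N)) := fun z => by
    rw [eval_eq_sum_range' (Nat.lt_succ_of_le (natDegree_le_of_degree_le hp.le)),
      Finset.sum_range_succ, (degree_lt_iff_coeff_zero _ _).1 hp N le_rfl, zero_mul, add_zero,
      Finset.mul_sum, Finset.sum_div]
    refine Finset.sum_congr rfl fun i _ => ?_
    ring
  have h2 : Tendsto (fun z : ℂ => ∑ i ∈ Finset.range N, p.coeff i * (z ^ (2 * i + 1) / z ^ (2 * N)))
      (Bornology.cobounded ℂ) (𝓝 (∑ i ∈ Finset.range N, p.coeff i * 0)) :=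
    tendsto_finsetSum _ fun i hi => (tendsto_pow_div_pow_cobounded
      (by have := Finset.mem_range.1 hi; omega)).const_mul _
  simp only [h1]
  simpa using h2

lemma tendsto_eval_sq_div_eval_sq {p d : ℂ[X]} {N : ℕ} (hp : p.natDegree ≤ N)
    (hd : d.natDegree ≤ N) (hd0 : d.coeff N ≠ 0) :
    Tendsto (fun z : ℂ => p.eval (z ^ 2) / d.eval (z ^ 2)) (Bornology.cobounded ℂ)
      (𝓝 (p.coeff N / d.coeff N)) := by
  refine ((tendsto_eval_sq_div hp).div (tendsto_eval_sq_div hd) hd0).congr' ?_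
  filter_upwards [Bornology.eventually_ne_cobounded (0 : ℂ)] with z hz
  exact div_div_div_cancel_right₀ (pow_ne_zero _ hz) _ _

lemma tendsto_mul_eval_sq_div_eval_sq {p d : ℂ[X]} {N : ℕ} (hp : p.degree < N)
    (hd : d.natDegree ≤ N) (hd0 : d.coeff N ≠ 0) :
    Tendsto (fun z : ℂ => z * p.eval (z ^ 2) / d.eval (z ^ 2)) (Bornology.cobounded ℂ)
      (𝓝 0) := by
  have := (tendsto_mul_eval_sq_div hp).div (tendsto_eval_sq_div hd) hd0
  rw [zero_div] at this
  refine this.congr' ?_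
  filter_upwards [Bornology.eventually_ne_cobounded (0 : ℂ)] with z hz
  exact div_div_div_cancel_right₀ (pow_ne_zero _ hz) _ _

end Infinity

/-! ### The dressing matrix solves the Riemann-Hilbert problem -/

section Existence

variable {N : ℕ} {ζ : Fin N → ℂ} {v : Fin N → Fin 2 → ℂ} {a b : ℂ[X]}

lemma differentiable_eval_sq (p : ℂ[X]) : Differentiable ℂ fun z : ℂ => p.eval (z ^ 2) :=
  p.differentiable.comp (differentiable_id.pow 2)

lemma isOpen_C13 : IsOpen C13 :=
  isOpen_lt continuous_const (continuous_re.mul continuous_im)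

lemma IsSpectrum.mem_C13 (hζ : IsSpectrum ζ) (k : Fin N) : ζ k ∈ C13 := by
  have := hζ.im_pos k
  rw [im_sq] at this
  change 0 < (ζ k).re * (ζ k).im
  linarith

lemma neg_mem_C13 {z : ℂ} (hz : z ∈ C13) : -z ∈ C13 := by
  have : 0 < z.re * z.im := hz
  change 0 < (-z).re * (-z).im
  simpa using this

lemma differentiableOn_dressPlus (i j : Fin 2) :
    DifferentiableOn ℂ (fun z => dressPlus ζ a b z i j) {z | (polePoly ζ).eval (z ^ 2) ≠ 0} := by
  have h := fun p => (differentiable_eval_sq p).differentiableOn (s := {z : ℂ | (polePoly ζ).eval (z ^ 2) ≠ 0})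
  fin_cases i <;> fin_cases j
  · exact (h a).div (h _) fun z hz => hz
  · exact (differentiableOn_id.mul (h b)).div (h _) fun z hz => hz
  · exact (differentiableOn_id.neg.mul (h _)).div (h _) fun z hz => hz
  · exact (h _).div (h _) fun z hz => hz

lemma differentiableOn_dressMinus (i j : Fin 2) :
    DifferentiableOn ℂ (fun z => dressMinus ζ a b z i j)
      {z | (conjPoly (polePoly ζ)).eval (z ^ 2) ≠ 0} := by
  have h := fun p => (differentiable_eval_sq p).differentiableOn
    (s := {z : ℂ | (conjPoly (polePoly ζ)).eval (z ^ 2) ≠ 0})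
  fin_cases i <;> fin_cases j
  · exact (h _).div (h _) fun z hz => hz
  · exact (differentiableOn_id.neg.mul (h b)).div (h _) fun z hz => hz
  · exact (differentiableOn_id.mul (h _)).div (h _) fun z hz => hz
  · exact (h a).div (h _) fun z hz => hz

lemma IsDressing.eval_detPoly_eq (hζ : IsSpectrum ζ) (hv : ∀ k, v k ≠ 0) (h : IsDressing ζ v a b)
    (z : ℂ) : a.eval (z ^ 2) * (conjPoly a).eval (z ^ 2) +
      z ^ 2 * (b.eval (z ^ 2) * (conjPoly b).eval (z ^ 2)) =
        (polePoly ζ).eval (z ^ 2) * (conjPoly (polePoly ζ)).eval (z ^ 2) := by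
  have := congrArg (eval (z ^ 2)) (h.detPoly_eq hζ hv)
  simpa [detPoly] using this

lemma IsDressing.dressMinus_mul (hζ : IsSpectrum ζ) (hv : ∀ k, v k ≠ 0) (h : IsDressing ζ v a b)
    {z : ℂ} (hz : (polePoly ζ).eval (z ^ 2) ≠ 0) (hz' : (conjPoly (polePoly ζ)).eval (z ^ 2) ≠ 0) :
    dressMinus ζ a b z * dressPlus ζ a b z = 1 := by
  have h1 := h.eval_detPoly_eq hζ hv z
  ext i j
  fin_cases i <;> fin_cases j <;>
  · simp only [dressMinus, dressPlus, Matrix.mul_apply, Fin.sum_univ_two, Matrix.of_apply,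
      Matrix.cons_val', Matrix.cons_val_zero, Matrix.cons_val_one, Matrix.cons_val_fin_one,
      Fin.zero_eta, Fin.mk_one, Matrix.one_apply_eq, ne_eq, zero_ne_one, one_ne_zero,
      not_false_eq_true, Matrix.one_apply_ne]
    field_simp
    first | linear_combination h1 | ring

lemma IsDressing.det_dressPlus (hζ : IsSpectrum ζ) (hv : ∀ k, v k ≠ 0) (h : IsDressing ζ v a b)
    {z : ℂ} (hz : (polePoly ζ).eval (z ^ 2) ≠ 0) :
    (dressPlus ζ a b z).det = (conjPoly (polePoly ζ)).eval (z ^ 2) / (polePoly ζ).eval (z ^ 2) := by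
  have h1 := h.eval_detPoly_eq hζ hv z
  rw [dressPlus, Matrix.det_fin_two_of]
  field_simp
  linear_combination h1

lemma IsSpectrum.eval_derivative_conjPoly_polePoly_ne_zero (hζ : IsSpectrum ζ) (k : Fin N) :
    (derivative (conjPoly (polePoly ζ))).eval (ζ k ^ 2) ≠ 0 := by
  have h1 : (derivative (polePoly ζ)).eval (conj (ζ k) ^ 2) ≠ 0 := by
    rw [polePoly, derivative_C_mul, eval_mul, eval_C]
    refine mul_ne_zero (inv_ne_zero hζ.nodal_zero_ne_zero) ?_
    rw [Lagrange.eval_nodal_derivative_eval_node_eq (v := fun k => conj (ζ k) ^ 2)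
      (Finset.mem_univ k)]
    exact hζ.eval_poleCofactor_self k
  have h2 : derivative (conjPoly (polePoly ζ)) = conjPoly (derivative (polePoly ζ)) :=
    derivative_map _ _
  rw [h2, eval_conjPoly, map_pow]
  simpa using h1

lemma IsSpectrum.polePoly_sq_ne_zero (hζ : IsSpectrum ζ) (k : Fin N) :
    (polePoly ζ).eval (ζ k ^ 2) ≠ 0 :=
  hζ.polePoly_ne_zero (Or.inl (hζ.mem_C13 k))

/-- The determinant is d*/d in λ, with simple zeros at the ζ_k²; the chain rule adds the nonzero
factor 2z. -/
lemma IsDressing.deriv_det_ne_zero (hζ : IsSpectrum ζ) (hv : ∀ k, v k ≠ 0)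
    (h : IsDressing ζ v a b) (k : Fin N) {z : ℂ} (hz : z ^ 2 = ζ k ^ 2) (hz0 : z ≠ 0) :
    deriv (fun z => (dressPlus ζ a b z).det) z ≠ 0 := by
  have hd : (polePoly ζ).eval (z ^ 2) ≠ 0 := by rw [hz]; exact hζ.polePoly_sq_ne_zero k
  have he : (conjPoly (polePoly ζ)).eval (z ^ 2) = 0 :=
    hζ.eval_conjPoly_polePoly_eq_zero_iff.2 ⟨k, hz⟩
  have hev : (fun z => (dressPlus ζ a b z).det) =ᶠ[𝓝 z] fun z =>
      (conjPoly (polePoly ζ)).eval (z ^ 2) / (polePoly ζ).eval (z ^ 2) := by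
    filter_upwards [(differentiable_eval_sq (polePoly ζ)).continuous.continuousAt.eventually_ne hd]
      with w hw using h.det_dressPlus hζ hv hw
  have hp : ∀ p : ℂ[X], HasDerivAt (fun z : ℂ => p.eval (z ^ 2))
      ((derivative p).eval (z ^ 2) * (2 * z)) z := fun p => by
    have h1 := HasDerivAt.comp z (p.hasDerivAt (z ^ 2)) (hasDerivAt_pow 2 z)
    exact HasDerivAt.congr_deriv (f := fun z => p.eval (z ^ 2)) h1 (by simp)
  rw [hev.deriv_eq, ((hp _).fun_div (hp _) hd).deriv, he, zero_mul, sub_zero, hz]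
  have := hζ.eval_derivative_conjPoly_polePoly_ne_zero k
  rw [hz] at hd
  exact div_ne_zero (mul_ne_zero (mul_ne_zero this (mul_ne_zero two_ne_zero hz0)) hd)
    (pow_ne_zero 2 hd)

lemma IsDressing.dressPlus_mulVec (h : IsDressing ζ v a b) (k : Fin N) :
    dressPlus ζ a b (ζ k) *ᵥ v k = 0 := by
  have h1 := h.kernel k
  have h2 := h.range_conj k
  ext i
  fin_cases i
  · simp only [dressPlus, Matrix.mulVec, dotProduct, Fin.sum_univ_two, Matrix.of_apply,
      Matrix.cons_val', Matrix.cons_val_zero, Matrix.cons_val_one, Matrix.cons_val_fin_one,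
      Fin.zero_eta, Pi.zero_apply]
    linear_combination (1 / (polePoly ζ).eval (ζ k ^ 2)) * h1
  · simp only [dressPlus, Matrix.mulVec, dotProduct, Fin.sum_univ_two, Matrix.of_apply,
      Matrix.cons_val', Matrix.cons_val_zero, Matrix.cons_val_one, Matrix.cons_val_fin_one,
      Fin.mk_one, Pi.zero_apply]
    linear_combination (1 / (polePoly ζ).eval (ζ k ^ 2)) * h2

/-- If all four entries vanished, a a* + λ b b* would have a double zero at ζ_k², whereas d d* has a
simple one there. With this, the kernel is exactly one-dimensional. -/
lemma IsDressing.dressPlus_ne_zero (hζ : IsSpectrum ζ) (hv : ∀ k, v k ≠ 0)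
    (h : IsDressing ζ v a b) (k : Fin N) : dressPlus ζ a b (ζ k) ≠ 0 := by
  intro h0
  have hd := hζ.polePoly_sq_ne_zero k
  have hz := hζ.ne_zero k
  have h00 := congrFun (congrFun h0 0) 0
  have h01 := congrFun (congrFun h0 0) 1
  have h10 := congrFun (congrFun h0 1) 0
  have h11 := congrFun (congrFun h0 1) 1
  simp only [dressPlus, Matrix.of_apply, Matrix.cons_val', Matrix.cons_val_zero,
    Matrix.cons_val_one, Matrix.cons_val_fin_one, Matrix.zero_apply, div_eq_zero_iff, hd, or_false,
    mul_eq_zero, hz, false_or, neg_eq_zero] at h00 h01 h10 h11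
  have h1 := congrArg (fun p => (derivative p).eval (ζ k ^ 2)) (h.detPoly_eq hζ hv)
  simp only [detPoly, derivative_add, derivative_mul, derivative_X, eval_add, eval_mul, eval_X,
    h00, h01, h10, h11, hζ.eval_conjPoly_polePoly_eq_zero_iff.2 ⟨k, rfl⟩] at h1
  have h2 := mul_ne_zero hd (hζ.eval_derivative_conjPoly_polePoly_ne_zero k)
  apply h2
  linear_combination -h1

lemma mem_span_of_mulVec_eq_zero {P : Matrix (Fin 2) (Fin 2) ℂ} (hP : P ≠ 0) {u w : Fin 2 → ℂ}
    (hw : w ≠ 0) (hPu : P *ᵥ u = 0) (hPw : P *ᵥ w = 0) : u ∈ Submodule.span ℂ {w} := by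
  have hu : ∀ i, P i 0 * u 0 + P i 1 * u 1 = 0 := fun i => by
    simpa [Matrix.mulVec, dotProduct, Fin.sum_univ_two] using congrFun hPu i
  have hw' : ∀ i, P i 0 * w 0 + P i 1 * w 1 = 0 := fun i => by
    simpa [Matrix.mulVec, dotProduct, Fin.sum_univ_two] using congrFun hPw i
  have hD : u 0 * w 1 - u 1 * w 0 = 0 := by
    by_contra hD
    apply hP
    ext i j
    refine mul_right_cancel₀ hD ?_
    fin_cases j
    · simp only [Fin.zero_eta, Matrix.zero_apply, zero_mul]
      linear_combination w 1 * hu i - u 1 * hw' i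
    · simp only [Fin.mk_one, Matrix.zero_apply, zero_mul]
      linear_combination u 0 * hw' i - w 0 * hu i
  rw [Submodule.mem_span_singleton]
  by_cases h0 : w 0 = 0
  · have h1 : w 1 ≠ 0 := fun h1 => hw (by ext i; fin_cases i <;> simp [h0, h1])
    refine ⟨u 1 / w 1, ?_⟩
    have : u 0 = 0 := by simpa [h0, h1] using hD
    ext i
    fin_cases i
    · simp [h0, this]
    · simp [h1]
  · refine ⟨u 0 / w 0, ?_⟩
    ext i
    fin_cases i
    · simp [h0]
    · simp only [Fin.mk_one, Pi.smul_apply, smul_eq_mul]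
      field_simp
      linear_combination hD

/-- The dressing matrix solves the reflectionless Riemann-Hilbert problem. -/
theorem IsDressing.isReflectionlessRHPSolution (hζ : IsSpectrum ζ) (hv : ∀ k, v k ≠ 0)
    (h : IsDressing ζ v a b) :
    IsReflectionlessRHPSolution ζ v (dressPlus ζ a b) (dressMinus ζ a b) where
  analytic_pos i j := (differentiableOn_dressPlus i j).mono fun z hz =>
    hζ.polePoly_ne_zero (Or.inl hz)
  analytic_neg i j := (differentiableOn_dressMinus i j).mono fun z hz =>
    hζ.conjPoly_polePoly_ne_zero (Or.inl hz)
  continuous_pos := continuousOn_pi.2 fun i => continuousOn_pi.2 fun j =>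
    (differentiableOn_dressPlus i j).continuousOn.mono fun z hz => hζ.polePoly_ne_zero hz
  continuous_neg := continuousOn_pi.2 fun i => continuousOn_pi.2 fun j =>
    (differentiableOn_dressMinus i j).continuousOn.mono fun z hz =>
      hζ.conjPoly_polePoly_ne_zero hz
  jump z hz := h.dressMinus_mul hζ hv (hζ.polePoly_ne_zero (Or.inr hz))
    (hζ.conjPoly_polePoly_ne_zero (Or.inr hz))
  normalization_pos := by
    ext i j
    fin_cases i <;> fin_cases j <;>
      simp [dressPlus, hζ.polePoly_zero, h.eval_zero, eval_conjPoly]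
  normalization_neg := by
    ext i j
    fin_cases i <;> fin_cases j <;>
      simp [dressMinus, hζ.polePoly_zero, h.eval_zero, eval_conjPoly]
  at_infinity := by
    have ha := h.coeff_ne_zero hζ hv
    have hd := hζ.coeff_polePoly_ne_zero
    have hb : (conjPoly b).degree < N := (degree_conjPoly b).trans_lt h.degree_lt
    -- The off-diagonal entries tend to 0: with deg b < N, the odd power in the numerator stays
    -- below 2N.
    refine ⟨!![a.coeff N / (polePoly ζ).coeff N, 0; 0, conj (a.coeff N) / (polePoly ζ).coeff N],
      ?_, Tendsto.mono_left ?_ inf_le_left⟩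
    · rw [Matrix.det_fin_two_of]
      simp [ha, hd]
    · refine tendsto_pi_nhds.2 (Fin.forall_fin_two.2 ⟨tendsto_pi_nhds.2 (Fin.forall_fin_two.2
        ⟨?_, ?_⟩), tendsto_pi_nhds.2 (Fin.forall_fin_two.2 ⟨?_, ?_⟩)⟩)
      · exact tendsto_eval_sq_div_eval_sq h.natDegree_le hζ.natDegree_polePoly.le hd
      · exact tendsto_mul_eval_sq_div_eval_sq h.degree_lt hζ.natDegree_polePoly.le hd
      · simpa [dressPlus, neg_div] using
          (tendsto_mul_eval_sq_div_eval_sq hb hζ.natDegree_polePoly.le hd).neg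
      · rw [← coeff_conjPoly]
        exact tendsto_eval_sq_div_eval_sq ((natDegree_conjPoly a).trans_le h.natDegree_le)
          hζ.natDegree_polePoly.le hd
  symm_conj z _ := by
    ext i j
    fin_cases i <;> fin_cases j <;> simp [dressPlus, dressMinus, eval_conjPoly]
  symm_neg z _ := by
    ext i j
    fin_cases i <;> fin_cases j <;>
      simp [dressPlus, σ₃, Matrix.mul_apply, Fin.sum_univ_two, neg_div]
  zeros z hz := by
    have hd := hζ.polePoly_ne_zero (Or.inl hz)
    rw [h.det_dressPlus hζ hv hd, div_eq_zero_iff, or_iff_left hd,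
      hζ.eval_conjPoly_polePoly_eq_zero_iff]
    exact exists_congr fun k => sq_eq_sq_iff_eq_or_eq_neg
  simple k := ⟨h.deriv_det_ne_zero hζ hv k rfl (hζ.ne_zero k),
    h.deriv_det_ne_zero hζ hv k (by ring) (neg_ne_zero.2 (hζ.ne_zero k))⟩
  kernel k := by
    ext u
    rw [LinearMap.mem_ker, Matrix.mulVecLin_apply]
    constructor
    · exact fun hu => mem_span_of_mulVec_eq_zero (h.dressPlus_ne_zero hζ hv k) (hv k) hu
        (h.dressPlus_mulVec k)
    · intro hu
      obtain ⟨c, rfl⟩ := Submodule.mem_span_singleton.1 hu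
      rw [Matrix.mulVec_smul, h.dressPlus_mulVec k, smul_zero]

end Existence

/-! ### Phragmén-Lindelöf and removal of zeros in the first quadrant -/

section Quadrant

/-- The open first quadrant. -/
abbrev quadrant : Set ℂ := Set.Ioi 0 ×ℂ Set.Ioi 0

/-- The closed first quadrant. -/
abbrev closedQuadrant : Set ℂ := Set.Ici 0 ×ℂ Set.Ici 0

lemma closure_quadrant : closure quadrant = closedQuadrant := by
  rw [closure_reProdIm, closure_Ioi]

lemma isOpen_quadrant : IsOpen quadrant := isOpen_Ioi.reProdIm isOpen_Ioi

lemma quadrant_subset_closedQuadrant : quadrant ⊆ closedQuadrant := fun z hz =>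
  ⟨le_of_lt (show 0 < z.re from hz.1), le_of_lt (show 0 < z.im from hz.2)⟩

lemma quadrant_subset_C13 : quadrant ⊆ C13 := fun z hz =>
  mul_pos (show 0 < z.re from hz.1) (show 0 < z.im from hz.2)

lemma closedQuadrant_subset : closedQuadrant ⊆ C13 ∪ contour := fun z hz =>
  (mul_nonneg (show 0 ≤ z.re from hz.1) (show 0 ≤ z.im from hz.2)).lt_or_eq.imp id Eq.symm

lemma diffContOnCl_quadrant {f : ℂ → ℂ} (hd : DifferentiableOn ℂ f quadrant)
    (hc : ContinuousOn f closedQuadrant) : DiffContOnCl ℂ f quadrant :=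
  ⟨hd, by rwa [closure_quadrant]⟩

/-- Boundedness cast in the form of the growth condition for an opening angle π/2, where any
exponent below 2 is admissible. -/
lemma growth_of_isBigO_one {f : ℂ → ℂ}
    (h : f =O[Bornology.cobounded ℂ ⊓ 𝓟 quadrant] fun _ => (1 : ℝ)) :
    ∃ c < (2 : ℝ), ∃ B, f =O[Bornology.cobounded ℂ ⊓ 𝓟 quadrant]
      fun z => Real.exp (B * ‖z‖ ^ c) :=
  ⟨1, one_lt_two, 0, by simpa using h⟩

/-- A function on the first quadrant that is bounded near infinity and real on the boundary is
constant. -/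
lemma eq_of_real_on_axes {f : ℂ → ℂ} (hd : DifferentiableOn ℂ f quadrant)
    (hc : ContinuousOn f closedQuadrant)
    (hO : f =O[Bornology.cobounded ℂ ⊓ 𝓟 quadrant] fun _ => (1 : ℝ))
    (hr : ∀ z ∈ contour, z ∈ closedQuadrant → (f z).im = 0) :
    ∀ z ∈ closedQuadrant, f z = f 0 := by
  have haxis : ∀ x : ℝ, 0 ≤ x → ((x : ℂ) ∈ contour ∧ (x : ℂ) ∈ closedQuadrant) ∧
      ((x : ℂ) * I ∈ contour ∧ (x : ℂ) * I ∈ closedQuadrant) := fun x hx => by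
    simp [contour, mem_reProdIm, hx]
  -- For imaginary c the function exp(c f) has modulus 1 on the axes and is bounded near infinity,
  -- hence has modulus at most 1 inside. Taking c = i and c = -i forces Im f = 0.
  have hexp : ∀ c : ℂ, c.re = 0 → ∀ z ∈ closedQuadrant, (-(c.im * (f z).im)) ≤ 0 := by
    intro c hcr z hz
    have h1 : ∀ w, ‖exp (c * f w)‖ = Real.exp (-(c.im * (f w).im)) := fun w => by
      rw [norm_exp, mul_re, hcr, zero_mul, zero_sub]
    have h2 : (fun w => exp (c * f w)) =O[Bornology.cobounded ℂ ⊓ 𝓟 quadrant]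
        fun _ => (1 : ℝ) := by
      obtain ⟨C, hC⟩ := hO.bound
      refine Asymptotics.IsBigO.of_bound (Real.exp (‖c‖ * C)) ?_
      filter_upwards [hC] with w hw
      rw [norm_one, mul_one] at hw ⊢
      refine (norm_exp_le_exp_norm _).trans (Real.exp_le_exp.2 ?_)
      rw [norm_mul]
      exact mul_le_mul_of_nonneg_left hw (norm_nonneg c)
    have h3 : ‖exp (c * f z)‖ ≤ 1 := by
      refine PhragmenLindelof.quadrant_I (f := fun w => exp (c * f w))
        (diffContOnCl_quadrant (hd.const_mul c).cexp ((continuousOn_const.mul hc).cexp))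
        (growth_of_isBigO_one h2) (fun x hx => ?_) (fun x hx => ?_) hz.1 hz.2
      · simp only [h1, hr _ (haxis x hx).1.1 (haxis x hx).1.2]
        simp
      · simp only [h1, hr _ (haxis x hx).2.1 (haxis x hx).2.2]
        simp
    rw [h1] at h3
    simpa using h3
  have him : ∀ z ∈ closedQuadrant, (f z).im = 0 := fun z hz => by
    have h1 := hexp I I_re z hz
    have h2 := hexp (-I) (by simp) z hz
    simp only [neg_im, I_im] at h1 h2
    linarith
  have hconn : IsConnected quadrant :=
    ⟨⟨1 + I, by simp [mem_reProdIm]⟩,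
      ((convex_halfSpace_re_gt 0).inter (convex_halfSpace_im_gt 0)).isPreconnected⟩
  obtain ⟨c, hcc⟩ := AnalyticOnNhd.eq_const_of_im_eq_const (c₀ := 0)
    (hd.analyticOnNhd isOpen_quadrant) (fun z hz => him z (quadrant_subset_closedQuadrant hz))
    isOpen_quadrant hconn
  have hK : Set.EqOn f (fun _ => c) closedQuadrant :=
    Set.EqOn.of_subset_closure (s := quadrant) (fun z hz => hcc z hz) hc continuousOn_const
      quadrant_subset_closedQuadrant closure_quadrant.ge
  intro z hz
  rw [hK hz, hK (by simp [mem_reProdIm] : (0 : ℂ) ∈ closedQuadrant)]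

lemma eq_zero_of_zero_on_axes {f : ℂ → ℂ} (hd : DifferentiableOn ℂ f quadrant)
    (hc : ContinuousOn f closedQuadrant)
    (hO : f =O[Bornology.cobounded ℂ ⊓ 𝓟 quadrant] fun _ => (1 : ℝ))
    (hr : ∀ z ∈ contour, z ∈ closedQuadrant → f z = 0) :
    ∀ z ∈ closedQuadrant, f z = 0 := by
  have h := eq_of_real_on_axes hd hc hO fun z hz hz' => by rw [hr z hz hz', zero_im]
  intro z hz
  rw [h z hz]
  exact hr 0 (by simp [contour]) (by simp [mem_reProdIm])

/-- Zeros in the open quadrant can be divided out. -/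
lemma exists_eq_prod_mul (s : Finset ℂ) : ∀ f : ℂ → ℂ, (∀ c ∈ s, c ∈ quadrant) →
    DifferentiableOn ℂ f quadrant → ContinuousOn f closedQuadrant → (∀ c ∈ s, f c = 0) →
    ∃ g : ℂ → ℂ, DifferentiableOn ℂ g quadrant ∧ ContinuousOn g closedQuadrant ∧
      ∀ z, f z = (∏ c ∈ s, (z - c)) * g z := by
  classical
  induction s using Finset.induction_on with
  | empty => exact fun f _ hd hc _ => ⟨f, hd, hc, fun z => by simp⟩
  | insert c s hcs ih =>
    intro f hs hd hc h0
    obtain ⟨g, hgd, hgc, hg⟩ := ih f (fun x hx => hs x (Finset.mem_insert_of_mem hx)) hd hc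
      fun x hx => h0 x (Finset.mem_insert_of_mem hx)
    have hcq := hs c (Finset.mem_insert_self c s)
    have hnhds := isOpen_quadrant.mem_nhds hcq
    have hgc0 : g c = 0 := by
      have h1 := hg c
      rw [h0 c (Finset.mem_insert_self c s), eq_comm, mul_eq_zero] at h1
      refine h1.resolve_left (Finset.prod_ne_zero_iff.2 fun x hx => sub_ne_zero.2 ?_)
      rintro rfl
      exact hcs hx
    refine ⟨dslope g c, (differentiableOn_dslope hnhds).2 hgd,
      (continuousOn_dslope (mem_of_superset hnhds quadrant_subset_closedQuadrant)).2
        ⟨hgc, (hgd c hcq).differentiableAt hnhds⟩, fun z => ?_⟩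
    have h2 := sub_smul_dslope g c z
    rw [hgc0, sub_zero, smul_eq_mul] at h2
    rw [hg z, Finset.prod_insert hcs, ← h2]
    ring

lemma ne_zero_of_deriv_ne_zero {s : Finset ℂ} {f g : ℂ → ℂ}
    (hgd : DifferentiableOn ℂ g quadrant) (hg : ∀ z, f z = (∏ c ∈ s, (z - c)) * g z) {c : ℂ}
    (hc : c ∈ s) (hcq : c ∈ quadrant) (hf : deriv f c ≠ 0) : g c ≠ 0 := by
  intro h0
  apply hf
  have hp : DifferentiableAt ℂ (fun z => ∏ c ∈ s, (z - c)) c := by fun_prop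
  have h1 := hp.hasDerivAt.mul
    ((hgd c hcq).differentiableAt (isOpen_quadrant.mem_nhds hcq)).hasDerivAt
  rw [show f = (fun z => ∏ c ∈ s, (z - c)) * g from funext hg, h1.deriv, h0,
    Finset.prod_eq_zero hc (sub_self c)]
  ring

end Quadrant

/-! ### Symmetries on the contour -/

section Boundary

lemma σ₃_eq_diagonal : σ₃ = Matrix.diagonal ![1, -1] := by
  ext i j
  fin_cases i <;> fin_cases j <;> simp [σ₃]

/-- On the contour the two halves of a solution are related by a conjugation. -/
lemma IsReflectionlessRHPSolution.exists_sign {z : ℂ} (hz : z ∈ contour) :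
    ∃ τ : ℂ, τ * τ = 1 ∧ conj τ = τ ∧ ∀ {N : ℕ} {ζ : Fin N → ℂ} {v : Fin N → Fin 2 → ℂ}
      {Pp Pm : ℂ → Matrix (Fin 2) (Fin 2) ℂ}, IsReflectionlessRHPSolution ζ v Pp Pm →
        Pm z = Matrix.diagonal ![1, τ] * (Pp z)ᴴ * Matrix.diagonal ![1, τ] := by
  rcases mul_eq_zero.1 (hz : z.re * z.im = 0) with h | h
  · refine ⟨-1, by norm_num, by simp, fun hP => ?_⟩
    have hc : conj z = -z := by apply Complex.ext <;> simp [h]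
    rw [hP.symm_conj z (Or.inr hz), hc, hP.symm_neg z (Or.inr hz), Matrix.conjTranspose_mul,
      Matrix.conjTranspose_mul, ← σ₃_eq_diagonal]
    have : σ₃ᴴ = σ₃ := by
      ext i j
      fin_cases i <;> fin_cases j <;> simp [σ₃]
    rw [this, Matrix.mul_assoc]
  · refine ⟨1, by norm_num, by simp, fun hP => ?_⟩
    have hc : conj z = z := by apply Complex.ext <;> simp [h]
    have h1 : (Matrix.diagonal ![1, 1] : Matrix (Fin 2) (Fin 2) ℂ) = 1 := by
      ext i j
      fin_cases i <;> fin_cases j <;> simp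
    rw [hP.symm_conj z (Or.inr hz), hc, h1, Matrix.one_mul, Matrix.mul_one]

/-- The inverse, which is the twisted adjoint, must equal the adjugate divided by the determinant;
the relations are its entries. -/
lemma unitary_relations {Φ : Matrix (Fin 2) (Fin 2) ℂ} {τ : ℂ}
    (h : Φ * (Matrix.diagonal ![1, τ] * Φᴴ * Matrix.diagonal ![1, τ]) = 1) :
    Φ.det ≠ 0 ∧ conj (Φ 0 0) * Φ.det = Φ 1 1 ∧ τ * τ * conj (Φ 1 1) * Φ.det = Φ 0 0 ∧
      τ * conj (Φ 1 0) * Φ.det = -Φ 0 1 := by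
  have hdet : Φ.det ≠ 0 := Matrix.det_ne_zero_of_right_inverse h
  have h1 : Φ.det • (Matrix.diagonal ![1, τ] * Φᴴ * Matrix.diagonal ![1, τ]) = Φ.adjugate := by
    rw [← Matrix.one_mul (Matrix.diagonal ![1, τ] * Φᴴ * Matrix.diagonal ![1, τ]),
      ← Matrix.smul_mul, ← Matrix.adjugate_mul, Matrix.mul_assoc, h, Matrix.mul_one]
  have h2 := fun i j => congrFun (congrFun h1 i) j
  simp only [Matrix.smul_apply, Matrix.mul_diagonal, Matrix.diagonal_mul, smul_eq_mul,
    Matrix.conjTranspose_apply, Matrix.adjugate_fin_two] at h2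
  have h00 := h2 0 0
  have h01 := h2 0 1
  have h11 := h2 1 1
  simp at h00 h01 h11
  refine ⟨hdet, ?_, ?_, ?_⟩
  · linear_combination h00
  · linear_combination h11
  · linear_combination h01

end Boundary

/-! ### Cancellation of the zeros by the adjugate -/

section Uniqueness

variable {N : ℕ} {ζ : Fin N → ℂ} {v : Fin N → Fin 2 → ℂ} {a b : ℂ[X]}
  {Pp Pm : ℂ → Matrix (Fin 2) (Fin 2) ℂ}

/-- The numerator of the inverse of the dressing matrix. -/
def numMinus (a b : ℂ[X]) (z : ℂ) : Matrix (Fin 2) (Fin 2) ℂ :=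
  !![(conjPoly a).eval (z ^ 2), -z * b.eval (z ^ 2);
    z * (conjPoly b).eval (z ^ 2), a.eval (z ^ 2)]

lemma differentiable_numMinus (i j : Fin 2) : Differentiable ℂ fun z => numMinus a b z i j := by
  have h := differentiable_eval_sq
  fin_cases i <;> fin_cases j
  · exact h _
  · exact differentiable_id.neg.mul (h _)
  · exact differentiable_id.mul (h _)
  · exact h _

lemma dressMinus_eq (z : ℂ) :
    dressMinus ζ a b z = ((conjPoly (polePoly ζ)).eval (z ^ 2))⁻¹ • numMinus a b z := by
  ext i j
  fin_cases i <;> fin_cases j <;> simp [dressMinus, numMinus, div_eq_inv_mul]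

lemma numMinus_neg (z : ℂ) : numMinus a b (-z) = σ₃ * numMinus a b z * σ₃ := by
  ext i j
  fin_cases i <;> fin_cases j <;> simp [numMinus, σ₃, Matrix.mul_apply, Fin.sum_univ_two]

lemma σ₃_mul_self : σ₃ * σ₃ = 1 := by
  ext i j
  fin_cases i <;> fin_cases j <;> simp [σ₃]

/-- The kernel and range conditions say that both columns of the adjugate numerator at ζ_k are
multiples of v_k. -/
lemma IsDressing.mul_numMinus_eq_zero (hv : ∀ k, v k ≠ 0) (h : IsDressing ζ v a b) (k : Fin N)
    {P : Matrix (Fin 2) (Fin 2) ℂ} (hP : P *ᵥ v k = 0) : P * numMinus a b (ζ k) = 0 := by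
  have h1 := h.kernel k
  have h2 := h.range_conj k
  have hrow : ∀ i, P i 0 * v k 0 + P i 1 * v k 1 = 0 := fun i => by
    simpa [Matrix.mulVec, dotProduct, Fin.sum_univ_two] using congrFun hP i
  ext i j
  have h3 := hrow i
  rw [Matrix.mul_apply, Fin.sum_univ_two]
  by_cases h0 : v k 0 = 0
  · have h4 : v k 1 ≠ 0 := fun h4 => hv k (by ext i; fin_cases i <;> simp [h0, h4])
    refine mul_right_cancel₀ h4 ?_
    fin_cases j
    · simp only [numMinus, Matrix.of_apply, Matrix.cons_val', Matrix.cons_val_zero,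
        Matrix.cons_val_one, Matrix.cons_val_fin_one, Fin.zero_eta, Matrix.zero_apply,
        zero_mul]
      linear_combination P i 0 * h2 + ζ k * (conjPoly b).eval (ζ k ^ 2) * h3
    · simp only [numMinus, Matrix.of_apply, Matrix.cons_val', Matrix.cons_val_zero,
        Matrix.cons_val_one, Matrix.cons_val_fin_one, Fin.mk_one, Matrix.zero_apply,
        zero_mul]
      linear_combination -P i 0 * h1 + a.eval (ζ k ^ 2) * h3
  · refine mul_right_cancel₀ h0 ?_
    fin_cases j
    · simp only [numMinus, Matrix.of_apply, Matrix.cons_val', Matrix.cons_val_zero,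
        Matrix.cons_val_one, Matrix.cons_val_fin_one, Fin.zero_eta, Matrix.zero_apply,
        zero_mul]
      linear_combination -P i 1 * h2 + (conjPoly a).eval (ζ k ^ 2) * h3
    · simp only [numMinus, Matrix.of_apply, Matrix.cons_val', Matrix.cons_val_zero,
        Matrix.cons_val_one, Matrix.cons_val_fin_one, Fin.mk_one, Matrix.zero_apply,
        zero_mul]
      linear_combination P i 1 * h1 - ζ k * b.eval (ζ k ^ 2) * h3

lemma IsReflectionlessRHPSolution.mul_numMinus_eq_zero (hζ : IsSpectrum ζ) (hv : ∀ k, v k ≠ 0)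
    (h : IsDressing ζ v a b) (hP : IsReflectionlessRHPSolution ζ v Pp Pm) {z : ℂ} {k : Fin N}
    (hz : z = ζ k ∨ z = -ζ k) : Pp z * numMinus a b z = 0 := by
  have h1 : Pp (ζ k) * numMinus a b (ζ k) = 0 := by
    refine h.mul_numMinus_eq_zero hv k ?_
    have : v k ∈ LinearMap.ker (Pp (ζ k)).mulVecLin := by
      rw [hP.kernel k]
      exact Submodule.mem_span_singleton_self _
    simpa using this
  rcases hz with rfl | rfl
  · exact h1
  · rw [hP.symm_neg _ (Or.inl (hζ.mem_C13 k)), numMinus_neg]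
    calc σ₃ * Pp (ζ k) * σ₃ * (σ₃ * numMinus a b (ζ k) * σ₃)
        = σ₃ * (Pp (ζ k) * ((σ₃ * σ₃) * numMinus a b (ζ k))) * σ₃ := by
          simp only [Matrix.mul_assoc]
      _ = 0 := by rw [σ₃_mul_self, Matrix.one_mul, h1, Matrix.mul_zero, Matrix.zero_mul]

end Uniqueness

/-! ### A matrix form of the reflection argument -/

section Unitary

/-- A matrix on the first quadrant that is bounded near infinity together with the inverse of its
determinant, unitary on the boundary up to a sign, and normalized at the origin, is the identity. -/
lemma eq_one_of_unitary {Φ : ℂ → Matrix (Fin 2) (Fin 2) ℂ} {δ : ℂ → ℂ}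
    (hd : ∀ i j, DifferentiableOn ℂ (fun z => Φ z i j) quadrant)
    (hc : ∀ i j, ContinuousOn (fun z => Φ z i j) closedQuadrant)
    (hO : ∀ i j, (fun z => Φ z i j) =O[Bornology.cobounded ℂ ⊓ 𝓟 quadrant] fun _ => (1 : ℝ))
    (hδd : DifferentiableOn ℂ δ quadrant) (hδc : ContinuousOn δ closedQuadrant)
    (hδO : δ =O[Bornology.cobounded ℂ ⊓ 𝓟 quadrant] fun _ => (1 : ℝ))
    (h0 : Φ 0 = 1)
    (hu : ∀ z ∈ contour, z ∈ closedQuadrant → (Φ z).det * δ z = 1 ∧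
      ∃ τ : ℂ, τ * τ = 1 ∧
        Φ z * (Matrix.diagonal ![1, τ] * (Φ z)ᴴ * Matrix.diagonal ![1, τ]) = 1) :
    ∀ z ∈ closedQuadrant, Φ z = 1 := by
  have h0c : (0 : ℂ) ∈ contour := by simp [contour]
  have h0q : (0 : ℂ) ∈ closedQuadrant := by simp [mem_reProdIm]
  have hδ0 : δ 0 = 1 := by
    have := (hu 0 h0c h0q).1
    rwa [h0, Matrix.det_one, one_mul] at this
  -- On the axes the analytic function Φ_jj δ is the conjugate of Φ_ii, so their sum and i times
  -- their difference are real there, hence constant; the values at 0 determine both.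
  have key : ∀ i j, (∀ z ∈ contour, z ∈ closedQuadrant → Φ z j j * δ z = conj (Φ z i i)) →
      ∀ z ∈ closedQuadrant, Φ z i i = 1 := by
    intro i j hij z hz
    have hmO : (fun z => Φ z j j * δ z) =O[Bornology.cobounded ℂ ⊓ 𝓟 quadrant]
        fun _ => (1 : ℝ) := by simpa using (hO j j).mul hδO
    have h1 := eq_of_real_on_axes (f := fun z => Φ z i i + Φ z j j * δ z)
      ((hd i i).add ((hd j j).mul hδd)) ((hc i i).add ((hc j j).mul hδc))
      ((hO i i).add hmO) (fun z hz hz' => by simp [hij z hz hz']) z hz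
    have h2 := eq_of_real_on_axes (f := fun z => I * (Φ z i i - Φ z j j * δ z))
      (((hd i i).sub ((hd j j).mul hδd)).const_mul I)
      (continuousOn_const.mul ((hc i i).sub ((hc j j).mul hδc)))
      (((hO i i).sub hmO).const_mul_left I) (fun z hz hz' => by simp [hij z hz hz']) z hz
    simp only [h0, hδ0, Matrix.one_apply_eq, mul_one, sub_self, mul_zero, mul_eq_zero, I_ne_zero,
      false_or] at h1 h2
    linear_combination (1 / 2) * h1 + (1 / 2) * h2
  have hrel : ∀ z ∈ contour, z ∈ closedQuadrant → Φ z 1 1 * δ z = conj (Φ z 0 0) ∧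
      Φ z 0 0 * δ z = conj (Φ z 1 1) := fun z hz hz' => by
    obtain ⟨h1, τ, hτ, h2⟩ := hu z hz hz'
    obtain ⟨-, h3, h4, -⟩ := unitary_relations h2
    rw [hτ, one_mul] at h4
    constructor
    · linear_combination -δ z * h3 + conj (Φ z 0 0) * h1
    · linear_combination -δ z * h4 + conj (Φ z 1 1) * h1
  have h00 := key 0 1 fun z hz hz' => (hrel z hz hz').1
  have h11 := key 1 0 fun z hz hz' => (hrel z hz hz').2
  -- With unit diagonal the determinant is 1, so Φ₀₁Φ₁₀ = 0; since Φ₀₁ = -τ conj Φ₁₀, both vanish.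
  have hoff : ∀ z ∈ contour, z ∈ closedQuadrant → Φ z 0 1 = 0 ∧ Φ z 1 0 = 0 := by
    intro z hz hz'
    obtain ⟨-, τ, hτ, h2⟩ := hu z hz hz'
    obtain ⟨-, h3, -, h4⟩ := unitary_relations h2
    rw [h00 z hz', h11 z hz', map_one, one_mul] at h3
    rw [h3, mul_one] at h4
    rw [Matrix.det_fin_two, h00 z hz', h11 z hz'] at h3
    have h5 : conj (Φ z 1 0) * Φ z 1 0 = 0 := by
      linear_combination τ * h3 + τ * Φ z 1 0 * h4 - conj (Φ z 1 0) * Φ z 1 0 * hτ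
    have h6 : Φ z 1 0 = 0 := by simpa using h5
    refine ⟨?_, h6⟩
    rw [h6, map_zero, mul_zero] at h4
    exact neg_eq_zero.1 h4.symm
  have h01 := eq_zero_of_zero_on_axes (hd 0 1) (hc 0 1) (hO 0 1) fun z hz hz' => (hoff z hz hz').1
  have h10 := eq_zero_of_zero_on_axes (hd 1 0) (hc 1 0) (hO 1 0) fun z hz hz' => (hoff z hz hz').2
  intro z hz
  ext i j
  fin_cases i <;> fin_cases j
  · exact h00 z hz
  · exact h01 z hz
  · exact h10 z hz
  · exact h11 z hz

end Unitary

/-! ### Uniqueness of the Riemann-Hilbert solution -/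

section Uniqueness

variable {N : ℕ} {ζ : Fin N → ℂ} {v : Fin N → Fin 2 → ℂ} {a b : ℂ[X]}
  {Pp Pm : ℂ → Matrix (Fin 2) (Fin 2) ℂ}

lemma IsDressing.exists_tendsto_dressMinus (hζ : IsSpectrum ζ) (h : IsDressing ζ v a b)
    (i j : Fin 2) :
    ∃ l, Tendsto (fun z => dressMinus ζ a b z i j) (Bornology.cobounded ℂ) (𝓝 l) := by
  have hd : (conjPoly (polePoly ζ)).coeff N ≠ 0 := by
    rw [coeff_conjPoly]
    simpa using hζ.coeff_polePoly_ne_zero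
  have hd' : (conjPoly (polePoly ζ)).natDegree ≤ N :=
    (natDegree_conjPoly _).trans_le hζ.natDegree_polePoly.le
  have hb : (conjPoly b).degree < N := (degree_conjPoly b).trans_lt h.degree_lt
  fin_cases i <;> fin_cases j
  · exact ⟨_, tendsto_eval_sq_div_eval_sq ((natDegree_conjPoly a).trans_le h.natDegree_le) hd' hd⟩
  · exact ⟨_, by simpa [dressMinus, neg_div] using
      (tendsto_mul_eval_sq_div_eval_sq h.degree_lt hd' hd).neg⟩
  · exact ⟨_, tendsto_mul_eval_sq_div_eval_sq hb hd' hd⟩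
  · exact ⟨_, tendsto_eval_sq_div_eval_sq h.natDegree_le hd' hd⟩

lemma IsDressing.numMinus_mul_dressPlus (hζ : IsSpectrum ζ) (hv : ∀ k, v k ≠ 0)
    (h : IsDressing ζ v a b) {z : ℂ} (hz : (polePoly ζ).eval (z ^ 2) ≠ 0) :
    numMinus a b z * dressPlus ζ a b z = (conjPoly (polePoly ζ)).eval (z ^ 2) • 1 := by
  have h1 := h.eval_detPoly_eq hζ hv z
  ext i j
  fin_cases i <;> fin_cases j <;>
  · simp only [numMinus, dressPlus, Matrix.mul_apply, Fin.sum_univ_two, Matrix.of_apply,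
      Matrix.cons_val', Matrix.cons_val_zero, Matrix.cons_val_one, Matrix.cons_val_fin_one,
      Fin.zero_eta, Fin.mk_one, Matrix.one_apply_eq, ne_eq, zero_ne_one, one_ne_zero,
      not_false_eq_true, Matrix.one_apply_ne, Matrix.smul_apply, smul_eq_mul]
    field_simp
    first | linear_combination h1 | ring

lemma IsSpectrum.deriv_conjPoly_polePoly_ne_zero (hζ : IsSpectrum ζ) {k : Fin N} {z : ℂ}
    (hz : z = ζ k ∨ z = -ζ k) :
    deriv (fun z => (conjPoly (polePoly ζ)).eval (z ^ 2)) z ≠ 0 := by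
  have h1 := HasDerivAt.comp z ((conjPoly (polePoly ζ)).hasDerivAt (z ^ 2)) (hasDerivAt_pow 2 z)
  have h2 : z ^ 2 = ζ k ^ 2 := sq_eq_sq_iff_eq_or_eq_neg.2 hz
  have hz0 : z ≠ 0 := fun h0 => hζ.ne_zero k (by simpa [h0] using h2.symm)
  change deriv ((fun y => (conjPoly (polePoly ζ)).eval y) ∘ fun z => z ^ 2) z ≠ 0
  rw [h1.deriv, h2]
  simpa [hz0] using hζ.eval_derivative_conjPoly_polePoly_ne_zero k

lemma IsReflectionlessRHPSolution.det_ne_zero_of_mem_contour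
    (hP : IsReflectionlessRHPSolution ζ v Pp Pm) {z : ℂ} (hz : z ∈ contour) : (Pp z).det ≠ 0 :=
  Matrix.det_ne_zero_of_left_inverse (hP.jump z hz)

lemma IsReflectionlessRHPSolution.continuousOn_apply
    (hP : IsReflectionlessRHPSolution ζ v Pp Pm) (i j : Fin 2) :
    ContinuousOn (fun z => Pp z i j) closedQuadrant :=
  continuousOn_pi.1 (continuousOn_pi.1 (hP.continuous_pos.mono closedQuadrant_subset) i) j

lemma IsReflectionlessRHPSolution.differentiableOn_apply
    (hP : IsReflectionlessRHPSolution ζ v Pp Pm) (i j : Fin 2) :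
    DifferentiableOn ℂ (fun z => Pp z i j) quadrant :=
  (hP.analytic_pos i j).mono quadrant_subset_C13

/-- On the closed first quadrant every solution is a left multiple of the adjugate dressing
matrix, with the expected scalar product. -/
lemma IsReflectionlessRHPSolution.mul_numMinus_eq (hζ : IsSpectrum ζ) (hv : ∀ k, v k ≠ 0)
    (h : IsDressing ζ v a b) (hP : IsReflectionlessRHPSolution ζ v Pp Pm) :
    ∀ z ∈ closedQuadrant,
      Pp z * numMinus a b z = (conjPoly (polePoly ζ)).eval (z ^ 2) • 1 := by
  classical
  have hD := h.isReflectionlessRHPSolution hζ hv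
  -- The zeros ±ζ_k lying in the first quadrant; a given ζ_k may itself be in the third one.
  set S : Finset ℂ := (Finset.univ.image ζ ∪ Finset.univ.image (-ζ)).filter (· ∈ quadrant)
    with hS
  have hmemS : ∀ c, c ∈ S ↔ (∃ k, c = ζ k ∨ c = -ζ k) ∧ c ∈ quadrant := fun c => by
    simp only [hS, Finset.mem_filter, Finset.mem_union, Finset.mem_image, Finset.mem_univ,
      true_and, Pi.neg_apply, ← exists_or, eq_comm]
  have hSq : ∀ c ∈ S, c ∈ quadrant := fun c hc => ((hmemS c).1 hc).2
  have hcontS : ∀ z ∈ contour, z ∉ S := fun z hz hzS =>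
    (ne_of_gt (quadrant_subset_C13 (hSq z hzS)) : z.re * z.im ≠ 0) hz
  have hquad : ∀ z ∈ closedQuadrant, z ∈ contour ∨ z ∈ quadrant := by
    intro z hz
    by_cases hc : z ∈ contour
    · exact Or.inl hc
    · have h1 : z.re ≠ 0 ∧ z.im ≠ 0 := by simpa [contour] using hc
      exact Or.inr ⟨lt_of_le_of_ne hz.1 h1.1.symm, lt_of_le_of_ne hz.2 h1.2.symm⟩
  set d : ℂ → ℂ := fun z => (polePoly ζ).eval (z ^ 2) with hd
  set E : ℂ → ℂ := fun z => (conjPoly (polePoly ζ)).eval (z ^ 2) with hE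
  have hd0 : ∀ z ∈ closedQuadrant, d z ≠ 0 := fun z hz =>
    hζ.polePoly_ne_zero (closedQuadrant_subset hz)
  have hE0 : ∀ z ∈ closedQuadrant, z ∉ S → E z ≠ 0 := by
    intro z hz hzS h0
    obtain ⟨k, hk⟩ := hζ.eval_conjPoly_polePoly_eq_zero_iff.1 h0
    have hk' := sq_eq_sq_iff_eq_or_eq_neg.1 hk
    rcases hquad z hz with hc | hq
    · have : z ∈ C13 := by
        rcases hk' with rfl | rfl
        exacts [hζ.mem_C13 k, neg_mem_C13 (hζ.mem_C13 k)]
      exact (ne_of_gt this : z.re * z.im ≠ 0) hc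
    · exact hzS ((hmemS z).2 ⟨⟨k, hk'⟩, hq⟩)
  have hdet0 : ∀ z ∈ closedQuadrant, z ∉ S → (Pp z).det ≠ 0 := by
    intro z hz hzS h0
    rcases hquad z hz with hc | hq
    · exact hP.det_ne_zero_of_mem_contour hc h0
    · exact hzS ((hmemS z).2 ⟨(hP.zeros z (quadrant_subset_C13 hq)).1 h0, hq⟩)
  have hprod : ∀ z, z ∉ S → ∏ c ∈ S, (z - c) ≠ 0 := fun z hz =>
    Finset.prod_ne_zero_iff.2 fun c hc => sub_ne_zero.2 fun hzc => hz (hzc ▸ hc)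
  have hfac : ∀ i j, ∃ g : ℂ → ℂ, DifferentiableOn ℂ g quadrant ∧
      ContinuousOn g closedQuadrant ∧
        ∀ z, (Pp z * numMinus a b z) i j = (∏ c ∈ S, (z - c)) * g z := by
    intro i j
    refine exists_eq_prod_mul S (fun z => (Pp z * numMinus a b z) i j) hSq ?_ ?_ ?_
    · simp only [Matrix.mul_apply, Fin.sum_univ_two]
      exact ((hP.differentiableOn_apply i 0).mul (differentiable_numMinus 0 j).differentiableOn).add
        ((hP.differentiableOn_apply i 1).mul (differentiable_numMinus 1 j).differentiableOn)
    · simp only [Matrix.mul_apply, Fin.sum_univ_two]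
      exact ((hP.continuousOn_apply i 0).mul
          (differentiable_numMinus 0 j).continuous.continuousOn).add
        ((hP.continuousOn_apply i 1).mul (differentiable_numMinus 1 j).continuous.continuousOn)
    · intro c hc
      obtain ⟨k, hk⟩ := ((hmemS c).1 hc).1
      rw [hP.mul_numMinus_eq_zero hζ hv h hk, Matrix.zero_apply]
  choose g hgd hgc hg using hfac
  obtain ⟨e, hed, hec, he⟩ := exists_eq_prod_mul S E hSq
    (differentiable_eval_sq _).differentiableOn (differentiable_eval_sq _).continuous.continuousOn
    fun c hc => by
      obtain ⟨k, hk⟩ := ((hmemS c).1 hc).1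
      exact hζ.eval_conjPoly_polePoly_eq_zero_iff.2 ⟨k, sq_eq_sq_iff_eq_or_eq_neg.2 hk⟩
  obtain ⟨p, hpd, hpc, hp⟩ := exists_eq_prod_mul S (fun z => (Pp z).det) hSq
    (by
      simp only [Matrix.det_fin_two]
      exact ((hP.differentiableOn_apply 0 0).mul (hP.differentiableOn_apply 1 1)).sub
        ((hP.differentiableOn_apply 0 1).mul (hP.differentiableOn_apply 1 0)))
    (by
      simp only [Matrix.det_fin_two]
      exact ((hP.continuousOn_apply 0 0).mul (hP.continuousOn_apply 1 1)).sub
        ((hP.continuousOn_apply 0 1).mul (hP.continuousOn_apply 1 0)))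
    fun c hc => (hP.zeros c (quadrant_subset_C13 (hSq c hc))).2 ((hmemS c).1 hc).1
  -- Simplicity of the zeros makes the cofactor nonzero at the points of S as well; likewise for the
  -- determinant of the given solution below.
  have he0 : ∀ z ∈ closedQuadrant, e z ≠ 0 := by
    intro z hz
    by_cases hzS : z ∈ S
    · obtain ⟨k, hk⟩ := ((hmemS z).1 hzS).1
      exact ne_zero_of_deriv_ne_zero hed he hzS (hSq z hzS) (hζ.deriv_conjPoly_polePoly_ne_zero hk)
    · have := hE0 z hz hzS
      rw [he z] at this
      exact right_ne_zero_of_mul this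
  have hp0 : ∀ z ∈ closedQuadrant, p z ≠ 0 := by
    intro z hz
    by_cases hzS : z ∈ S
    · obtain ⟨k, hk⟩ := ((hmemS z).1 hzS).1
      refine ne_zero_of_deriv_ne_zero hpd hp hzS (hSq z hzS) ?_
      rcases hk with rfl | rfl
      exacts [(hP.simple k).1, (hP.simple k).2]
    · have := hdet0 z hz hzS
      rw [hp z] at this
      exact right_ne_zero_of_mul this
  -- Φ is the quotient of the two solutions with the singularities at S removed, and δ continues the
  -- inverse of its determinant.
  set Φ : ℂ → Matrix (Fin 2) (Fin 2) ℂ := fun z => Matrix.of fun i j => g i j z / e z with hΦ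
  set δ : ℂ → ℂ := fun z => e z / (p z * d z) with hδ
  have hΦeq : ∀ z ∈ closedQuadrant, z ∉ S → Φ z = Pp z * dressMinus ζ a b z := by
    intro z hz hzS
    rw [dressMinus_eq, Matrix.mul_smul]
    ext i j
    rw [Matrix.smul_apply, hg, smul_eq_mul, show eval (z ^ 2) (conjPoly (polePoly ζ)) = _ from he z]
    have h1 := hprod z hzS
    have h2 := he0 z hz
    simp only [hΦ, Matrix.of_apply]
    field_simp
  have hδeq : ∀ z, z ∉ S → δ z = E z / d z * ((Pp z).det)⁻¹ := by
    intro z hzS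
    rw [he z, hp z, ← div_eq_mul_inv, div_div, mul_left_comm (d z), mul_div_mul_left _ _
      (hprod z hzS), mul_comm (d z)]
  have hmono : Bornology.cobounded ℂ ⊓ 𝓟 quadrant ≤
      Bornology.cobounded ℂ ⊓ 𝓟 (C13 ∪ contour) :=
    inf_le_inf_left _ (principal_mono.2 (quadrant_subset_C13.trans Set.subset_union_left))
  have hev : ∀ᶠ z in Bornology.cobounded ℂ ⊓ 𝓟 quadrant, z ∈ closedQuadrant ∧ z ∉ S := by
    have h1 : ∀ᶠ z in Bornology.cobounded ℂ, z ∉ S :=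
      (S.finite_toSet.isBounded : Bornology.IsBounded (S : Set ℂ))
    filter_upwards [h1.filter_mono inf_le_left, mem_inf_of_right (mem_principal_self _)] with z h2 h3
      using ⟨quadrant_subset_closedQuadrant h3, h2⟩
  obtain ⟨L, hL0, hL⟩ := hP.at_infinity
  have hLij : ∀ i j, Tendsto (fun z => Pp z i j) (Bornology.cobounded ℂ ⊓ 𝓟 quadrant)
      (𝓝 (L i j)) := fun i j =>
    tendsto_pi_nhds.1 (tendsto_pi_nhds.1 (hL.mono_left hmono) i) j
  have hone : ∀ z ∈ closedQuadrant, Φ z = 1 := by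
    refine eq_one_of_unitary (δ := δ) (fun i j => (hgd i j).div hed fun z hz =>
        he0 z (quadrant_subset_closedQuadrant hz)) (fun i j => (hgc i j).div hec he0) ?_
      (hed.div (hpd.mul (differentiable_eval_sq _).differentiableOn) fun z hz =>
        mul_ne_zero (hp0 z (quadrant_subset_closedQuadrant hz))
          (hd0 z (quadrant_subset_closedQuadrant hz)))
      (hec.div (hpc.mul (differentiable_eval_sq _).continuous.continuousOn) fun z hz =>
        mul_ne_zero (hp0 z hz) (hd0 z hz)) ?_ ?_ ?_
    · intro i j
      obtain ⟨l, hl⟩ := h.exists_tendsto_dressMinus hζ 0 j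
      obtain ⟨l', hl'⟩ := h.exists_tendsto_dressMinus hζ 1 j
      have h1 := ((hLij i 0).mul (hl.mono_left inf_le_left)).add
        ((hLij i 1).mul (hl'.mono_left inf_le_left))
      refine Tendsto.isBigO_one ℝ (h1.congr' ?_)
      filter_upwards [hev] with z hz
      rw [hΦeq z hz.1 hz.2, Matrix.mul_apply, Fin.sum_univ_two]
    · have h1 : Tendsto (fun z => (Pp z).det) (Bornology.cobounded ℂ ⊓ 𝓟 quadrant) (𝓝 L.det) :=
        ((continuous_id.matrix_det).tendsto L).comp (hL.mono_left hmono)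
      have h2 : Tendsto (fun z => E z / d z) (Bornology.cobounded ℂ ⊓ 𝓟 quadrant) _ :=
        (tendsto_eval_sq_div_eval_sq ((natDegree_conjPoly _).trans_le hζ.natDegree_polePoly.le)
          hζ.natDegree_polePoly.le hζ.coeff_polePoly_ne_zero).mono_left inf_le_left
      refine Tendsto.isBigO_one ℝ ((h2.mul (h1.inv₀ hL0)).congr' ?_)
      filter_upwards [hev] with z hz using (hδeq z hz.2).symm
    · have h0c : (0 : ℂ) ∈ contour := by simp [contour]
      rw [hΦeq 0 (by simp [mem_reProdIm]) (hcontS 0 h0c), hP.normalization_pos,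
        hD.normalization_neg, Matrix.one_mul]
    · intro z hz hz'
      have hzS := hcontS z hz
      have hDd := h.det_dressPlus hζ hv (hd0 z hz')
      have hDj := congrArg Matrix.det (hD.jump z hz)
      rw [Matrix.det_mul, Matrix.det_one, hDd] at hDj
      constructor
      · rw [hδeq z hzS, hΦeq z hz' hzS, Matrix.det_mul]
        have h1 := hdet0 z hz' hzS
        field_simp
        rwa [← mul_div_assoc] at hDj
      · obtain ⟨τ, hτ, hτc, hsign⟩ := IsReflectionlessRHPSolution.exists_sign hz
        refine ⟨τ, hτ, ?_⟩
        set T : Matrix (Fin 2) (Fin 2) ℂ := Matrix.diagonal ![1, τ] with hT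
        have hTT : T * T = 1 := by
          rw [hT, Matrix.diagonal_mul_diagonal]
          ext i j
          fin_cases i <;> fin_cases j <;> simp [hτ]
        have hTc : Tᴴ = T := by
          rw [hT, Matrix.diagonal_conjTranspose]
          ext i j
          fin_cases i <;> fin_cases j <;> simp [hτc]
        have h1 := hsign hP
        have h2 : (dressMinus ζ a b z)ᴴ = T * dressPlus ζ a b z * T := by
          rw [hsign hD, Matrix.conjTranspose_mul, Matrix.conjTranspose_mul, hTc,
            Matrix.conjTranspose_conjTranspose, Matrix.mul_assoc]
        have h3 := mul_eq_one_comm.1 (hP.jump z hz)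
        have h4 := hD.jump z hz
        rw [hΦeq z hz' hzS, Matrix.conjTranspose_mul, h2]
        -- The sign twist is the same for both solutions, so the inner factors T cancel and the two
        -- jump relations apply in turn.
        calc Pp z * dressMinus ζ a b z * (T * (T * dressPlus ζ a b z * T * (Pp z)ᴴ) * T)
            = Pp z * dressMinus ζ a b z * ((T * T) * dressPlus ζ a b z * (T * (Pp z)ᴴ * T)) := by
              simp only [Matrix.mul_assoc]
          _ = Pp z * ((dressMinus ζ a b z * dressPlus ζ a b z) * (T * (Pp z)ᴴ * T)) := by
              rw [hTT]
              simp only [Matrix.mul_assoc, Matrix.one_mul]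
          _ = 1 := by rw [h4, ← h1, Matrix.one_mul, h3]
  intro z hz
  ext i j
  have h1 : g i j z / e z = (1 : Matrix (Fin 2) (Fin 2) ℂ) i j :=
    congrFun (congrFun (hone z hz) i) j
  rw [div_eq_iff (he0 z hz)] at h1
  rw [hg, h1, Matrix.smul_apply, smul_eq_mul,
    show eval (z ^ 2) (conjPoly (polePoly ζ)) = _ from he z]
  ring

/-- The dressing matrix is the only solution of the reflectionless Riemann-Hilbert problem. -/
theorem IsReflectionlessRHPSolution.eq_dressPlus (hζ : IsSpectrum ζ)
    (hv : ∀ k, v k ≠ 0) (h : IsDressing ζ v a b) (hP : IsReflectionlessRHPSolution ζ v Pp Pm)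
    {z : ℂ} (hz : z ∈ C13 ∪ contour) : Pp z = dressPlus ζ a b z := by
  have hD := h.isReflectionlessRHPSolution hζ hv
  have hoff : ∀ z ∈ closedQuadrant, (conjPoly (polePoly ζ)).eval (z ^ 2) ≠ 0 →
      Pp z = dressPlus ζ a b z := by
    intro z hz h0
    have h1 := hP.mul_numMinus_eq hζ hv h z hz
    have h2 := h.numMinus_mul_dressPlus hζ hv (hζ.polePoly_ne_zero (closedQuadrant_subset hz))
    have h3 := congrArg (Pp z * ·) h2
    simp only [← Matrix.mul_assoc, h1, Matrix.smul_mul, Matrix.mul_smul, Matrix.one_mul,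
      Matrix.mul_one] at h3
    exact (smul_right_injective _ h0 h3).symm
  have hcl : ∀ z ∈ closedQuadrant, Pp z = dressPlus ζ a b z := by
    intro z hz
    by_cases h0 : (conjPoly (polePoly ζ)).eval (z ^ 2) = 0
    · obtain ⟨k, hk⟩ := hζ.eval_conjPoly_polePoly_eq_zero_iff.1 h0
      have hk' := sq_eq_sq_iff_eq_or_eq_neg.1 hk
      have hzC : z ∈ C13 := by
        rcases hk' with rfl | rfl
        exacts [hζ.mem_C13 k, neg_mem_C13 (hζ.mem_C13 k)]
      have h1 : z.re * z.im ≠ 0 := ne_of_gt hzC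
      have hq : z ∈ quadrant := ⟨lt_of_le_of_ne hz.1 (left_ne_zero_of_mul h1).symm,
        lt_of_le_of_ne hz.2 (right_ne_zero_of_mul h1).symm⟩
      have hnhds : C13 ∪ contour ∈ 𝓝 z :=
        mem_of_superset (isOpen_C13.mem_nhds hzC) Set.subset_union_left
      -- At a zero the product identity cannot be divided, but the zero is isolated and both sides
      -- are continuous.
      have hne : ∀ᶠ w in 𝓝[≠] z, (conjPoly (polePoly ζ)).eval (w ^ 2) ≠ 0 :=
        (differentiable_eval_sq _ z).hasDerivAt.eventually_ne
          (hζ.deriv_conjPoly_polePoly_ne_zero hk')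
      refine tendsto_nhds_unique (f := Pp) (l := 𝓝[≠] z)
        ((hP.continuous_pos.continuousAt hnhds).tendsto.mono_left nhdsWithin_le_nhds)
        (((hD.continuous_pos.continuousAt hnhds).tendsto.mono_left nhdsWithin_le_nhds).congr' ?_)
      filter_upwards [hne, mem_nhdsWithin_of_mem_nhds (isOpen_quadrant.mem_nhds hq)] with w hw hwq
        using (hoff w (quadrant_subset_closedQuadrant hwq) hw).symm
    · exact hoff z hz h0
  -- The closed domain is the closed first quadrant together with its negative, which the symmetry
  -- under z ↦ -z covers.
  have hz0 : 0 ≤ z.re * z.im := hz.elim (fun h => le_of_lt h) fun h => le_of_eq (Eq.symm h)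
  rcases mul_nonneg_iff.1 hz0 with h1 | h1
  · exact hcl z h1
  · have h2 : -z ∈ closedQuadrant := by simpa [mem_reProdIm] using h1
    have h3 := closedQuadrant_subset h2
    rw [← neg_neg z, hP.symm_neg _ h3, hD.symm_neg _ h3, hcl _ h2]

end Uniqueness

/-! ### Expansion at the origin and recovery of the potential -/

section Expansion

/-- A first-order estimate in λ becomes second-order in z after substituting λ = z². -/
lemma isBigO_eval_sq_div_sub (p : ℂ[X]) {d : ℂ[X]} (hd : d.eval 0 = 1) :
    (fun z : ℂ => p.eval (z ^ 2) / d.eval (z ^ 2) - p.eval 0) =O[𝓝 0] fun z => z ^ 2 := by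
  have h1 : DifferentiableAt ℂ (fun w => p.eval w / d.eval w) 0 :=
    p.differentiableAt.fun_div d.differentiableAt (by rw [hd]; exact one_ne_zero)
  have h2 := h1.isBigO_sub
  have h3 : Tendsto (fun z : ℂ => z ^ 2) (𝓝 0) (𝓝 0) := by
    simpa using (continuous_pow 2).tendsto (0 : ℂ)
  simpa [Function.comp_def, hd] using h2.comp_tendsto h3

lemma isBigO_mul_eval_sq_div_sub (p : ℂ[X]) {d : ℂ[X]} (hd : d.eval 0 = 1) :
    (fun z : ℂ => z * p.eval (z ^ 2) / d.eval (z ^ 2) - z * p.eval 0) =O[𝓝 0]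
      fun z => z ^ 2 := by
  have h1 : (fun z : ℂ => z) =O[𝓝 0] fun _ => (1 : ℂ) :=
    (continuous_id.tendsto (0 : ℂ)).isBigO_one ℂ
  simpa [mul_sub, mul_div_assoc] using h1.mul (isBigO_eval_sq_div_sub p hd)

variable {N : ℕ} {ζ : Fin N → ℂ} {v : Fin N → Fin 2 → ℂ} {a b : ℂ[X]}

/-- The coefficient of `z` in the expansion of the dressing matrix at the origin. -/
def dressSlope (b : ℂ[X]) : Matrix (Fin 2) (Fin 2) ℂ := !![0, b.coeff 0; -conj (b.coeff 0), 0]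

lemma IsDressing.isBigO_dressPlus_sub (hζ : IsSpectrum ζ) (h : IsDressing ζ v a b) (i j : Fin 2) :
    (fun z : ℂ => dressPlus ζ a b z i j - (1 : Matrix (Fin 2) (Fin 2) ℂ) i j -
      z * dressSlope b i j) =O[𝓝 0] fun z => z ^ 2 := by
  have hd := hζ.polePoly_zero
  have ha : (conjPoly a).eval 0 = 1 := by simp [eval_conjPoly, h.eval_zero]
  have hb : (conjPoly b).eval 0 = conj (b.coeff 0) := by
    simp [eval_conjPoly, coeff_zero_eq_eval_zero]
  fin_cases i <;> fin_cases j
  · simpa [dressPlus, dressSlope, h.eval_zero] using isBigO_eval_sq_div_sub a hd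
  · simpa [dressPlus, dressSlope, coeff_zero_eq_eval_zero] using isBigO_mul_eval_sq_div_sub b hd
  · have h1 := (isBigO_mul_eval_sq_div_sub (conjPoly b) hd).neg_left
    rw [hb] at h1
    simpa [dressPlus, dressSlope, neg_div, sub_eq_add_neg, add_comm] using h1
  · simpa [dressPlus, dressSlope, ha] using isBigO_eval_sq_div_sub (conjPoly a) hd

lemma hasDerivAt_dressSlope {α β : Fin N → ℂ} (hζ : IsSpectrum ζ)
    (hαβ : ∀ k, α k ≠ 0 ∨ β k ≠ 0) (x t : ℝ) (i j : Fin 2) :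
    HasDerivAt (fun y : ℝ => dressSlope (solB ζ α β y t) i j)
      (potentialMatrix (solitonPotential ζ α β x t) i j) x := by
  have h1 := hasDerivAt_partialX (contDiff_coeff_solB hζ hαβ 0) x t
  rw [← solitonPotential_eq_partialX hζ hαβ] at h1
  fin_cases i <;> fin_cases j
  · exact hasDerivAt_const x (0 : ℂ)
  · exact h1
  · exact (hasDerivAt_conj h1).fun_neg
  · exact hasDerivAt_const x (0 : ℂ)

end Expansion

end

end HigherKN

/-! ### The main theorem -/

theorem mainTheorem1 (N : ℕ) (ζ a b : Fin N → ℂ)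
    (hζ : ∀ k, ζ k ∈ HigherKN.C13)
    (hdistinct : ∀ j k, j ≠ k → ζ j ≠ ζ k ∧ ζ j ≠ -ζ k)
    (hab : ∀ k, a k ≠ 0 ∨ b k ≠ 0) :
    -- the closed forms make sense everywhere and agree
    (∀ x t : ℝ, ∀ v : Fin N → Fin 2 → ℂ,
      (v = fun k => HigherKN.kernelVector (ζ k) (a k) (b k) x t) →
        (HigherKN.matM ζ v).det ≠ 0 ∧
        (HigherKN.matM ζ v).det + 2 * (HigherKN.matG ζ v).det ≠ 0 ∧
        HigherKN.sumDenominator ζ v ≠ 0 ∧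
        HigherKN.detQuotient ζ v =
          (HigherKN.sumDenominator ζ v)⁻¹ * HigherKN.sumNumerator ζ v) ∧
    -- the reflectionless Riemann-Hilbert problem with these data is solvable
    (∀ x t : ℝ, ∃ Pp Pm : ℂ → Matrix (Fin 2) (Fin 2) ℂ,
      HigherKN.IsReflectionlessRHPSolution ζ
        (fun k => HigherKN.kernelVector (ζ k) (a k) (b k) x t) Pp Pm) ∧
    -- the potential recovered from any solution through `Q = (P⁽¹⁾)_x` is the closed form, and
    -- the solution is the Jost matrix of that potential
    (∀ Pp Pm : ℝ → ℝ → ℂ → Matrix (Fin 2) (Fin 2) ℂ,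
      (∀ x t : ℝ, HigherKN.IsReflectionlessRHPSolution ζ
        (fun k => HigherKN.kernelVector (ζ k) (a k) (b k) x t) (Pp x t) (Pm x t)) →
      (∃ P₁ : ℝ → ℝ → Matrix (Fin 2) (Fin 2) ℂ,
        (∀ (x t : ℝ) (i j : Fin 2),
          (fun z : ℂ => Pp x t z i j - (1 : Matrix (Fin 2) (Fin 2) ℂ) i j - z * P₁ x t i j)
            =O[𝓝[HigherKN.C13 ∪ HigherKN.contour] 0] (fun z : ℂ => z ^ 2)) ∧
        (∀ (x t : ℝ) (i j : Fin 2),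
          HasDerivAt (fun y : ℝ => P₁ y t i j)
            (HigherKN.potentialMatrix (HigherKN.solitonPotential ζ a b x t) i j) x)) ∧
      ((∀ k, a k ≠ 0 ∧ b k ≠ 0) → ∀ t : ℝ,
        HigherKN.IsJostMatrix (fun x => HigherKN.solitonPotential ζ a b x t)
          (fun x => Pp x t))) ∧
    -- the potential is reflectionless
    ((∀ k, a k ≠ 0 ∧ b k ≠ 0) → ∀ t : ℝ,
      HigherKN.IsReflectionless (fun x => HigherKN.solitonPotential ζ a b x t)) ∧
    -- it is a smooth, rapidly decreasing solution of the higher-order Kaup-Newell equation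
    ContDiff ℝ ∞ (fun p : ℝ × ℝ => HigherKN.solitonPotential ζ a b p.1 p.2) ∧
    (∀ t : ℝ, HigherKN.RapidlyDecreasing (fun x => HigherKN.solitonPotential ζ a b x t)) ∧
    HigherKN.SolvesHigherOrderKN (HigherKN.solitonPotential ζ a b) := by
  have hS := HigherKN.isSpectrum_of_mem hζ hdistinct
  have hv := HigherKN.kernelVectors_ne_zero (ζ := ζ) hab
  have hD := HigherKN.isDressing_sol hS hab
  refine ⟨?_, fun x t => ⟨_, _, (hD x t).isReflectionlessRHPSolution hS (hv x t)⟩, ?_,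
    fun hab' => HigherKN.isReflectionless_solitonPotential hS hab',
    HigherKN.contDiff_solitonPotential hS hab, HigherKN.rapidlyDecreasing_solitonPotential hS hab,
    HigherKN.solvesHigherOrderKN_solitonPotential hS hab⟩
  · rintro x t v rfl
    exact ⟨HigherKN.det_matM_ne_zero hS (hv x t), HigherKN.det_add_ne_zero hS (hv x t),
      HigherKN.sumDenominator_ne_zero hS (hv x t), HigherKN.detQuotient_eq hS (hv x t)⟩
  · intro Pp Pm hP
    -- Uniqueness reduces the claims about an arbitrary family of solutions to the explicit dressing
    -- matrix.
    have heq : ∀ x t : ℝ, ∀ z ∈ HigherKN.C13 ∪ HigherKN.contour, Pp x t z =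
        HigherKN.dressPlus ζ (HigherKN.solA ζ a b x t) (HigherKN.solB ζ a b x t) z :=
      fun x t z hz => (hP x t).eq_dressPlus hS (hv x t) (hD x t) hz
    refine ⟨⟨fun x t => HigherKN.dressSlope (HigherKN.solB ζ a b x t), fun x t i j => ?_,
      HigherKN.hasDerivAt_dressSlope hS hab⟩, fun hab' t z hz => ?_⟩
    · refine (((hD x t).isBigO_dressPlus_sub hS i j).mono nhdsWithin_le_nhds).congr' ?_
        EventuallyEq.rfl
      filter_upwards [self_mem_nhdsWithin] with z hz
      rw [heq x t z hz]
    · have h := HigherKN.isJostMatrix_dressPlus hS hab' t z hz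
      simp only [← heq _ t z hz] at h
      exact h
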